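/- Let $N\ge 1$ and $\nu\ge 1$, and write $x=(x_1,\dots,x_\nu)\in(\mathbb{R}^N)^\nu=\mathbb{R}^{N\nu}$ with Lebesgue measure. The Euclidean group $G={\rm ISO}(N)={\rm SO}(N)\ltimes\mathbb{R}^N$, with elements $g=(k,a)$ acting by $gx=(kx_1+a,\dots,kx_\nu+a)$ and with Haar measure $dg=dk\,da$ ($\int_{{\rm SO}(N)}dk=1$), is represented unitarily on $L^2(\mathbb{R}^{N\nu})$ by $[\ell(g)\psi](x)=\psi(g^{-1}x)$. *Transfer operators.* A transfer operator $\mathbf T$ on $L^2(\mathbb{R}^{N\nu})$ is a bounded positive operator $(\mathbf T\psi)(x)=\int T(x,y)\psi(y)\,dy$ whose kernel is continuous, symmetric, nonnegative, almost everywhere strictly positive and satisfies $\sup_x\int T(x,y)\,dy<\infty$. Assume that $\mathbf T$ commutes with $\ell(g)$ for all $g\in G$. *Ground states.* Let $\mathcal N=\mathbb{R}^{N(\nu-1)}$ with elements $n=(n_2,\dots,n_\nu)$ and Lebesgue measure $dn$. A function $\Omega$ on $\mathbb{R}^{N\nu}$ is also viewed as the function $\Omega(g,n):=\Omega\big(g^{-1}(0,n_2,\dots,n_\nu)\big)$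 on $G\times\mathcal N$. The ground state sector $\mathcal G(\mathbf T)$ consists of the measurable $\Omega$ (modulo null sets) with $$\|\Omega\|_{\infty,2}:=\Big[\int dn\,\big(\operatorname{ess\,sup}_{g}|\Omega(g,n)|\big)^2\Big]^{1/2}<\infty,\qquad \int T(x,y)\,\Omega(y)\,dy=\|\mathbf T\|\,\Omega(x)\ \text{ for a.e. }x .$$ *Equivariance.* For a unitary representation $\pi$ of $G$ on a Hilbert space $H$ and a function $\phi$ with $\int dn\,(\int dg\,|\phi(g,n)|)^2<\infty$ put $\widehat\phi(\pi)(n)=\int dg\,\phi(g,n)\,\pi(g^{-1})$ (weak integral). $\Omega$ is called $\pi$-equivariant if there is a bounded linear functional $L$ on $L^2(\mathcal N,\mathcal K(H))$, $\mathcal K(H)$ the compact operators, such that $\int dn\,dg\,\overline{\Omega(g,n)}\,\phi(g,n)=L(\widehat\phi(\pi))$ for all such $\phi$ for which $\widehat\phi(\pi)$ belongs to $L^2(\mathcal N,\mathcal K(H))$. *Representations.* Let $e_1=(1,0,\dots,0)$, let $M\simeq{\rm SO}(N-1)$ be the isotropy group of $e_1$ in ${\rm SO}(N)$ and $\xi$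 an irreducible finite-dimensional unitary representation of $M$ on $V_\xi$ ($\xi=0$ denotes the trivial one). For $\omega\ge 0$, $\pi_{\omega\xi}$ acts on $\{f\in L^2({\rm SO}(N),V_\xi): f(mk)=\xi(m)f(k)\ \text{for all } m\in M\}$ by $[\pi_{\omega\xi}(k_0,a_0)f](k)=e^{i\omega e_1\cdot ka_0}f(kk_0)$, for $(\omega,\xi)\ne(0,0)$, while $\pi_{00}$ denotes the trivial one-dimensional (singlet) representation of $G$. Let $\mathcal G_{\omega\xi}(\mathbf T)$ be the space of $\pi_{\omega\xi}$-equivariant elements of $\mathcal G(\mathbf T)$. *Singlet component.* Let $L^2(\mathcal N)_0$ be the space of $f\in L^2(\mathcal N)$ that are invariant under simultaneous rotations of $n_2,\dots,n_\nu$, and let $\mathbf T_{00}$ be the operator on $L^2(\mathcal N)_0$ with kernel $\int dg\,T\big(g^{-1}(0,n),(0,n')\big)$. Let $\mathcal G(\mathbf T_{00})\subset L^2(\mathcal N)_0$ be its eigenspace for the eigenvalue $\|\mathbf T_{00}\|$ ($\{0\}$ if there are no eigenvectors). **Theorem C.1.** (a) $\mathcal G_{\omega\xi}(\mathbf T)=\{0\}$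 for all $\omega\ge 0$ and $\xi$ unless $\omega=0$ and $\xi=0$; all ground states are singlets: $\mathcal G_{00}(\mathbf T)=\mathcal G(\mathbf T)$. (b) $\mathbf T_{00}$ is a well-defined bounded operator on $L^2(\mathcal N)_0$, and $f\mapsto\big[x\mapsto f(x_2-x_1,\dots,x_\nu-x_1)\big]$ is an isometric linear bijection from $\mathcal G(\mathbf T_{00})$ (with the $L^2(\mathcal N)$ norm) onto $\mathcal G(\mathbf T)$ (with the norm $\|\cdot\|_{\infty,2}$). If $\|\mathbf T\|$ is an eigenvalue of $\mathbf T_{00}$, then $\mathbf T$ has a unique ground state: there is $\Psi\in\mathcal G(\mathbf T)$ that is almost everywhere strictly positive, is of the form $\Psi(x)=f(x_2-x_1,\dots,x_\nu-x_1)$ with $f\in L^2(\mathcal N)_0$, satisfies $\mathcal G(\mathbf T)=\mathbb{C}\Psi$, and is not normalizable, $\Psi\notin L^2(\mathbb{R}^{N\nu})$. -/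

import Mathlib

open MeasureTheory
open scoped ENNReal NNReal ComplexConjugate InnerProductSpace

noncomputable section

namespace EuclideanSpin

/-! ### The groups `SO(N)` and `ISO(N)` -/

/-- Euclidean space `ℝ^N`. -/
abbrev Pt (N : ℕ) : Type := EuclideanSpace ℝ (Fin N)

/-- The rotation group `SO(N)`. -/
def SO (N : ℕ) : Type := Matrix.specialOrthogonalGroup (Fin N) ℝ

variable {N r : ℕ}

instance : Group (SO N) := inferInstanceAs (Group (Matrix.specialOrthogonalGroup (Fin N) ℝ))

instance : TopologicalSpace (SO N) :=
  inferInstanceAs (TopologicalSpace (Matrix.specialOrthogonalGroup (Fin N) ℝ))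

instance : T2Space (SO N) := inferInstanceAs (T2Space (Matrix.specialOrthogonalGroup (Fin N) ℝ))

instance : MeasurableSpace (SO N) := borel _

instance : BorelSpace (SO N) := ⟨rfl⟩

/-- The underlying matrix of a rotation. -/
def SO.mat (k : SO N) : Matrix (Fin N) (Fin N) ℝ := k.1

theorem SO.mat_mul (k l : SO N) : (k * l).mat = k.mat * l.mat := rfl

theorem SO.mat_one : (1 : SO N).mat = 1 := rfl

theorem SO.mat_inv (k : SO N) : (k⁻¹).mat = k.mat.transpose := rfl

theorem SO.continuous_mat : Continuous (SO.mat : SO N → _) := continuous_subtype_val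

theorem SO.ext_mat {k l : SO N} (h : k.mat = l.mat) : k = l := Subtype.ext h

instance : IsTopologicalGroup (SO N) where
  continuous_mul :=
    Continuous.subtype_mk
      ((SO.continuous_mat.comp continuous_fst).matrix_mul (SO.continuous_mat.comp continuous_snd)) _
  continuous_inv := Continuous.subtype_mk (SO.continuous_mat.matrix_transpose) _

instance : SecondCountableTopology (SO N) := by
  have : SecondCountableTopology (Matrix (Fin N) (Fin N) ℝ) :=
    inferInstanceAs (SecondCountableTopology (Fin N → Fin N → ℝ))
  exact Topology.IsInducing.secondCountableTopology (f := (SO.mat : SO N → _))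
    Topology.IsInducing.subtypeVal

instance : CompactSpace (SO N) := by
  refine (isCompact_iff_compactSpace (s := {A : Matrix (Fin N) (Fin N) ℝ |
    A ∈ Matrix.specialOrthogonalGroup (Fin N) ℝ})).1 ?_
  have hset : {A : Matrix (Fin N) (Fin N) ℝ | A ∈ Matrix.specialOrthogonalGroup (Fin N) ℝ} =
      {A | A * A.transpose = 1} ∩ {A | A.det = 1} := by
    ext A
    simp only [Set.mem_ofPred_eq, Set.mem_inter_iff, Matrix.mem_specialOrthogonalGroup_iff,
      Matrix.mem_orthogonalGroup_iff]
  have hK : IsCompact (Set.univ.pi fun _ : Fin N => Set.univ.pi fun _ : Fin N =>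
      Set.Icc (-1 : ℝ) 1) :=
    isCompact_univ_pi fun _ => isCompact_univ_pi fun _ => isCompact_Icc
  rw [hset]
  refine IsCompact.of_isClosed_subset hK ?_ ?_
  · exact (isClosed_eq (continuous_id.matrix_mul continuous_id.matrix_transpose)
      continuous_const).inter (isClosed_eq continuous_id.matrix_det continuous_const)
  · rintro A ⟨hA, -⟩ i - j -
    have h1 : (A * A.transpose) i i = 1 := by
      rw [show A * A.transpose = 1 from hA]; simp
    rw [Matrix.mul_apply] at h1
    simp only [Matrix.transpose_apply] at h1
    have h2 : A i j * A i j ≤ ∑ x, A i x * A i x :=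
      Finset.single_le_sum (f := fun x => A i x * A i x) (fun x _ => mul_self_nonneg _)
        (Finset.mem_univ j)
    have h3 : A i j ^ 2 ≤ 1 := by nlinarith
    exact ⟨by nlinarith [abs_le.1 ((sq_le_one_iff_abs_le_one _).1 h3)],
      (abs_le.1 ((sq_le_one_iff_abs_le_one _).1 h3)).2⟩

/-- The rotation `x ↦ k x` of `ℝ^N`. -/
def rot (k : SO N) : Pt N ≃ₗᵢ[ℝ] Pt N where
  toFun x := WithLp.toLp 2 (k.mat.mulVec x.ofLp)
  invFun x := WithLp.toLp 2 ((k⁻¹).mat.mulVec x.ofLp)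
  map_add' x y := by simp [Matrix.mulVec_add]
  map_smul' c x := by simp [Matrix.mulVec_smul]
  left_inv x := by simp [← SO.mat_mul, SO.mat_one]
  right_inv x := by simp [← SO.mat_mul, SO.mat_one]
  norm_map' x := by
    have h : (k⁻¹).mat * k.mat = 1 := by rw [← SO.mat_mul, inv_mul_cancel, SO.mat_one]
    have : ‖WithLp.toLp 2 (k.mat.mulVec x.ofLp)‖ ^ 2 = ‖x‖ ^ 2 := by
      rw [← real_inner_self_eq_norm_sq, ← real_inner_self_eq_norm_sq]
      simp only [EuclideanSpace.inner_eq_star_dotProduct, star_trivial]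
      rw [Matrix.dotProduct_mulVec, ← Matrix.mulVec_transpose, ← SO.mat_inv, Matrix.mulVec_mulVec,
        h, Matrix.one_mulVec]
    exact (sq_eq_sq₀ (norm_nonneg _) (norm_nonneg _)).1 this

theorem rot_mul (k l : SO N) (x : Pt N) : rot (k * l) x = rot k (rot l x) := by
  simp [rot, SO.mat_mul]

theorem rot_one (x : Pt N) : rot (1 : SO N) x = x := by simp [rot, SO.mat_one]

theorem continuous_rot : Continuous fun p : SO N × Pt N => rot p.1 p.2 := by
  have : Continuous fun p : SO N × Pt N => p.1.mat.mulVec p.2.ofLp :=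
    (SO.continuous_mat.comp continuous_fst).matrix_mulVec
      ((PiLp.continuous_ofLp 2 _).comp continuous_snd)
  exact (PiLp.continuous_toLp 2 _).comp this

/-- The Haar measure `dk` on `SO(N)` of total mass one. -/
def haarSO (N : ℕ) : Measure (SO N) := Measure.haarMeasure ⊤

instance : (haarSO N).IsHaarMeasure := inferInstanceAs (Measure.haarMeasure _).IsHaarMeasure

instance : IsProbabilityMeasure (haarSO N) := ⟨by
  have := Measure.haarMeasure_self (G := SO N) (K₀ := ⊤)
  simpa [haarSO] using this⟩

instance : (haarSO N).IsMulRightInvariant := ⟨fun g => by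
  have : IsProbabilityMeasure (Measure.map (fun x => x * g) (haarSO N)) :=
    Measure.isProbabilityMeasure_map (measurable_mul_const g).aemeasurable
  have : (Measure.map (fun x => x * g) (haarSO N)).IsHaarMeasure :=
    Measure.isHaarMeasure_map_mul_right _ g
  exact Measure.isHaarMeasure_eq_of_isProbabilityMeasure _ _⟩

/-- The Euclidean group `ISO(N)`: the pair `(k, a)` stands for the motion `x ↦ k x + a`. -/
def ISO (N : ℕ) : Type := SO N × Pt N

instance : MeasurableSpace (ISO N) := inferInstanceAs (MeasurableSpace (SO N × Pt N))

instance : Group (ISO N) where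
  mul g h := (g.1 * h.1, g.2 + rot g.1 h.2)
  one := (1, 0)
  inv g := (g.1⁻¹, -rot g.1⁻¹ g.2)
  mul_assoc g h l := Prod.ext (mul_assoc g.1 h.1 l.1) (by
    change g.2 + rot g.1 h.2 + rot (g.1 * h.1) l.2 = g.2 + rot g.1 (h.2 + rot h.1 l.2)
    rw [rot_mul, map_add, add_assoc])
  one_mul g := Prod.ext (one_mul g.1) (by
    change 0 + rot 1 g.2 = g.2
    rw [rot_one, zero_add])
  mul_one g := Prod.ext (mul_one g.1) (by
    change g.2 + rot g.1 0 = g.2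
    rw [map_zero, add_zero])
  inv_mul_cancel g := Prod.ext (inv_mul_cancel g.1) (by
    change -rot g.1⁻¹ g.2 + rot g.1⁻¹ g.2 = 0
    exact neg_add_cancel _)

/-- The Haar measure `dk da` on `ISO(N)`. -/
def haarISO (N : ℕ) : Measure (ISO N) := (haarSO N).prod (volume : Measure (Pt N))

instance : SigmaFinite (haarISO N) :=
  inferInstanceAs (SigmaFinite ((haarSO N).prod (volume : Measure (Pt N))))

/-! ### Configurations -/

/-- Configurations `(x_1, …, x_ν)` of `ν = r + 1` points of `ℝ^N`, with Lebesgue measure. -/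
abbrev Conf (N r : ℕ) : Type := Fin (r + 1) → Pt N

/-- Relative configurations `n = (n_2, …, n_ν)`, with Lebesgue measure. -/
abbrev Rel (N r : ℕ) : Type := Fin r → Pt N

/-- The diagonal action of a Euclidean motion on configurations. -/
def act (g : ISO N) (x : Conf N r) : Conf N r := fun i => rot g.1 (x i) + g.2

/-- The diagonal action of a rotation on relative configurations. -/
def rotRel (k : SO N) (n : Rel N r) : Rel N r := fun i => rot k (n i)

/-- The differences `(x_2 - x_1, …, x_ν - x_1)`. -/
def diffs (x : Conf N r) : Rel N r := fun i => x i.succ - x 0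

/-- The configuration `(0, n_2, …, n_ν)`. -/
def based (n : Rel N r) : Conf N r := Fin.cons 0 n

/-- The map `(g, n) ↦ g⁻¹ (0, n_2, …, n_ν)` from `ISO(N) × 𝒩` onto configurations; it is constant
on the orbits `(k g, k n)`, `k ∈ SO(N)`, and identifies `(ISO(N) × 𝒩) / SO(N)` with the
configuration space, the right translations of `ISO(N)` becoming the diagonal action. -/
def place (g : ISO N) (n : Rel N r) : Conf N r := act g⁻¹ (based n)

theorem measurePreserving_act (g : ISO N) :
    MeasurePreserving (act g : Conf N r → Conf N r) volume volume :=
  volume_preserving_pi fun _ =>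
    (measurePreserving_add_right volume g.2).comp (rot g.1).measurePreserving

theorem measurePreserving_rotRel (k : SO N) :
    MeasurePreserving (rotRel k : Rel N r → Rel N r) volume volume :=
  volume_preserving_pi fun _ => (rot k).measurePreserving

theorem continuous_place :
    Continuous fun p : (SO N × Pt N) × Rel N r => place (N := N) (r := r) p.1 p.2 := by
  refine continuous_pi fun i => ?_
  have h1 : Continuous fun p : (SO N × Pt N) × Rel N r => (based p.2 : Conf N r) i := by
    refine Fin.cases ?_ (fun j => ?_) i
    · simpa [based] using continuous_const
    · exact (continuous_apply j).comp continuous_snd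
  have hk : Continuous fun p : (SO N × Pt N) × Rel N r => p.1.1⁻¹ :=
    (continuous_fst.comp continuous_fst).inv
  exact (continuous_rot.comp (hk.prodMk h1)).add
    (continuous_rot.comp (hk.prodMk (continuous_snd.comp continuous_fst))).neg

theorem measurePreserving_place :
    MeasurePreserving (fun p : ISO N × Rel N r => place p.1 p.2)
      ((haarISO N).prod volume) volume := by
  have hneg : ∀ k : SO N, MeasurePreserving (fun a : Pt N => -rot k⁻¹ a) volume volume :=
    fun k => (Measure.measurePreserving_neg volume).comp (rot k⁻¹).measurePreserving
  have hA : MeasurePreserving (fun g : SO N × Pt N => -rot g.1⁻¹ g.2)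
      ((haarSO N).prod volume) volume := by
    have hm : Measurable (Function.uncurry fun (k : SO N) (a : Pt N) => -rot k⁻¹ a) :=
      (continuous_rot.comp ((continuous_fst.inv).prodMk continuous_snd)).neg.measurable
    exact measurePreserving_snd.comp (MeasurePreserving.skew_product
      (MeasurePreserving.id (haarSO N)) hm (Filter.Eventually.of_forall fun k => (hneg k).map_eq))
  have hB : MeasurePreserving
      (fun p : (SO N × Pt N) × Rel N r =>
        (-rot p.1.1⁻¹ p.1.2, fun i => rot p.1.1⁻¹ (p.2 i) + -rot p.1.1⁻¹ p.1.2))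
      (((haarSO N).prod volume).prod volume)
      ((volume : Measure (Pt N)).prod (volume : Measure (Rel N r))) := by
    refine MeasurePreserving.skew_product
      (g := fun (g : SO N × Pt N) (n : Rel N r) i => rot g.1⁻¹ (n i) + -rot g.1⁻¹ g.2) hA ?_ ?_
    · refine Continuous.measurable (continuous_pi fun i => ?_)
      have hk : Continuous fun p : (SO N × Pt N) × Rel N r => p.1.1⁻¹ :=
        (continuous_fst.comp continuous_fst).inv
      exact (continuous_rot.comp (hk.prodMk ((continuous_apply i).comp continuous_snd))).add
        (continuous_rot.comp (hk.prodMk (continuous_snd.comp continuous_fst))).neg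
    · exact Filter.Eventually.of_forall fun g => (volume_preserving_pi fun _ =>
        (measurePreserving_add_right volume _).comp (rot g.1⁻¹).measurePreserving).map_eq
  have hC := ((volume_preserving_piFinSuccAbove (fun _ : Fin (r + 1) => Pt N) 0).symm _).comp hB
  have heq : (fun p : ISO N × Rel N r => place p.1 p.2) =
      (MeasurableEquiv.piFinSuccAbove (fun _ : Fin (r + 1) => Pt N) 0).symm ∘
      (fun p : (SO N × Pt N) × Rel N r =>
        (-rot p.1.1⁻¹ p.1.2, fun i => rot p.1.1⁻¹ (p.2 i) + -rot p.1.1⁻¹ p.1.2)) := by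
    funext p
    funext i
    refine Fin.cases ?_ (fun j => ?_) i
    · change rot p.1.1⁻¹ (based p.2 0) + -rot p.1.1⁻¹ p.1.2 = _
      simp [based, MeasurableEquiv.piFinSuccAbove]
      rfl
    · change rot p.1.1⁻¹ (based p.2 j.succ) + -rot p.1.1⁻¹ p.1.2 = _
      simp [based, MeasurableEquiv.piFinSuccAbove]
      rfl
  rw [heq]
  exact hC

/-- The space `L²` of complex functions. -/
abbrev L2 (α : Type) [MeasureSpace α] : Type := Lp ℂ 2 (volume : Measure α)

/-- The unitary representation `[ℓ(k, a) ψ](x) = ψ(k⁻¹ (x - a))` on `L²(ℝ^{Nν})`. -/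
def ell (g : ISO N) : L2 (Conf N r) →ₗᵢ[ℂ] L2 (Conf N r) :=
  Lp.compMeasurePreservingₗᵢ ℂ (act g⁻¹) (measurePreserving_act g⁻¹)

/-! ### Transfer operators -/

/-- `𝓣` is the transfer operator with kernel `T`: a positive bounded operator on `L²` that is
the integral operator of a nonnegative, symmetric, continuous, almost everywhere strictly positive
kernel with `sup_x ∫ T(x, y) dy < ∞`. -/
structure IsTransferOperator (𝓣 : L2 (Conf N r) →L[ℂ] L2 (Conf N r))
    (T : Conf N r → Conf N r → ℝ) : Prop where
  continuous : Continuous (Function.uncurry T)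
  symm : ∀ x y, T x y = T y x
  nonneg : ∀ x y, 0 ≤ T x y
  pos : ∀ᵐ p : Conf N r × Conf N r, 0 < T p.1 p.2
  bounded : ∃ C : ℝ≥0, ∀ x, ∫⁻ y, ENNReal.ofReal (T x y) ≤ C
  apply : ∀ ψ : L2 (Conf N r), ∀ᵐ x, 𝓣 ψ x = ∫ y, (T x y : ℂ) * ψ y
  isPositive : 𝓣.IsPositive

/-- `𝓣` commutes with the representation `ell` of `ISO(N)`. -/
def IsInvariant (𝓣 : L2 (Conf N r) →L[ℂ] L2 (Conf N r)) : Prop :=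
  ∀ (g : ISO N) (ψ : L2 (Conf N r)), 𝓣 (ell g ψ) = ell g (𝓣 ψ)

/-! ### The ground state sector -/

/-- Almost everywhere defined functions on configuration space. -/
abbrev AEFun (N r : ℕ) : Type := Conf N r →ₘ[volume] ℂ

/-- The norm `[∫ dn (ess sup_g |Ω(g, n)|)²]^{1/2}`, where `Ω` is viewed as a function of
`(g, n) ∈ ISO(N) × 𝒩`. -/
def normSup2 (Ω : AEFun N r) : ℝ≥0∞ :=
  (∫⁻ n : Rel N r, eLpNorm (fun g => Ω (place g n)) ∞ (haarISO N) ^ 2) ^ (1 / 2 : ℝ)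

theorem measurable_essSup {α β : Type*} [MeasurableSpace α] [MeasurableSpace β]
    (μ : Measure α) [SFinite μ] {f : α × β → ℝ≥0∞} (hf : Measurable f) :
    Measurable fun b => essSup (fun a => f (a, b)) μ := by
  refine measurable_of_Ioi fun c => ?_
  have : (fun b => essSup (fun a => f (a, b)) μ) ⁻¹' Set.Ioi c =
      {b | 0 < μ ((fun a => (a, b)) ⁻¹' {p | c < f p})} := by
    ext b
    simp only [Set.mem_preimage, Set.mem_Ioi, Set.mem_ofPred_eq, pos_iff_ne_zero]
    rw [← not_le, not_iff_not]
    constructor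
    · intro h
      refine measure_mono_null ?_ (meas_essSup_lt (f := fun a => f (a, b)) (μ := μ))
      intro a ha
      exact lt_of_le_of_lt h ha
    · intro h
      refine essSup_le_of_ae_le c ?_
      rw [Filter.EventuallyLE, ae_iff]
      simpa using h
  rw [this]
  exact (measurable_measure_prodMk_right (hf measurableSet_Ioi)) measurableSet_Ioi

theorem ae_place {p : Conf N r → Prop} (h : ∀ᵐ x, p x) :
    ∀ᵐ n : Rel N r, ∀ᵐ g ∂(haarISO N), p (place g n) := by
  have h1 : ∀ᵐ q ∂((haarISO N).prod (volume : Measure (Rel N r))), p (place q.1 q.2) :=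
    measurePreserving_place.quasiMeasurePreserving.ae h
  have h2 := (Measure.measurePreserving_swap (μ := (volume : Measure (Rel N r)))
    (ν := haarISO N)).quasiMeasurePreserving.ae h1
  exact Measure.ae_ae_of_ae_prod h2

theorem normSup2_lt_top_iff (Ω : AEFun N r) : normSup2 Ω < ∞ ↔
    ∫⁻ n : Rel N r, eLpNorm (fun g => Ω (place g n)) ∞ (haarISO N) ^ 2 < ∞ := by
  rw [normSup2, ENNReal.rpow_lt_top_iff_of_pos (by norm_num)]

theorem normSup2_zero : normSup2 (0 : AEFun N r) = 0 := by
  have h : ∀ᵐ n : Rel N r, eLpNorm (fun g => (0 : AEFun N r) (place g n)) ∞ (haarISO N) ^ 2 = 0 := by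
    filter_upwards [ae_place (AEEqFun.coeFn_zero (α := Conf N r) (β := ℂ) (μ := volume))] with n hn
    rw [eLpNorm_congr_ae (g := 0) hn]
    simp
  rw [normSup2, lintegral_congr_ae h]
  simp

theorem normSup2_add {Ω Ω' : AEFun N r} (h : normSup2 Ω < ∞) (h' : normSup2 Ω' < ∞) :
    normSup2 (Ω + Ω') < ∞ := by
  rw [normSup2_lt_top_iff] at *
  have hm : Measurable fun n : Rel N r => eLpNorm (fun g => Ω (place g n)) ∞ (haarISO N) := by
    simp only [eLpNorm_exponent_top, eLpNormEssSup]
    exact measurable_essSup (haarISO N) (f := fun p : ISO N × Rel N r => ‖Ω (place p.1 p.2)‖ₑ)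
      (Ω.stronglyMeasurable.measurable.comp measurePreserving_place.measurable).enorm
  have hle : ∀ᵐ n : Rel N r,
      eLpNorm (fun g => (Ω + Ω') (place g n)) ∞ (haarISO N) ^ 2 ≤
        2 * eLpNorm (fun g => Ω (place g n)) ∞ (haarISO N) ^ 2 +
        2 * eLpNorm (fun g => Ω' (place g n)) ∞ (haarISO N) ^ 2 := by
    filter_upwards [ae_place (AEEqFun.coeFn_add Ω Ω')] with n hn
    rw [eLpNorm_congr_ae (g := (fun g => Ω (place g n)) + fun g => Ω' (place g n)) hn]
    have hadd : eLpNorm ((fun g => Ω (place g n)) + fun g => Ω' (place g n)) ∞ (haarISO N) ≤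
        eLpNorm (fun g => Ω (place g n)) ∞ (haarISO N) +
        eLpNorm (fun g => Ω' (place g n)) ∞ (haarISO N) := by
      simp only [eLpNorm_exponent_top]
      exact eLpNormEssSup_add_le
    refine (pow_le_pow_left' hadd 2).trans ?_
    have := ENNReal.rpow_add_le_mul_rpow_add_rpow
      (eLpNorm (fun g => Ω (place g n)) ∞ (haarISO N))
      (eLpNorm (fun g => Ω' (place g n)) ∞ (haarISO N)) (p := 2) (by norm_num)
    norm_num at this
    rw [mul_add] at this
    exact this
  refine lt_of_le_of_lt (lintegral_mono_ae hle) ?_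
  rw [lintegral_add_left ((hm.pow_const 2).const_mul 2), lintegral_const_mul _ (hm.pow_const 2),
    lintegral_const_mul' _ _ (by norm_num)]
  exact ENNReal.add_lt_top.2 ⟨ENNReal.mul_lt_top (by norm_num) h,
    ENNReal.mul_lt_top (by norm_num) h'⟩

theorem normSup2_smul (c : ℂ) {Ω : AEFun N r} (h : normSup2 Ω < ∞) : normSup2 (c • Ω) < ∞ := by
  rw [normSup2_lt_top_iff] at *
  have hle : ∀ᵐ n : Rel N r,
      eLpNorm (fun g => (c • Ω) (place g n)) ∞ (haarISO N) ^ 2 =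
        ‖c‖ₑ ^ 2 * eLpNorm (fun g => Ω (place g n)) ∞ (haarISO N) ^ 2 := by
    filter_upwards [ae_place (AEEqFun.coeFn_smul c Ω)] with n hn
    rw [eLpNorm_congr_ae (g := c • fun g => Ω (place g n)) hn, eLpNorm_const_smul, mul_pow]
  rw [lintegral_congr_ae hle, lintegral_const_mul' _ _ (by simp)]
  exact ENNReal.mul_lt_top (by simp) h

/-- The ground state sector `𝒢(𝓣)`: the almost everywhere defined functions `Ω` with
`∫ dn (ess sup_g |Ω(g, n)|)² < ∞` that satisfy `∫ T(x, y) Ω(y) dy = ‖𝓣‖ Ω(x)`, with absolutely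
convergent integral, for almost every `x`. -/
def groundSector (𝓣 : L2 (Conf N r) →L[ℂ] L2 (Conf N r)) (T : Conf N r → Conf N r → ℝ) :
    Submodule ℂ (AEFun N r) where
  carrier := {Ω | normSup2 Ω < ∞ ∧ ∀ᵐ x, Integrable (fun y => (T x y : ℂ) * Ω y) ∧
    ∫ y, (T x y : ℂ) * Ω y = (‖𝓣‖ : ℂ) * Ω x}
  zero_mem' := by
    refine ⟨by simp [normSup2_zero], ?_⟩
    have h0 := AEEqFun.coeFn_zero (α := Conf N r) (β := ℂ) (μ := volume)
    filter_upwards [h0] with x hx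
    have : (fun y => (T x y : ℂ) * (0 : AEFun N r) y) =ᵐ[volume] fun _ => (0 : ℂ) := by
      filter_upwards [h0] with y hy
      simp [hy]
    rw [integrable_congr this, integral_congr_ae this, hx]
    simp
  add_mem' := by
    rintro Ω Ω' ⟨h1, h2⟩ ⟨h1', h2'⟩
    refine ⟨normSup2_add h1 h1', ?_⟩
    have hs := AEEqFun.coeFn_add Ω Ω'
    filter_upwards [h2, h2', hs] with x hx hx' hxs
    have : (fun y => (T x y : ℂ) * (Ω + Ω') y) =ᵐ[volume]
        fun y => (T x y : ℂ) * Ω y + (T x y : ℂ) * Ω' y := by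
      filter_upwards [hs] with y hy
      rw [hy, Pi.add_apply, mul_add]
    rw [integrable_congr this, integral_congr_ae this, integral_add hx.1 hx'.1, hx.2, hx'.2, hxs,
      Pi.add_apply, mul_add]
    exact ⟨hx.1.add hx'.1, rfl⟩
  smul_mem' := by
    rintro c Ω ⟨h1, h2⟩
    refine ⟨normSup2_smul c h1, ?_⟩
    have hs := AEEqFun.coeFn_smul c Ω
    filter_upwards [h2, hs] with x hx hxs
    have : (fun y => (T x y : ℂ) * (c • Ω) y) =ᵐ[volume]
        fun y => c * ((T x y : ℂ) * Ω y) := by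
      filter_upwards [hs] with y hy
      rw [hy, Pi.smul_apply, smul_eq_mul]
      ring
    rw [integrable_congr this, integral_congr_ae this, integral_const_mul, hx.2, hxs,
      Pi.smul_apply, smul_eq_mul]
    exact ⟨hx.1.const_mul c, by ring⟩

/-! ### The singlet fiber -/

/-- The subspace of rotation invariant functions of `L²(𝒩)`. -/
def invL2 (N r : ℕ) : Submodule ℂ (L2 (Rel N r)) where
  carrier := {f | ∀ k : SO N, ∀ᵐ n, f (rotRel k n) = f n}
  zero_mem' k := by
    have h := Lp.coeFn_zero ℂ 2 (volume : Measure (Rel N r))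
    filter_upwards [h, (measurePreserving_rotRel k).quasiMeasurePreserving.ae h] with n h1 h2
    rw [h1, h2]
    rfl
  add_mem' {f f'} hf hf' k := by
    have h := Lp.coeFn_add f f'
    filter_upwards [hf k, hf' k, h, (measurePreserving_rotRel k).quasiMeasurePreserving.ae h]
      with n h1 h2 h3 h4
    rw [h3, h4, Pi.add_apply, Pi.add_apply, h1, h2]
  smul_mem' c f hf k := by
    have h := Lp.coeFn_smul c f
    filter_upwards [hf k, h, (measurePreserving_rotRel k).quasiMeasurePreserving.ae h]
      with n h1 h3 h4
    rw [h3, h4, Pi.smul_apply, Pi.smul_apply, h1]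

/-- The kernel `∫ dg T(g⁻¹ (0, n), (0, n'))`, `g ∈ ISO(N)`, of the component of the transfer
operator in the singlet representation. -/
def singletKernel (T : Conf N r → Conf N r → ℝ) (n n' : Rel N r) : ℝ :=
  ∫ g, T (place g n) (based n') ∂(haarISO N)

/-- `T₀₀` is the component in the singlet representation of the transfer operator with kernel `T`:
the operator on the rotation invariant functions of `L²(𝒩)` with kernel `singletKernel T`. -/
def IsSingletFiber (T : Conf N r → Conf N r → ℝ) (T₀₀ : invL2 N r →L[ℂ] invL2 N r) : Prop :=
  ∀ f : invL2 N r, ∀ᵐ n, Integrable (fun n' => (singletKernel T n n' : ℂ) * f.1 n') ∧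
    (T₀₀ f).1 n = ∫ n', (singletKernel T n n' : ℂ) * f.1 n'

/-- The ground state sector of an operator: its eigenspace for the eigenvalue `‖A‖`. -/
def opGroundSector {H : Type*} [NormedAddCommGroup H] [NormedSpace ℂ H] (A : H →L[ℂ] H) :
    Submodule ℂ H :=
  Module.End.eigenspace (A : Module.End ℂ H) (‖A‖ : ℂ)

/-! ### Equivariant ground states -/

/-- The Banach space of compact operators on `H`, with the operator norm. -/
def Compacts (H : Type*) [NormedAddCommGroup H] [NormedSpace ℂ H] : Type _ :=
  compactOperator (RingHom.id ℂ) H H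

instance (H : Type*) [NormedAddCommGroup H] [NormedSpace ℂ H] : NormedAddCommGroup (Compacts H) :=
  Submodule.normedAddCommGroup (compactOperator (RingHom.id ℂ) H H)

instance (H : Type*) [NormedAddCommGroup H] [NormedSpace ℂ H] : NormedSpace ℂ (Compacts H) :=
  Submodule.normedSpace (compactOperator (RingHom.id ℂ) H H)

/-- The space `L^{1,2}` of functions `φ` on `ISO(N) × 𝒩` with `∫ dn (∫ dg |φ(g, n)|)² < ∞`. -/
def MemL12 (φ : ISO N × Rel N r → ℂ) : Prop :=
  AEStronglyMeasurable φ ((haarISO N).prod volume) ∧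
    ∫⁻ n : Rel N r, (∫⁻ g, ‖φ (g, n)‖ₑ ∂(haarISO N)) ^ 2 < ∞

/-- `Φ` is the Fourier transform `n ↦ ∫ dg φ(g, n) π(g⁻¹)` (a weak integral) of `φ` at `π`. -/
def IsFourierTransform {H : Type*} [NormedAddCommGroup H] [InnerProductSpace ℂ H]
    (π : ISO N →* (H →ₗᵢ[ℂ] H)) (φ : ISO N × Rel N r → ℂ) (Φ : Rel N r → Compacts H) : Prop :=
  ∀ᵐ n, ∀ u w : H, ⟪u, (Φ n).1 w⟫_ℂ = ∫ g, φ (g, n) * ⟪u, π g⁻¹ w⟫_ℂ ∂(haarISO N)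

/-- `Ω`, viewed as a function on `ISO(N) × 𝒩`, is equivariant with respect to the unitary
representation `π`: on test functions `φ ∈ L^{1,2}` the functional
`(Ω, φ) = ∫ dg dn conj Ω(g, n) φ(g, n)` only depends on the Fourier transform of `φ` at `π`, as a
bounded linear functional of that element of `L²(𝒩, compact operators)`. -/
def IsEquivariant {H : Type*} [NormedAddCommGroup H] [InnerProductSpace ℂ H]
    (π : ISO N →* (H →ₗᵢ[ℂ] H)) (Ω : AEFun N r) : Prop :=
  ∃ ℓ : Lp (Compacts H) 2 (volume : Measure (Rel N r)) →L[ℂ] ℂ,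
    ∀ φ : ISO N × Rel N r → ℂ, MemL12 φ →
    ∀ Φ : Lp (Compacts H) 2 (volume : Measure (Rel N r)), IsFourierTransform π φ Φ →
      ∫ n, ∫ g, conj (Ω (place g n)) * φ (g, n) ∂(haarISO N) = ℓ Φ

/-- The ground states that are equivariant with respect to `π`. -/
def equivariantGroundSector {H : Type*} [NormedAddCommGroup H] [InnerProductSpace ℂ H]
    (𝓣 : L2 (Conf N r) →L[ℂ] L2 (Conf N r)) (T : Conf N r → Conf N r → ℝ)
    (π : ISO N →* (H →ₗᵢ[ℂ] H)) : Set (AEFun N r) :=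
  {Ω | Ω ∈ groundSector 𝓣 T ∧ IsEquivariant π Ω}

/-! ### The representations `π_{ωξ}` of `ISO(N)` -/

/-- The singlet (trivial one-dimensional) representation `π₀₀` of `ISO(N)`. -/
def singletRep (N : ℕ) : ISO N →* (ℂ →ₗᵢ[ℂ] ℂ) := 1

/-- The first unit vector of `ℝ^N`. -/
def e₁ (N : ℕ) [NeZero N] : Pt N := EuclideanSpace.single 0 1

/-- The isotropy group of `e₁` in `SO(N)`, a copy of `SO(N-1)`. -/
def isotropy (N : ℕ) [NeZero N] : Subgroup (SO N) where
  carrier := {k | rot k (e₁ N) = e₁ N}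
  one_mem' := rot_one _
  mul_mem' {k l} hk hl := by
    change rot (k * l) (e₁ N) = e₁ N
    rw [rot_mul, show rot l (e₁ N) = e₁ N from hl, show rot k (e₁ N) = e₁ N from hk]
  inv_mem' {k} hk := by
    change rot k⁻¹ (e₁ N) = e₁ N
    conv_lhs => rw [← show rot k (e₁ N) = e₁ N from hk]
    rw [← rot_mul, inv_mul_cancel, rot_one]

/-- A finite-dimensional irreducible unitary representation of a topological group. -/
structure UnitaryIrrep (G : Type*) [Group G] [TopologicalSpace G] (V : Type*)
    [NormedAddCommGroup V] [InnerProductSpace ℂ V] [FiniteDimensional ℂ V] where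
  toHom : G →* (V ≃ₗᵢ[ℂ] V)
  continuous : ∀ v, Continuous fun g => toHom g v
  nontrivial : Nontrivial V
  irreducible : ∀ W : Submodule ℂ V, (∀ g, ∀ w ∈ W, toHom g w ∈ W) → W = ⊥ ∨ W = ⊤

/-- The trivial representation, written `ξ = 0`. -/
def UnitaryIrrep.IsTrivial {G V : Type*} [Group G] [TopologicalSpace G]
    [NormedAddCommGroup V] [InnerProductSpace ℂ V] [FiniteDimensional ℂ V]
    (ξ : UnitaryIrrep G V) : Prop :=
  ∀ g v, ξ.toHom g v = v

section PrincipalSeries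

set_option linter.unusedSectionVars false

variable [NeZero N] {V : Type*} [NormedAddCommGroup V] [InnerProductSpace ℂ V]
  [FiniteDimensional ℂ V]

/-- The space of the `f ∈ L²(SO(N), V)` with `f(m k) = ξ(m) f(k)` for all `m` in the isotropy
group. -/
def covariantL2 (ξ : UnitaryIrrep (isotropy N) V) : Submodule ℂ (Lp V 2 (haarSO N)) where
  carrier := {f | ∀ m : isotropy N, ∀ᵐ k ∂(haarSO N), f (m * k) = ξ.toHom m (f k)}
  zero_mem' m := by
    have h := Lp.coeFn_zero V 2 (haarSO N)
    filter_upwards [h,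
      (measurePreserving_mul_left (haarSO N) (m : SO N)).quasiMeasurePreserving.ae h] with k h1 h2
    rw [h1, h2, Pi.zero_apply, Pi.zero_apply, map_zero]
  add_mem' {f f'} hf hf' m := by
    have h := Lp.coeFn_add f f'
    filter_upwards [hf m, hf' m, h,
      (measurePreserving_mul_left (haarSO N) (m : SO N)).quasiMeasurePreserving.ae h]
      with k h1 h2 h3 h4
    rw [h3, h4, Pi.add_apply, Pi.add_apply, h1, h2, map_add]
  smul_mem' c f hf m := by
    have h := Lp.coeFn_smul c f
    filter_upwards [hf m, h,
      (measurePreserving_mul_left (haarSO N) (m : SO N)).quasiMeasurePreserving.ae h]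
      with k h1 h3 h4
    rw [h3, h4, Pi.smul_apply, Pi.smul_apply, h1, map_smul]

/-- The phase `exp(i ω e₁ · k a)`. -/
def phase (ω : ℝ) (a : Pt N) (k : SO N) : ℂ :=
  Complex.exp (((ω * ⟪e₁ N, rot k a⟫_ℝ : ℝ) : ℂ) * Complex.I)

theorem norm_phase (ω : ℝ) (a : Pt N) (k : SO N) : ‖phase ω a k‖ = 1 :=
  Complex.norm_exp_ofReal_mul_I _

theorem continuous_phase (ω : ℝ) (a : Pt N) : Continuous (phase ω a) := by
  have h : Continuous fun k : SO N => rot k a :=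
    continuous_rot.comp (continuous_id.prodMk continuous_const)
  exact Complex.continuous_exp.comp ((Complex.continuous_ofReal.comp
    (continuous_const.mul (continuous_const.inner h))).mul continuous_const)

theorem aestronglyMeasurable_principal (ω : ℝ) (g : ISO N) (f : Lp V 2 (haarSO N)) :
    AEStronglyMeasurable (fun k => phase ω g.2 k • f (k * g.1)) (haarSO N) :=
  (continuous_phase ω g.2).aestronglyMeasurable.smul
    ((Lp.aestronglyMeasurable f).comp_measurePreserving (measurePreserving_mul_right (haarSO N) g.1))

theorem eLpNorm_principal (ω : ℝ) (g : ISO N) (f : Lp V 2 (haarSO N)) :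
    eLpNorm (fun k => phase ω g.2 k • f (k * g.1)) 2 (haarSO N) = eLpNorm f 2 (haarSO N) := by
  rw [eLpNorm_congr_norm_ae (g := f ∘ fun k => k * g.1)
    (Filter.Eventually.of_forall fun k => by simp [norm_smul, norm_phase])]
  exact eLpNorm_comp_measurePreserving (Lp.aestronglyMeasurable f)
    (measurePreserving_mul_right (haarSO N) g.1)

theorem memLp_principal (ω : ℝ) (g : ISO N) (f : Lp V 2 (haarSO N)) :
    MemLp (fun k => phase ω g.2 k • f (k * g.1)) 2 (haarSO N) :=
  ⟨aestronglyMeasurable_principal ω g f, by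
    rw [eLpNorm_principal]; exact (Lp.memLp f).eLpNorm_lt_top⟩

theorem principal_mem (ω : ℝ) (ξ : UnitaryIrrep (isotropy N) V) (g : ISO N)
    (f : covariantL2 ξ) : (memLp_principal ω g f.1).toLp ∈ covariantL2 ξ := by
  intro m
  have h := (memLp_principal ω g f.1).coeFn_toLp
  filter_upwards [h,
    (measurePreserving_mul_left (haarSO N) (m : SO N)).quasiMeasurePreserving.ae h,
    (measurePreserving_mul_right (haarSO N) g.1).quasiMeasurePreserving.ae (f.2 m)] with k h1 h2 h3
  have hp : phase ω g.2 (m * k) = phase ω g.2 k := by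
    have hm : rot (m : SO N) (e₁ N) = e₁ N := m.2
    unfold phase
    rw [rot_mul]
    conv_lhs => rw [← hm]
    rw [LinearIsometryEquiv.inner_map_map]
  rw [h1, h2, hp, mul_assoc, h3, map_smul]

/-- The unitary representation `[π_{ωξ}(k₀, a₀) f](k) = exp(i ω e₁ · k a₀) f(k k₀)` of `ISO(N)` on
the space `covariantL2 ξ`. -/
def principalSeries (ω : ℝ) (ξ : UnitaryIrrep (isotropy N) V) :
    ISO N →* (covariantL2 ξ →ₗᵢ[ℂ] covariantL2 ξ) where
  toFun g :=
    { toFun := fun f => ⟨(memLp_principal ω g f.1).toLp, principal_mem ω ξ g f⟩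
      map_add' := fun f f' => Subtype.ext <| Lp.ext <| by
        have h := (measurePreserving_mul_right (haarSO N) g.1).quasiMeasurePreserving.ae
          (Lp.coeFn_add f.1 f'.1)
        refine (memLp_principal ω g (f + f').1).coeFn_toLp.trans ?_
        refine Filter.EventuallyEq.trans ?_ (Lp.coeFn_add (memLp_principal ω g f.1).toLp
          (memLp_principal ω g f'.1).toLp).symm
        filter_upwards [h, (memLp_principal ω g f.1).coeFn_toLp,
          (memLp_principal ω g f'.1).coeFn_toLp] with k h1 h2 h3
        rw [Pi.add_apply, h2, h3, ← smul_add]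
        exact congrArg _ h1
      map_smul' := fun c f => Subtype.ext <| Lp.ext <| by
        have h := (measurePreserving_mul_right (haarSO N) g.1).quasiMeasurePreserving.ae
          (Lp.coeFn_smul c f.1)
        refine (memLp_principal ω g (c • f).1).coeFn_toLp.trans ?_
        refine Filter.EventuallyEq.trans ?_
          (Lp.coeFn_smul c (memLp_principal ω g f.1).toLp).symm
        filter_upwards [h, (memLp_principal ω g f.1).coeFn_toLp] with k h1 h2
        rw [Pi.smul_apply]
        refine (congrArg _ h1).trans ?_
        rw [h2, Pi.smul_apply, smul_comm]
      norm_map' := fun f => by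
        change ‖(memLp_principal ω g f.1).toLp‖ = ‖f.1‖
        rw [Lp.norm_toLp, eLpNorm_principal, Lp.norm_def] }
  map_one' := LinearIsometry.ext fun f => Subtype.ext <| Lp.ext <| by
    refine (memLp_principal ω 1 f.1).coeFn_toLp.trans (Filter.Eventually.of_forall fun k => ?_)
    change phase ω (0 : Pt N) k • f.1 (k * 1) = f.1 k
    simp [phase]
  map_mul' g h := LinearIsometry.ext fun f => Subtype.ext <| Lp.ext <| by
    refine (memLp_principal ω (g * h) f.1).coeFn_toLp.trans ?_
    refine Filter.EventuallyEq.trans ?_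
      (memLp_principal ω g (memLp_principal ω h f.1).toLp).coeFn_toLp.symm
    have h1 := (measurePreserving_mul_right (haarSO N) g.1).quasiMeasurePreserving.ae
      (memLp_principal ω h f.1).coeFn_toLp
    filter_upwards [h1] with k hk
    refine Eq.trans ?_ (congrArg (fun z => phase ω g.2 k • z) hk).symm
    change phase ω (g.2 + rot g.1 h.2) k • f.1 (k * (g.1 * h.1)) =
      phase ω g.2 k • phase ω h.2 (k * g.1) • f.1 (k * g.1 * h.1)
    rw [smul_smul, mul_assoc]
    congr 1
    unfold phase
    rw [← Complex.exp_add, map_add, inner_add_right, rot_mul]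
    congr 1
    push_cast
    ring

end PrincipalSeries

end EuclideanSpin

end

open EuclideanSpin

open MeasureTheory
open scoped ENNReal NNReal ComplexConjugate InnerProductSpace

noncomputable section

namespace EuclideanSpin

variable {N r : ℕ}

/-! ### Integral operators on nonnegative functions -/

/-! Since the kernel is continuous, commutation with the group makes it invariant at every pair of
points (`kernel_act`). It therefore maps functions of the differences to functions of the
differences, and induces on 𝒩 an integral operator K (`fiberOp`) with a symmetric, almost everywhere
positive kernel. Functions of the differences are not normalizable over configurations, yet K has
norm at most ‖𝓣‖: cut them off at a large ball of positions, whose boundary layer is negligible in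
the limit (`lintegral_fiberOp_sq_le`). Conversely, a positive eigenfunction of K serves as a weight
in Schur's test and bounds ‖𝓣‖ by its eigenvalue (`opNorm_le_of_fiberOp_le`).

For a ground state Ω let m(n) be the essential supremum of |Ω| over the orbit labelled by n
(`orbitSup`). Positivity of the kernel gives ‖𝓣‖ m ≤ K m. As m is square integrable and K is bounded
by ‖𝓣‖, equality holds (`fiberOp_eq_of_le`), and a Perron–Frobenius argument shows that m is zero or
almost everywhere positive, and unique up to a factor (`exists_eigenfunction_eq_mul`).

It remains to see that Ω itself depends on the differences only. This is a Liouville theorem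
(`exists_eq_mul_comp_diffs`): a nonnegative solution U ≤ m of the eigenvalue equation is a multiple
of m. The largest gain of U under a translation h is, orbit by orbit, again a subsolution, hence
equals c m. If c > 0, there are points where the gain is almost maximal; the eigenvalue equation
spreads this over a whole region, and after enough repetitions of h the function U would exceed m.
So c = 0. Applied to real and imaginary parts with m added, this gives Ω = const · m.

Thus all ground states are rotation invariant functions of the differences, which gives the
bijection with the singlet eigenspace, uniqueness and positivity; infinite translation volume
excludes normalizability. For equivariance under another π, test with φ(g, n) = η(a) f(n), where η
has nonzero mean but its Fourier transform at π vanishes: the pairing ‖f‖² ∫ η must be zero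
(`eq_zero_of_isEquivariant_pullback`). -/

theorem lintegral_mul_sq_le {α : Type*} [MeasurableSpace α] (μ : Measure α) {u v : α → ℝ≥0∞}
    (hu : AEMeasurable u μ) (hv : AEMeasurable v μ) :
    (∫⁻ x, u x * v x ∂μ) ^ 2 ≤ (∫⁻ x, u x ^ 2 ∂μ) * ∫⁻ x, v x ^ 2 ∂μ := by
  have h := ENNReal.lintegral_mul_le_Lp_mul_Lq μ Real.HolderConjugate.two_two hu hv
  simp only [Pi.mul_apply, ENNReal.rpow_two] at h
  refine (pow_le_pow_left' h 2).trans (le_of_eq ?_)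
  rw [mul_pow, ← ENNReal.rpow_two, ← ENNReal.rpow_two, ← ENNReal.rpow_mul, ← ENNReal.rpow_mul]
  norm_num

/-- Schur's test with a positive weight. -/
theorem schur_test {α : Type*} [MeasurableSpace α] (μ : Measure α) [SFinite μ]
    {k : α → α → ℝ≥0∞} (hk : Measurable (Function.uncurry k)) (hs : ∀ x y, k x y = k y x)
    {h : α → ℝ≥0∞} (hm : Measurable h) (h0 : ∀ᵐ x ∂μ, h x ≠ 0) (hi : ∀ᵐ x ∂μ, h x ≠ ∞)
    {κ : ℝ≥0∞} (hκ : ∀ᵐ x ∂μ, ∫⁻ y, k x y * h y ∂μ ≤ κ * h x)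
    {g : α → ℝ≥0∞} (hg : Measurable g) :
    ∫⁻ x, (∫⁻ y, k x y * g y ∂μ) ^ 2 ∂μ ≤ κ ^ 2 * ∫⁻ x, g x ^ 2 ∂μ := by
  set s : α → ℝ≥0∞ := fun x => h x ^ (1 / 2 : ℝ) with hs'
  have hsm : Measurable s := hm.pow_const _
  have hs2 : ∀ x, s x ^ 2 = h x := fun x => by
    rw [hs', ← ENNReal.rpow_two, ← ENNReal.rpow_mul]; norm_num
  have hkx : ∀ x, Measurable (k x) := fun x => hk.comp measurable_prodMk_left
  have hv : Measurable fun y => g y / s y := hg.div hsm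
  have key : ∀ᵐ x ∂μ, (∫⁻ y, k x y * g y ∂μ) ^ 2 ≤
      κ * ∫⁻ y, h x * (k x y * (g y ^ 2 / h y)) ∂μ := by
    filter_upwards [hκ] with x hx
    -- Cauchy–Schwarz is applied in the measure k(x, ·) μ to the product of the square root of h
    -- with g divided by that root.
    have e1 : ∫⁻ y, k x y * g y ∂μ = ∫⁻ y, s y * (g y / s y) ∂(μ.withDensity (k x)) := by
      rw [lintegral_withDensity_eq_lintegral_mul _ (hkx x)
        (show Measurable fun y => s y * (g y / s y) from hsm.mul hv)]
      refine lintegral_congr_ae ?_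
      filter_upwards [h0, hi] with y hy hy'
      have h1 : s y ≠ 0 := fun h => hy (by rw [← hs2, h]; simp)
      have h2 : s y ≠ ∞ := fun h => hy' (by rw [← hs2, h]; simp)
      simp only [Pi.mul_apply]
      rw [ENNReal.mul_div_cancel h1 h2]
    have hκ' : ∫⁻ y, s y ^ 2 ∂(μ.withDensity (k x)) ≤ κ * h x := by
      rw [lintegral_withDensity_eq_lintegral_mul _ (hkx x) (hsm.pow_const _)]
      simpa [hs2] using hx
    rw [e1]
    refine (lintegral_mul_sq_le _ hsm.aemeasurable hv.aemeasurable).trans ?_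
    refine (mul_le_mul_left hκ' _).trans (le_of_eq ?_)
    rw [lintegral_withDensity_eq_lintegral_mul _ (hkx x)
        (show Measurable fun y => (g y / s y) ^ 2 from hv.pow_const _), mul_assoc,
      ← lintegral_const_mul _ ((hkx x).mul (hv.pow_const _))]
    congr 1
    refine lintegral_congr fun y => ?_
    simp only [Pi.mul_apply]
    rw [div_eq_mul_inv, mul_pow, ← ENNReal.inv_pow, hs2, div_eq_mul_inv]
  refine (lintegral_mono_ae key).trans ?_
  have hM : Measurable (Function.uncurry fun x y => h x * (k x y * (g y ^ 2 / h y))) :=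
    (hm.comp measurable_fst).mul (hk.mul (((hg.comp measurable_snd).pow_const 2).div
      (hm.comp measurable_snd)))
  -- After exchanging the integrals, symmetry of k turns the x integral into the hypothesis on h at
  -- y, which supplies the second factor κ.
  rw [lintegral_const_mul _ (show Measurable fun x => ∫⁻ y, h x * (k x y * (g y ^ 2 / h y)) ∂μ from
    hM.lintegral_prod_right'), lintegral_lintegral_swap hM.aemeasurable,
    pow_two, mul_assoc]
  refine mul_le_mul_right ?_ _
  rw [← lintegral_const_mul _ (hg.pow_const 2)]
  refine lintegral_mono_ae ?_
  filter_upwards [hκ, h0, hi] with y hy hy0 hyi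
  have : ∀ x, h x * (k x y * (g y ^ 2 / h y)) = (g y ^ 2 / h y) * (k y x * h x) := fun x => by
    rw [hs x y]; ring
  simp only [this]
  rw [lintegral_const_mul _ (show Measurable fun x => k y x * h x from (hkx y).mul hm)]
  refine (mul_le_mul_right hy _).trans (le_of_eq ?_)
  rw [mul_left_comm, ENNReal.div_mul_cancel hy0 hyi]

/-! ### Translations -/

/-- The simultaneous translation of all points of a configuration. -/
def shift (a : Pt N) (x : Conf N r) : Conf N r := fun i => x i + a

/-- The configuration with first point `a` and differences `n`. -/
def conf (a : Pt N) (n : Rel N r) : Conf N r := shift a (based n)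

/-- The translation by `a` in the Euclidean group. -/
def transl (a : Pt N) : ISO N := ((1 : SO N), a)

/-- The rotation `k` in the Euclidean group. -/
def rotation (k : SO N) : ISO N := (k, (0 : Pt N))

theorem act_transl (a : Pt N) (x : Conf N r) : act (transl a) x = shift a x := by
  funext i
  change rot 1 (x i) + a = x i + a
  rw [rot_one]

theorem measurable_diffs : Measurable (diffs : Conf N r → Rel N r) := by
  unfold diffs; fun_prop

theorem continuous_based : Continuous (based : Rel N r → Conf N r) := by
  refine continuous_pi fun i => Fin.cases ?_ (fun j => ?_) i
  · exact continuous_const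
  · exact continuous_apply j

theorem continuous_shift : Continuous fun p : Pt N × Conf N r => shift p.1 p.2 := by
  unfold shift; fun_prop

theorem measurable_shift (a : Pt N) : Measurable (shift a : Conf N r → Conf N r) :=
  (continuous_shift.comp (continuous_const.prodMk continuous_id)).measurable

theorem continuous_conf : Continuous fun p : Pt N × Rel N r => conf p.1 p.2 :=
  continuous_shift.comp (continuous_fst.prodMk (continuous_based.comp continuous_snd))

theorem diffs_based (n : Rel N r) : diffs (based n) = n := by
  funext i; simp [diffs, based]

theorem diffs_shift (a : Pt N) (x : Conf N r) : diffs (shift a x) = diffs x := by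
  funext i; simp [diffs, shift]

theorem diffs_conf (a : Pt N) (n : Rel N r) : diffs (conf a n) = n := by
  rw [conf, diffs_shift, diffs_based]

theorem conf_zero (a : Pt N) (n : Rel N r) : conf a n 0 = a := by
  simp [conf, shift, based]

theorem shift_zero_apply (a : Pt N) (x : Conf N r) : shift a x 0 = x 0 + a := rfl

theorem shift_shift (a b : Pt N) (x : Conf N r) : shift a (shift b x) = shift (a + b) x := by
  funext i; simp only [shift]; abel

theorem shift_zero (x : Conf N r) : shift 0 x = x := by
  funext i; simp [shift]

theorem shift_conf (a b : Pt N) (n : Rel N r) : shift a (conf b n) = conf (a + b) n :=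
  shift_shift _ _ _

theorem conf_diffs (x : Conf N r) : conf (x 0) (diffs x) = x := by
  funext i
  refine Fin.cases ?_ (fun j => ?_) i <;> simp [conf, shift, based, diffs]

theorem conf_zero_left (n : Rel N r) : conf 0 n = based n := shift_zero _

theorem measurePreserving_shift (a : Pt N) :
    MeasurePreserving (shift a : Conf N r → Conf N r) volume volume :=
  volume_preserving_pi fun _ => measurePreserving_add_right volume a

theorem measurePreserving_conf :
    MeasurePreserving (fun p : Pt N × Rel N r => conf p.1 p.2)
      ((volume : Measure (Pt N)).prod volume) volume := by
  have hB : MeasurePreserving (fun p : Pt N × Rel N r => (p.1, fun i => p.2 i + p.1))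
      ((volume : Measure (Pt N)).prod (volume : Measure (Rel N r)))
      ((volume : Measure (Pt N)).prod (volume : Measure (Rel N r))) := by
    refine MeasurePreserving.skew_product (g := fun (a : Pt N) (n : Rel N r) i => n i + a)
      (MeasurePreserving.id _) ?_ (Filter.Eventually.of_forall fun a =>
        (volume_preserving_pi fun _ => measurePreserving_add_right volume a).map_eq)
    change Measurable fun p : Pt N × Rel N r => fun i => p.2 i + p.1
    fun_prop
  have hC := ((volume_preserving_piFinSuccAbove (fun _ : Fin (r + 1) => Pt N) 0).symm _).comp hB
  have heq : (fun p : Pt N × Rel N r => conf p.1 p.2) =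
      (MeasurableEquiv.piFinSuccAbove (fun _ : Fin (r + 1) => Pt N) 0).symm ∘
      (fun p : Pt N × Rel N r => (p.1, fun i => p.2 i + p.1)) := by
    funext p i
    refine Fin.cases ?_ (fun j => ?_) i <;>
      simp [conf, shift, based, MeasurableEquiv.piFinSuccAbove]
  rw [heq]
  exact hC

theorem lintegral_conf {F : Conf N r → ℝ≥0∞} (hF : Measurable F) :
    ∫⁻ x, F x = ∫⁻ n : Rel N r, ∫⁻ a : Pt N, F (conf a n) := by
  rw [← measurePreserving_conf.lintegral_comp hF,
    lintegral_prod_symm _ (show Measurable fun p : Pt N × Rel N r => F (conf p.1 p.2) from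
      hF.comp continuous_conf.measurable).aemeasurable]

theorem ae_conf {p : Conf N r → Prop} (h : ∀ᵐ x, p x) :
    ∀ᵐ n : Rel N r, ∀ᵐ a : Pt N, p (conf a n) := by
  have h1 : ∀ᵐ q ∂((volume : Measure (Pt N)).prod (volume : Measure (Rel N r))),
      p (conf q.1 q.2) := measurePreserving_conf.quasiMeasurePreserving.ae h
  have h2 := (Measure.measurePreserving_swap (μ := (volume : Measure (Rel N r)))
    (ν := (volume : Measure (Pt N)))).quasiMeasurePreserving.ae h1
  exact Measure.ae_ae_of_ae_prod h2

/-- The fiber over n is a full copy of the translations, so `diffs` cannot be expected to preserve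
measure; preimages of null sets being null is all that is used. -/
theorem quasiMeasurePreserving_diffs :
    Measure.QuasiMeasurePreserving (diffs : Conf N r → Rel N r) volume volume := by
  refine ⟨measurable_diffs, Measure.AbsolutelyContinuous.mk fun s hs h0 => ?_⟩
  rw [Measure.map_apply measurable_diffs hs, ← measurePreserving_conf.measure_preimage
    (measurable_diffs hs).nullMeasurableSet]
  have : (fun p : Pt N × Rel N r => conf p.1 p.2) ⁻¹' (diffs ⁻¹' s) = Set.univ ×ˢ s := by
    ext p; simp [diffs_conf]
  rw [this, Measure.prod_prod, h0, mul_zero]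

theorem ae_diffs {p : Rel N r → Prop} (h : ∀ᵐ n, p n) : ∀ᵐ x : Conf N r, p (diffs x) :=
  quasiMeasurePreserving_diffs.ae h

/-- A property of the differences is constant along a fiber, so a single good point of the fiber
suffices. -/
theorem ae_of_ae_diffs {p : Rel N r → Prop} (h : ∀ᵐ x : Conf N r, p (diffs x)) : ∀ᵐ n, p n := by
  filter_upwards [ae_conf h] with n hn
  obtain ⟨a, ha⟩ := hn.exists
  rwa [diffs_conf] at ha

theorem act_mul (g h : ISO N) (x : Conf N r) : act (g * h) x = act g (act h x) := by
  funext i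
  change rot (g.1 * h.1) (x i) + (g.2 + rot g.1 h.2) = rot g.1 (rot h.1 (x i) + h.2) + g.2
  rw [rot_mul, map_add]; abel

theorem act_one (x : Conf N r) : act 1 x = x := by
  funext i
  change rot 1 (x i) + 0 = x i
  rw [rot_one, add_zero]

theorem act_inv_act (g : ISO N) (x : Conf N r) : act g⁻¹ (act g x) = x := by
  rw [← act_mul, inv_mul_cancel, act_one]

theorem act_act_inv (g : ISO N) (x : Conf N r) : act g (act g⁻¹ x) = x := by
  rw [← act_mul, mul_inv_cancel, act_one]

theorem continuous_act (g : ISO N) : Continuous (act g : Conf N r → Conf N r) :=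
  continuous_pi fun i => ((rot g.1).continuous.comp (continuous_apply i)).add continuous_const

theorem measurableEmbedding_act (g : ISO N) :
    MeasurableEmbedding (act g : Conf N r → Conf N r) :=
  MeasurableEquiv.measurableEmbedding
    { toFun := act g
      invFun := act g⁻¹
      left_inv := act_inv_act g
      right_inv := act_act_inv g
      measurable_toFun := (continuous_act g).measurable
      measurable_invFun := (continuous_act g⁻¹).measurable }

/-! ### Invariance of the kernel -/

section Kernel

variable {𝓣 : L2 (Conf N r) →L[ℂ] L2 (Conf N r)} {T : Conf N r → Conf N r → ℝ}

theorem integral_kernel_mul_indicatorConstLp {V : Set (Conf N r)} (hV : MeasurableSet V)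
    (hVf : volume V ≠ ∞) (S : Conf N r → ℝ) :
    ∫ y, (S y : ℂ) * (indicatorConstLp 2 hV hVf (1 : ℂ) : L2 (Conf N r)) y =
      ((∫ y in V, S y : ℝ) : ℂ) := by
  rw [← integral_complex_ofReal, ← integral_indicator hV]
  refine integral_congr_ae ?_
  filter_upwards [indicatorConstLp_coeFn (p := 2) (hs := hV) (hμs := hVf) (c := (1 : ℂ))] with y hy
  rw [hy]
  by_cases h : y ∈ V <;> simp [h]

/-- Commutation tested on the indicator of V. The exceptional null set depends on g and V;
continuity removes it in `kernel_act_le`. -/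
theorem ae_setIntegral_kernel_act (hT : IsTransferOperator 𝓣 T) (hinv : IsInvariant 𝓣)
    (g : ISO N) {V : Set (Conf N r)} (hV : MeasurableSet V) (hVf : volume V ≠ ∞) :
    ∀ᵐ x, ∫ y in V, T (act g x) (act g y) = ∫ y in V, T x y := by
  set ψ : L2 (Conf N r) := indicatorConstLp 2 hV hVf (1 : ℂ) with hψ
  have h1 := hT.apply (ell g ψ)
  have h2 : (ell g (𝓣 ψ) : Conf N r → ℂ) =ᵐ[volume] (𝓣 ψ) ∘ act g⁻¹ :=
    Lp.coeFn_compMeasurePreserving _ (measurePreserving_act g⁻¹)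
  have h3 : (ell g ψ : Conf N r → ℂ) =ᵐ[volume] ψ ∘ act g⁻¹ :=
    Lp.coeFn_compMeasurePreserving _ (measurePreserving_act g⁻¹)
  rw [hinv] at h1
  filter_upwards [(measurePreserving_act g).quasiMeasurePreserving.ae h1,
    (measurePreserving_act g).quasiMeasurePreserving.ae h2, hT.apply ψ] with x h1 h2 h4
  rw [h1, Function.comp, act_inv_act, h4] at h2
  have h5 : ∫ y, (T (act g x) y : ℂ) * (ell g ψ : L2 (Conf N r)) y =
      ∫ y, (T (act g x) (act g y) : ℂ) * ψ y := by
    rw [← (measurePreserving_act g).integral_comp (measurableEmbedding_act g)]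
    refine integral_congr_ae ?_
    filter_upwards [(measurePreserving_act g).quasiMeasurePreserving.ae h3] with y hy
    rw [hy, Function.comp, act_inv_act]
  rw [h5, integral_kernel_mul_indicatorConstLp hV hVf fun y => T (act g x) (act g y),
    integral_kernel_mul_indicatorConstLp hV hVf fun y => T x y] at h2
  exact_mod_cast h2

theorem kernel_act_le (hT : IsTransferOperator 𝓣 T) (hinv : IsInvariant 𝓣) (g : ISO N)
    (x₀ y₀ : Conf N r) : T x₀ y₀ ≤ T (act g x₀) (act g y₀) := by
  by_contra! hlt
  have hc1 : ∀ x, Continuous (T x) := fun x =>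
    hT.continuous.comp (continuous_const.prodMk continuous_id)
  have hW : IsOpen {p : Conf N r × Conf N r | T (act g p.1) (act g p.2) < T p.1 p.2} :=
    isOpen_lt (hT.continuous.comp (((continuous_act g).comp continuous_fst).prodMk
      ((continuous_act g).comp continuous_snd))) hT.continuous
  obtain ⟨U, V, hU, hV, hxU, hyV, hUV⟩ := isOpen_prod_iff.1 hW x₀ y₀ hlt
  -- The ball makes the volume finite and puts the set inside a compact one, on which continuous
  -- functions are integrable. Since this set is fixed before x is chosen, the exceptional null set
  -- cannot contain the open set U.
  set V' := V ∩ Metric.ball y₀ 1 with hV'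
  have hV'o : IsOpen V' := hV.inter Metric.isOpen_ball
  have hV'f : volume V' ≠ ∞ :=
    ((measure_mono Set.inter_subset_right).trans_lt measure_ball_lt_top).ne
  obtain ⟨x, hxU', hx⟩ : ∃ x ∈ U, ∫ y in V', T (act g x) (act g y) = ∫ y in V', T x y := by
    by_contra! hne
    have h0 : volume U = 0 := by
      refine measure_mono_null (fun x hx => ?_)
        (ae_iff.1 (ae_setIntegral_kernel_act hT hinv g hV'o.measurableSet hV'f))
      exact hne x hx
    exact (hU.measure_pos volume ⟨x₀, hxU⟩).ne' h0
  have hint : ∀ S : Conf N r → ℝ, Continuous S → IntegrableOn S V' := fun S hS =>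
    (hS.continuousOn.integrableOn_compact (isCompact_closedBall y₀ 1)).mono_set
      (Set.inter_subset_right.trans Metric.ball_subset_closedBall)
  have hi1 := hint _ (hc1 x)
  have hi2 := hint (fun y => T (act g x) (act g y)) ((hc1 _).comp (continuous_act g))
  have h0 : ∫ y in V', (T x y - T (act g x) (act g y)) = 0 := by
    rw [integral_sub hi1 hi2, hx, sub_self]
  have hpos : ∀ y ∈ V', 0 < T x y - T (act g x) (act g y) := fun y hy =>
    sub_pos.2 (hUV (Set.mk_mem_prod hxU' hy.1))
  rw [setIntegral_eq_zero_iff_of_nonneg_ae ((ae_restrict_mem hV'o.measurableSet).mono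
    fun y hy => (hpos y hy).le) (hi1.sub hi2)] at h0
  have : volume V' = 0 := by
    rw [Filter.EventuallyEq, ae_restrict_iff' hV'o.measurableSet] at h0
    refine measure_mono_null (fun y hy => ?_) (ae_iff.1 h0)
    simpa using ⟨hy, (hpos y hy).ne'⟩
  exact (hV'o.measure_pos volume ⟨y₀, hyV, Metric.mem_ball_self one_pos⟩).ne' this

/-- The kernel of an invariant transfer operator is invariant. -/
theorem kernel_act (hT : IsTransferOperator 𝓣 T) (hinv : IsInvariant 𝓣) (g : ISO N)
    (x y : Conf N r) : T (act g x) (act g y) = T x y := by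
  refine le_antisymm ?_ (kernel_act_le hT hinv g x y)
  simpa [act_inv_act] using kernel_act_le hT hinv g⁻¹ (act g x) (act g y)

end Kernel

/-! ### The action on nonnegative functions -/

/-- The integral operator with kernel `T` on nonnegative functions. -/
def posOp (T : Conf N r → Conf N r → ℝ) (F : Conf N r → ℝ≥0∞) (x : Conf N r) : ℝ≥0∞ :=
  ∫⁻ y, ENNReal.ofReal (T x y) * F y

/-- The action of `posOp` on functions of the differences. -/
def fiberOp (T : Conf N r → Conf N r → ℝ) (f : Rel N r → ℝ≥0∞) (n : Rel N r) : ℝ≥0∞ :=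
  posOp T (f ∘ diffs) (based n)

/-- A symmetric, continuous, almost everywhere strictly positive kernel, with bounded marginal,
that is invariant under Euclidean motions. -/
structure IsInvariantKernel (T : Conf N r → Conf N r → ℝ) : Prop where
  continuous : Continuous (Function.uncurry T)
  symm : ∀ x y, T x y = T y x
  nonneg : ∀ x y, 0 ≤ T x y
  pos : ∀ᵐ p : Conf N r × Conf N r, 0 < T p.1 p.2
  bounded : ∃ C : ℝ≥0, ∀ x, ∫⁻ y, ENNReal.ofReal (T x y) ≤ C
  act : ∀ g x y, T (act g x) (act g y) = T x y

theorem IsTransferOperator.isInvariantKernel {𝓣 : L2 (Conf N r) →L[ℂ] L2 (Conf N r)}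
    {T : Conf N r → Conf N r → ℝ} (hT : IsTransferOperator 𝓣 T) (hinv : IsInvariant 𝓣) :
    IsInvariantKernel T :=
  ⟨hT.continuous, hT.symm, hT.nonneg, hT.pos, hT.bounded, kernel_act hT hinv⟩

section PosOp

variable {T : Conf N r → Conf N r → ℝ}

theorem IsInvariantKernel.measurable (hT : IsInvariantKernel T) :
    Measurable (Function.uncurry fun x y => ENNReal.ofReal (T x y)) :=
  ENNReal.measurable_ofReal.comp hT.continuous.measurable

theorem IsInvariantKernel.measurable_left (hT : IsInvariantKernel T) (x : Conf N r) :
    Measurable fun y => ENNReal.ofReal (T x y) :=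
  hT.measurable.comp measurable_prodMk_left

theorem IsInvariantKernel.shift (hT : IsInvariantKernel T) (a : Pt N) (x y : Conf N r) :
    T (shift a x) (shift a y) = T x y := by
  rw [← act_transl, ← act_transl, hT.act]

theorem measurable_posOp (hT : IsInvariantKernel T) {F : Conf N r → ℝ≥0∞} (hF : Measurable F) :
    Measurable (posOp T F) :=
  (show Measurable (Function.uncurry fun x y => ENNReal.ofReal (T x y) * F y) from
    hT.measurable.mul (hF.comp measurable_snd)).lintegral_prod_right'

theorem measurable_fiberOp (hT : IsInvariantKernel T) {f : Rel N r → ℝ≥0∞} (hf : Measurable f) :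
    Measurable (fiberOp T f) :=
  (measurable_posOp hT (hf.comp measurable_diffs)).comp continuous_based.measurable

theorem posOp_mono {F F' : Conf N r → ℝ≥0∞} (h : F ≤ᵐ[volume] F') (x : Conf N r) :
    posOp T F x ≤ posOp T F' x := by
  refine lintegral_mono_ae ?_
  filter_upwards [h] with y hy
  gcongr

theorem posOp_congr {F F' : Conf N r → ℝ≥0∞} (h : F =ᵐ[volume] F') (x : Conf N r) :
    posOp T F x = posOp T F' x :=
  le_antisymm (posOp_mono h.le x) (posOp_mono h.symm.le x)

theorem posOp_add (hT : IsInvariantKernel T) {F : Conf N r → ℝ≥0∞} (hF : Measurable F)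
    (F' : Conf N r → ℝ≥0∞) (x : Conf N r) :
    posOp T (fun y => F y + F' y) x = posOp T F x + posOp T F' x := by
  simp only [posOp, mul_add]
  exact lintegral_add_left ((hT.measurable_left x).mul hF) _

theorem posOp_const_mul (hT : IsInvariantKernel T) {F : Conf N r → ℝ≥0∞} (hF : Measurable F)
    (c : ℝ≥0∞) (x : Conf N r) : posOp T (fun y => c * F y) x = c * posOp T F x := by
  simp only [posOp, mul_left_comm _ c]
  exact lintegral_const_mul _ ((hT.measurable_left x).mul hF)

theorem posOp_act (hT : IsInvariantKernel T) (g : ISO N) (F : Conf N r → ℝ≥0∞) (x : Conf N r) :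
    posOp T F (act g x) = posOp T (fun y => F (act g y)) x := by
  unfold posOp
  rw [← (measurePreserving_act g).lintegral_comp_emb (measurableEmbedding_act g)]
  simp only [hT.act]

theorem posOp_shift (hT : IsInvariantKernel T) (a : Pt N) (F : Conf N r → ℝ≥0∞) (x : Conf N r) :
    posOp T F (shift a x) = posOp T (fun y => F (shift a y)) x := by
  simpa only [act_transl] using posOp_act hT (transl a) F x

/-- Translating the first point of x to the origin leaves the kernel and the differences of y
unchanged; hence the operator descends to 𝒩. -/
theorem posOp_diffs (hT : IsInvariantKernel T) (f : Rel N r → ℝ≥0∞) (x : Conf N r) :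
    posOp T (fun y => f (diffs y)) x = fiberOp T f (diffs x) := by
  conv_lhs => rw [← conf_diffs x, conf, posOp_shift hT]
  simp only [diffs_shift]
  rfl

theorem fiberOp_mono {f f' : Rel N r → ℝ≥0∞} (h : f ≤ᵐ[volume] f') (n : Rel N r) :
    fiberOp T f n ≤ fiberOp T f' n :=
  posOp_mono (ae_diffs h) _

theorem fiberOp_add (hT : IsInvariantKernel T) {f : Rel N r → ℝ≥0∞} (hf : Measurable f)
    (f' : Rel N r → ℝ≥0∞) (n : Rel N r) :
    fiberOp T (fun n => f n + f' n) n = fiberOp T f n + fiberOp T f' n :=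
  posOp_add hT (hf.comp measurable_diffs) _ _

theorem fiberOp_const_mul (hT : IsInvariantKernel T) {f : Rel N r → ℝ≥0∞} (hf : Measurable f)
    (c : ℝ≥0∞) (n : Rel N r) : fiberOp T (fun n => c * f n) n = c * fiberOp T f n :=
  posOp_const_mul hT (hf.comp measurable_diffs) _ _

/-- The kernel of `fiberOp`. -/
def fiberKernel (T : Conf N r → Conf N r → ℝ) (n n' : Rel N r) : ℝ≥0∞ :=
  ∫⁻ b : Pt N, ENNReal.ofReal (T (based n) (conf b n'))

theorem fiberOp_eq_lintegral (hT : IsInvariantKernel T) {f : Rel N r → ℝ≥0∞} (hf : Measurable f)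
    (n : Rel N r) : fiberOp T f n = ∫⁻ n', fiberKernel T n n' * f n' := by
  rw [fiberOp, posOp, lintegral_conf
    (show Measurable fun y => ENNReal.ofReal (T (based n) y) * (f ∘ diffs) y from
      (hT.measurable_left _).mul (hf.comp measurable_diffs))]
  refine lintegral_congr fun n' => ?_
  simp only [Function.comp, diffs_conf]
  exact lintegral_mul_const _ ((hT.measurable_left _).comp
    (continuous_conf.comp (continuous_id.prodMk continuous_const)).measurable)

theorem measurable_fiberKernel (hT : IsInvariantKernel T) :
    Measurable (Function.uncurry (fiberKernel T)) := by
  have : Measurable fun p : (Rel N r × Rel N r) × Pt N =>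
      ENNReal.ofReal (T (based p.1.1) (conf p.2 p.1.2)) :=
    hT.measurable.comp ((continuous_based.comp (continuous_fst.comp continuous_fst)).prodMk
      (continuous_conf.comp (continuous_snd.prodMk
        (continuous_snd.comp continuous_fst)))).measurable
  exact this.lintegral_prod_right'

/-- Reflect b, then move the pair by b and use the symmetry of T. -/
theorem fiberKernel_symm (hT : IsInvariantKernel T) (n n' : Rel N r) :
    fiberKernel T n n' = fiberKernel T n' n := by
  unfold fiberKernel
  rw [← lintegral_neg_eq_self]
  refine lintegral_congr fun b => ?_
  rw [hT.symm, ← hT.shift b, shift_conf, add_neg_cancel, conf_zero_left]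
  rfl

/-- Positivity of T holds only almost everywhere and says nothing directly about first points at the
origin. Some point of almost every fiber is good, and translation carries it to the origin. -/
theorem ae_fiberKernel_ne_zero (hT : IsInvariantKernel T) :
    ∀ᵐ n : Rel N r, ∀ᵐ n' : Rel N r, fiberKernel T n n' ≠ 0 := by
  have h1 : ∀ᵐ x : Conf N r, ∀ᵐ y : Conf N r, 0 < T x y := Measure.ae_ae_of_ae_prod hT.pos
  filter_upwards [ae_conf h1] with n hn
  obtain ⟨a, ha⟩ := hn.exists
  filter_upwards [ae_conf ha] with n' hn'
  have hm : Measurable fun b : Pt N => ENNReal.ofReal (T (based n) (conf b n')) :=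
    (hT.measurable_left _).comp (continuous_conf.comp
      (continuous_id.prodMk continuous_const)).measurable
  rw [fiberKernel, Ne, lintegral_eq_zero_iff hm]
  intro h0
  have h0' : ∀ᵐ b : Pt N, ENNReal.ofReal (T (based n) (conf (-a + b) n')) = 0 :=
    (measurePreserving_add_left volume (-a)).quasiMeasurePreserving.ae h0
  obtain ⟨b, hb, hb'⟩ := (hn'.and h0').exists
  rw [← hT.shift a, shift_conf, add_neg_cancel_left, ENNReal.ofReal_eq_zero] at hb'
  exact absurd hb hb'.not_gt

/-- A bound on the fiber operator. -/
theorem lintegral_fiberOp_sq_lt_top (hT : IsInvariantKernel T) {f : Rel N r → ℝ≥0∞}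
    (hf : Measurable f) (h : ∫⁻ n, f n ^ 2 ≠ ∞) : ∫⁻ n, fiberOp T f n ^ 2 < ∞ := by
  obtain ⟨C, hC⟩ := hT.bounded
  have hs := schur_test (volume : Measure (Rel N r)) (measurable_fiberKernel hT)
    (fiberKernel_symm hT) (h := fun _ => 1) measurable_const (by simp) (by simp) (κ := C)
    (Filter.Eventually.of_forall fun n => by
      rw [← fiberOp_eq_lintegral hT measurable_const]
      simpa [fiberOp, posOp] using hC (based n)) hf
  simp only [← fiberOp_eq_lintegral hT hf] at hs
  exact hs.trans_lt (ENNReal.mul_lt_top (by simp) h.lt_top)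

/-- Schur's test with weight one. Only finiteness matters here, so that values in [0, ∞] may be read
as complex numbers; the sharp constant comes from the next lemmas. -/
theorem lintegral_posOp_sq_lt_top (hT : IsInvariantKernel T) {F : Conf N r → ℝ≥0∞}
    (hF : Measurable F) (h : ∫⁻ n, F n ^ 2 ≠ ∞) : ∫⁻ x, posOp T F x ^ 2 < ∞ := by
  obtain ⟨C, hC⟩ := hT.bounded
  have hs := schur_test (volume : Measure (Conf N r)) hT.measurable
    (fun x y => by rw [hT.symm]) (h := fun _ => 1) measurable_const (by simp) (by simp) (κ := C)
    (Filter.Eventually.of_forall fun x => by simpa using hC x) hF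
  exact hs.trans_lt (ENNReal.mul_lt_top (by simp) h.lt_top)

end PosOp

/-! ### Comparison of the norms -/

theorem lintegral_enorm_sq_Lp {α E : Type*} [MeasurableSpace α] {μ : Measure α}
    [NormedAddCommGroup E] (f : Lp E 2 μ) : ∫⁻ x, ‖f x‖ₑ ^ 2 ∂μ = ‖f‖ₑ ^ 2 := by
  rw [Lp.enorm_def, eLpNorm_eq_lintegral_rpow_enorm_toReal (by norm_num) (by norm_num)]
  simp only [ENNReal.toReal_ofNat, ENNReal.rpow_two]
  rw [← ENNReal.rpow_two, ← ENNReal.rpow_mul]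
  norm_num

theorem memLp_toReal {α : Type*} [MeasurableSpace α] {μ : Measure α} {F : α → ℝ≥0∞}
    (hF : Measurable F) (h : ∫⁻ x, F x ^ 2 ∂μ ≠ ∞) :
    MemLp (fun x => ((F x).toReal : ℂ)) 2 μ := by
  refine ⟨(Complex.measurable_ofReal.comp hF.ennreal_toReal).aestronglyMeasurable, ?_⟩
  rw [eLpNorm_lt_top_iff_lintegral_rpow_enorm_lt_top (by norm_num) (by norm_num)]
  simp only [ENNReal.toReal_ofNat, ENNReal.rpow_two]
  refine (lintegral_mono fun x => ?_).trans_lt h.lt_top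
  gcongr
  rw [← ofReal_norm, Complex.norm_real, Real.norm_of_nonneg ENNReal.toReal_nonneg]
  exact ENNReal.ofReal_toReal_le

theorem ae_ne_top_of_lintegral_sq {α : Type*} [MeasurableSpace α] {μ : Measure α} {F : α → ℝ≥0∞}
    (hF : Measurable F) (h : ∫⁻ x, F x ^ 2 ∂μ ≠ ∞) : ∀ᵐ x ∂μ, F x ≠ ∞ := by
  filter_upwards [ae_lt_top (hF.pow_const 2) h] with x hx h'
  simp [h'] at hx

theorem enorm_toReal {a : ℝ≥0∞} (h : a ≠ ∞) : ‖(a.toReal : ℂ)‖ₑ = a := by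
  rw [← ofReal_norm, Complex.norm_real, Real.norm_of_nonneg ENNReal.toReal_nonneg,
    ENNReal.ofReal_toReal h]

section Norms

variable {𝓣 : L2 (Conf N r) →L[ℂ] L2 (Conf N r)} {T : Conf N r → Conf N r → ℝ}

/-- The Bochner integral against the kernel of a nonnegative function. -/
theorem integral_kernel_toReal (hT : IsInvariantKernel T) {F : Conf N r → ℝ≥0∞}
    (hF : Measurable F) (hf : ∀ᵐ y, F y ≠ ∞) (x : Conf N r) :
    ∫ y, (T x y : ℂ) * ((F y).toReal : ℂ) = ((posOp T F x).toReal : ℂ) := by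
  have h1 : ∀ y, (T x y : ℂ) * ((F y).toReal : ℂ) = ((T x y * (F y).toReal : ℝ) : ℂ) :=
    fun y => by push_cast; rfl
  simp only [h1]
  rw [integral_complex_ofReal, integral_eq_lintegral_of_nonneg_ae
    (Filter.Eventually.of_forall fun y => mul_nonneg (hT.nonneg x y) ENNReal.toReal_nonneg)]
  · congr 2
    refine lintegral_congr_ae ?_
    filter_upwards [hf] with y hy
    rw [ENNReal.ofReal_mul (hT.nonneg x y), ENNReal.ofReal_toReal hy]
  · exact ((hT.continuous.comp (continuous_const.prodMk continuous_id)).measurable.mul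
      hF.ennreal_toReal).aestronglyMeasurable

/-- The operator norm enters the calculus of [0, ∞]-valued functions here: on nonnegative functions
the Bochner and Lebesgue integrals agree. -/
theorem lintegral_posOp_sq_le (hTO : IsTransferOperator 𝓣 T) (hT : IsInvariantKernel T)
    {F : Conf N r → ℝ≥0∞} (hF : Measurable F) (h : ∫⁻ x, F x ^ 2 ≠ ∞) :
    ∫⁻ x, posOp T F x ^ 2 ≤ (‖𝓣‖₊ : ℝ≥0∞) ^ 2 * ∫⁻ x, F x ^ 2 := by
  have hFt := ae_ne_top_of_lintegral_sq hF h
  have hP := ae_ne_top_of_lintegral_sq (measurable_posOp hT hF)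
    (lintegral_posOp_sq_lt_top hT hF h).ne
  set ψ : L2 (Conf N r) := (memLp_toReal hF h).toLp with hψ
  have hψF : ∀ᵐ x, ψ x = ((F x).toReal : ℂ) := (memLp_toReal hF h).coeFn_toLp
  have h1 : ∀ᵐ x, ‖𝓣 ψ x‖ₑ = posOp T F x := by
    filter_upwards [hTO.apply ψ, hP] with x hx hPx
    have : ∫ y, (T x y : ℂ) * ψ y = ∫ y, (T x y : ℂ) * ((F y).toReal : ℂ) := by
      refine integral_congr_ae ?_
      filter_upwards [hψF] with y hy
      rw [hy]
    rw [hx, this, integral_kernel_toReal hT hF hFt, enorm_toReal hPx]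
  have h2 : ∫⁻ x, posOp T F x ^ 2 = ‖𝓣 ψ‖ₑ ^ 2 := by
    rw [← lintegral_enorm_sq_Lp]
    refine lintegral_congr_ae ?_
    filter_upwards [h1] with x hx
    rw [hx]
  have h3 : ∫⁻ x, F x ^ 2 = ‖ψ‖ₑ ^ 2 := by
    rw [← lintegral_enorm_sq_Lp]
    refine lintegral_congr_ae ?_
    filter_upwards [hψF, hFt] with x hx hx'
    rw [hx, enorm_toReal hx']
  rw [h2, h3, ← mul_pow]
  exact pow_le_pow_left' (𝓣.le_opENorm ψ) 2

/-- A positive function of the differences that is an eigenfunction bounds the norm. -/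
theorem opNorm_le_of_fiberOp_le (hTO : IsTransferOperator 𝓣 T) (hT : IsInvariantKernel T)
    {f : Rel N r → ℝ≥0∞} (hf : Measurable f) (h0 : ∀ᵐ n, f n ≠ 0) (hi : ∀ᵐ n, f n ≠ ∞)
    {κ : ℝ≥0} (hκ : ∀ᵐ n, fiberOp T f n ≤ κ * f n) : ‖𝓣‖₊ ≤ κ := by
  refine 𝓣.opNNNorm_le_bound κ fun ψ => ?_
  -- The weight f ∘ `diffs` need not be square integrable over configurations; Schur's test only
  -- asks that it be finite and nonzero almost everywhere.
  have hs := schur_test (volume : Measure (Conf N r)) hT.measurable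
    (fun x y => by rw [hT.symm]) (h := f ∘ diffs) (hf.comp measurable_diffs)
    (ae_diffs h0) (ae_diffs hi) (κ := κ) (by
      filter_upwards [ae_diffs hκ] with x hx
      exact (posOp_diffs hT f x).trans_le hx)
    (g := fun y => ‖ψ y‖ₑ) (Lp.stronglyMeasurable ψ).measurable.enorm
  have h2 : ‖𝓣 ψ‖ₑ ^ 2 ≤ (κ * ‖ψ‖ₑ) ^ 2 := by
    rw [mul_pow, ← lintegral_enorm_sq_Lp, ← lintegral_enorm_sq_Lp]
    refine le_trans (lintegral_mono_ae ?_) hs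
    filter_upwards [hTO.apply ψ] with x hx
    rw [hx]
    gcongr
    refine (enorm_integral_le_lintegral_enorm _).trans (le_of_eq (lintegral_congr fun y => ?_))
    rw [enorm_mul, ← ofReal_norm (T x y : ℂ), Complex.norm_real,
      Real.norm_of_nonneg (hT.nonneg x y)]
  have h3 : ‖𝓣 ψ‖ₑ ≤ κ * ‖ψ‖ₑ := le_of_not_gt fun hlt =>
    absurd h2 (ENNReal.pow_lt_pow_left two_ne_zero hlt).not_ge
  rw [enorm_eq_nnnorm, enorm_eq_nnnorm] at h3
  exact_mod_cast h3

/-- The part of the fiber operator that comes from bounded translations. -/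
def truncFiberOp (T : Conf N r → Conf N r → ℝ) (D : ℝ) (f : Rel N r → ℝ≥0∞) (n : Rel N r) :
    ℝ≥0∞ :=
  posOp T (fun y => (Metric.closedBall (0 : Pt N) D).indicator 1 (y 0) * f (diffs y)) (based n)

theorem measurable_ballCutoff (D : ℝ) {f : Rel N r → ℝ≥0∞} (hf : Measurable f) :
    Measurable fun y : Conf N r =>
      (Metric.closedBall (0 : Pt N) D).indicator (1 : Pt N → ℝ≥0∞) (y 0) * f (diffs y) :=
  ((measurable_one.indicator measurableSet_closedBall).comp (measurable_pi_apply 0)).mul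
    (hf.comp measurable_diffs)

theorem lintegral_ballCutoff_sq (D : ℝ) {f : Rel N r → ℝ≥0∞} (hf : Measurable f) :
    ∫⁻ y : Conf N r, ((Metric.closedBall (0 : Pt N) D).indicator (1 : Pt N → ℝ≥0∞) (y 0) *
      f (diffs y)) ^ 2 = volume (Metric.closedBall (0 : Pt N) D) * ∫⁻ n, f n ^ 2 := by
  rw [lintegral_conf ((measurable_ballCutoff D hf).pow_const 2),
    ← lintegral_const_mul _ (hf.pow_const 2)]
  refine lintegral_congr fun n => ?_
  simp only [conf_zero, diffs_conf, mul_pow]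
  rw [lintegral_mul_const _ ((measurable_one.indicator measurableSet_closedBall).pow_const 2)]
  congr 1
  rw [← lintegral_indicator_one measurableSet_closedBall]
  refine lintegral_congr fun a => ?_
  by_cases h : a ∈ Metric.closedBall (0 : Pt N) D <;> simp [h]

/-- If the first point lies within R of the origin and is displaced by at most D, it stays within R
+ D. So on the smaller ball the truncated operator is dominated by 𝓣 acting on f ∘ `diffs` cut off
at R + D. -/
theorem volume_ball_mul_lintegral_truncFiberOp_sq_le (hTO : IsTransferOperator 𝓣 T)
    (hT : IsInvariantKernel T) {f : Rel N r → ℝ≥0∞} (hf : Measurable f)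
    (h : ∫⁻ n, f n ^ 2 ≠ ∞) (D R : ℝ) :
    volume (Metric.closedBall (0 : Pt N) R) * ∫⁻ n, truncFiberOp T D f n ^ 2 ≤
      (‖𝓣‖₊ : ℝ≥0∞) ^ 2 *
        (volume (Metric.closedBall (0 : Pt N) (R + D)) * ∫⁻ n, f n ^ 2) := by
  have hm : Measurable (truncFiberOp T D f) :=
    (measurable_posOp hT (measurable_ballCutoff D hf)).comp continuous_based.measurable
  rw [← lintegral_ballCutoff_sq R hm, ← lintegral_ballCutoff_sq (R + D) hf]
  refine le_trans (lintegral_mono fun x => ?_)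
    (lintegral_posOp_sq_le hTO hT (measurable_ballCutoff (R + D) hf) ?_)
  · refine pow_le_pow_left' ?_ 2
    by_cases hx : x 0 ∈ Metric.closedBall (0 : Pt N) R
    · rw [Set.indicator_of_mem hx, Pi.one_apply, one_mul]
      conv_rhs => rw [← conf_diffs x, conf, posOp_shift hT]
      refine posOp_mono (Filter.Eventually.of_forall fun y => ?_) _
      simp only [diffs_shift, shift_zero_apply]
      refine mul_le_mul_left ?_ _
      by_cases hy : y 0 ∈ Metric.closedBall (0 : Pt N) D
      · have hxy : y 0 + x 0 ∈ Metric.closedBall (0 : Pt N) (R + D) := by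
          rw [mem_closedBall_zero_iff] at hx hy ⊢
          exact (norm_add_le _ _).trans (by linarith)
        rw [Set.indicator_of_mem hy, Set.indicator_of_mem hxy]
        rfl
      · rw [Set.indicator_of_notMem hy]
        exact zero_le
    · rw [Set.indicator_of_notMem hx, zero_mul]
      exact zero_le
  · rw [lintegral_ballCutoff_sq _ hf]
    exact ENNReal.mul_ne_top measure_closedBall_lt_top.ne h

theorem volume_closedBall_eq (R : ℝ) (hR : 0 ≤ R) : volume (Metric.closedBall (0 : Pt N) R) =
    ENNReal.ofReal (R ^ N) * volume (Metric.closedBall (0 : Pt N) 1) := by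
  rw [Measure.addHaar_closedBall' _ _ hR, finrank_euclideanSpace_fin]

theorem lintegral_truncFiberOp_sq_le (hTO : IsTransferOperator 𝓣 T)
    (hT : IsInvariantKernel T) {f : Rel N r → ℝ≥0∞} (hf : Measurable f)
    (h : ∫⁻ n, f n ^ 2 ≠ ∞) (D : ℝ) (hD : 0 ≤ D) :
    ∫⁻ n, truncFiberOp T D f n ^ 2 ≤ (‖𝓣‖₊ : ℝ≥0∞) ^ 2 * ∫⁻ n, f n ^ 2 := by
  have hb : ∀ R : ℝ, 0 < R → ∫⁻ n, truncFiberOp T D f n ^ 2 ≤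
      ENNReal.ofReal ((1 + D / R) ^ N) * ((‖𝓣‖₊ : ℝ≥0∞) ^ 2 * ∫⁻ n, f n ^ 2) := by
    intro R hR
    have h1 := volume_ball_mul_lintegral_truncFiberOp_sq_le hTO hT hf h D R
    have h2 : volume (Metric.closedBall (0 : Pt N) (R + D)) =
        volume (Metric.closedBall (0 : Pt N) R) * ENNReal.ofReal ((1 + D / R) ^ N) := by
      rw [volume_closedBall_eq _ hR.le, volume_closedBall_eq _ (by positivity), mul_right_comm,
        ← ENNReal.ofReal_mul (by positivity), ← mul_pow, mul_add, mul_one,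
        mul_div_cancel₀ _ hR.ne']
    have h3 : volume (Metric.closedBall (0 : Pt N) R) ≠ 0 :=
      (Metric.measure_closedBall_pos volume _ hR).ne'
    rw [h2] at h1
    refine (ENNReal.mul_le_mul_iff_right h3 measure_closedBall_lt_top.ne).1 (h1.trans_eq ?_)
    ring
  -- The ratio of the volumes of the balls of radii R + D and R tends to one: the translation group
  -- is amenable, which is why no constant is lost.
  have hlim : Filter.Tendsto (fun R : ℝ =>
      ENNReal.ofReal ((1 + D / R) ^ N) * ((‖𝓣‖₊ : ℝ≥0∞) ^ 2 * ∫⁻ n, f n ^ 2)) Filter.atTop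
      (nhds (1 * ((‖𝓣‖₊ : ℝ≥0∞) ^ 2 * ∫⁻ n, f n ^ 2))) := by
    refine ENNReal.Tendsto.mul_const ?_ (Or.inl one_ne_zero)
    have : Filter.Tendsto (fun R : ℝ => (1 + D / R) ^ N) Filter.atTop (nhds ((1 + 0) ^ N)) :=
      ((tendsto_const_nhds.div_atTop Filter.tendsto_id).const_add 1).pow N
    simpa using ENNReal.tendsto_ofReal this
  rw [one_mul] at hlim
  refine ge_of_tendsto hlim ?_
  filter_upwards [Filter.eventually_gt_atTop 0] with R hR using hb R hR

/-- The norm of the fiber operator is at most that of the transfer operator. -/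
theorem lintegral_fiberOp_sq_le (hTO : IsTransferOperator 𝓣 T)
    (hT : IsInvariantKernel T) {f : Rel N r → ℝ≥0∞} (hf : Measurable f)
    (h : ∫⁻ n, f n ^ 2 ≠ ∞) :
    ∫⁻ n, fiberOp T f n ^ 2 ≤ (‖𝓣‖₊ : ℝ≥0∞) ^ 2 * ∫⁻ n, f n ^ 2 := by
  -- Monotone convergence in the truncation radius is used twice, for the kernel integral at each
  -- point and for the integral of the squares.
  have hmono : Monotone fun j : ℕ => truncFiberOp T j f := by
    intro i j hij n
    refine posOp_mono (Filter.Eventually.of_forall fun y => ?_) _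
    refine mul_le_mul_left (Set.indicator_le_indicator_of_subset
      (Metric.closedBall_subset_closedBall (by exact_mod_cast hij)) (fun _ => zero_le) _) _
  have hm : ∀ j : ℕ, Measurable (truncFiberOp T j f) := fun j =>
    (measurable_posOp hT (measurable_ballCutoff j hf)).comp continuous_based.measurable
  have hsup : ∀ n, fiberOp T f n = ⨆ j : ℕ, truncFiberOp T j f n := by
    intro n
    simp only [truncFiberOp, fiberOp, posOp]
    rw [← lintegral_iSup (f := fun (j : ℕ) y => ENNReal.ofReal (T (based n) y) *
      ((Metric.closedBall (0 : Pt N) j).indicator (1 : Pt N → ℝ≥0∞) (y 0) * f (diffs y)))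
      (fun j => (hT.measurable_left _).mul (measurable_ballCutoff j hf))]
    · refine lintegral_congr fun y => ?_
      rw [← ENNReal.mul_iSup, ← ENNReal.iSup_mul]
      congr 1
      obtain ⟨j, hj⟩ := exists_nat_ge ‖y 0‖
      have : ⨆ j : ℕ, (Metric.closedBall (0 : Pt N) j).indicator (1 : Pt N → ℝ≥0∞) (y 0) = 1 := by
        refine le_antisymm (iSup_le fun i => Set.indicator_le_self' (by simp) _) ?_
        refine le_iSup_of_le j ?_
        rw [Set.indicator_of_mem (by simpa using hj)]
        rfl
      rw [this, one_mul]
      rfl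
    · intro i j hij y
      refine mul_le_mul_right (mul_le_mul_left (Set.indicator_le_indicator_of_subset
        (Metric.closedBall_subset_closedBall (by exact_mod_cast hij)) (fun _ => zero_le) _) _) _
  have hsq : ∀ n, fiberOp T f n ^ 2 = ⨆ j : ℕ, truncFiberOp T j f n ^ 2 := fun n => by
    rw [hsup]
    exact Monotone.map_iSup_of_continuousAt (f := fun a : ℝ≥0∞ => a ^ 2)
      (ENNReal.continuous_pow 2).continuousAt (fun a b h => pow_le_pow_left' h 2) (by simp)
  simp only [hsq]
  rw [lintegral_iSup (fun j => (hm j).pow_const 2)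
    (fun i j hij n => pow_le_pow_left' (hmono hij n) 2)]
  exact iSup_le fun j => lintegral_truncFiberOp_sq_le hTO hT hf h j (by positivity)

end Norms

/-! ### Perron–Frobenius theory of the fiber operator -/

/-- `κ` bounds the `L²` norm of the fiber operator. -/
def IsFiberBound (T : Conf N r → Conf N r → ℝ) (κ : ℝ≥0) : Prop :=
  ∀ f : Rel N r → ℝ≥0∞, Measurable f → ∫⁻ n, f n ^ 2 ≠ ∞ →
    ∫⁻ n, fiberOp T f n ^ 2 ≤ (κ : ℝ≥0∞) ^ 2 * ∫⁻ n, f n ^ 2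

section PerronFrobenius

variable {T : Conf N r → Conf N r → ℝ} {κ : ℝ≥0}

/-- A subsolution whose image has no larger norm than κ f must be a solution, since the squares are
ordered pointwise and have equal finite integrals. The norm bound is asked for this f alone, because
the norm of the singlet operator controls rotation invariant functions only. -/
theorem fiberOp_eq_of_le (hT : IsInvariantKernel T) {f : Rel N r → ℝ≥0∞} (hf : Measurable f)
    (h : ∫⁻ n, f n ^ 2 ≠ ∞) (hle : ∀ᵐ n, κ * f n ≤ fiberOp T f n)
    (hb : ∫⁻ n, fiberOp T f n ^ 2 ≤ (κ : ℝ≥0∞) ^ 2 * ∫⁻ n, f n ^ 2) :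
    ∀ᵐ n, fiberOp T f n = κ * f n := by
  have e : ∫⁻ n, (κ * f n) ^ 2 = (κ : ℝ≥0∞) ^ 2 * ∫⁻ n, f n ^ 2 := by
    simp only [mul_pow]
    exact lintegral_const_mul _ (hf.pow_const 2)
  have h1 : (fun n => (κ * f n) ^ 2) =ᵐ[volume] fun n => fiberOp T f n ^ 2 := by
    refine ae_eq_of_ae_le_of_lintegral_le ?_ ?_ ((measurable_fiberOp hT hf).pow_const 2).aemeasurable
      (hb.trans_eq e.symm)
    · filter_upwards [hle] with n hn using pow_le_pow_left' hn 2
    · rw [e]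
      exact ENNReal.mul_ne_top (by simp) h
  filter_upwards [h1, hle] with n hn hn'
  refine le_antisymm (le_of_not_gt fun hlt => ?_) hn'
  exact (ENNReal.pow_lt_pow_left two_ne_zero hlt).ne hn

/-- If f vanishes at one typical n, the integral of f against a positive kernel vanishes there,
which forces f to vanish almost everywhere. -/
theorem ae_eq_zero_or_ne_zero_of_fiberOp_eq (hT : IsInvariantKernel T) {f : Rel N r → ℝ≥0∞}
    (hf : Measurable f) (he : ∀ᵐ n, fiberOp T f n = κ * f n) :
    (∀ᵐ n, f n = 0) ∨ ∀ᵐ n, f n ≠ 0 := by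
  by_cases h : ∀ᵐ n, f n = 0
  · exact Or.inl h
  refine Or.inr ?_
  filter_upwards [he, ae_fiberKernel_ne_zero hT] with n hn hk h0
  rw [h0, mul_zero, fiberOp_eq_lintegral hT hf, lintegral_eq_zero_iff
    (show Measurable fun n' => fiberKernel T n n' * f n' from
      ((measurable_fiberKernel hT).comp measurable_prodMk_left).mul hf)] at hn
  refine h ?_
  filter_upwards [hn, hk] with n' h1 h2
  exact (mul_eq_zero.1 h1).resolve_left h2

/-- Subtraction in [0, ∞] is truncated, so f - q m is the positive part of the difference. It is a
square integrable subsolution, hence a solution, hence zero or positive almost everywhere. -/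
theorem eigenfunction_le_or_gt (hT : IsInvariantKernel T) (hκ : IsFiberBound T κ)
    {f m : Rel N r → ℝ≥0∞} (hf : Measurable f) (hm : Measurable m)
    (hf2 : ∫⁻ n, f n ^ 2 ≠ ∞) (hfe : ∀ᵐ n, fiberOp T f n = κ * f n)
    (hme : ∀ᵐ n, fiberOp T m n = κ * m n) (q : ℝ≥0) :
    (∀ᵐ n, f n ≤ q * m n) ∨ ∀ᵐ n, q * m n < f n := by
  have hg : Measurable fun n => f n - q * m n := hf.sub (hm.const_mul _)
  have hg2 : ∫⁻ n, (f n - q * m n) ^ 2 ≠ ∞ :=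
    ((lintegral_mono fun n => pow_le_pow_left' tsub_le_self 2).trans_lt hf2.lt_top).ne
  have hle : ∀ᵐ n, κ * (f n - q * m n) ≤ fiberOp T (fun n => f n - q * m n) n := by
    filter_upwards [hfe, hme] with n h1 h2
    rw [ENNReal.mul_sub (by simp), mul_left_comm, ← h1, ← h2, tsub_le_iff_right,
      ← fiberOp_const_mul hT hm, ← fiberOp_add hT hg]
    exact fiberOp_mono (Filter.Eventually.of_forall fun n => le_tsub_add) n
  rcases ae_eq_zero_or_ne_zero_of_fiberOp_eq hT hg
    (fiberOp_eq_of_le hT hg hg2 hle (hκ _ hg hg2)) with h | h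
  · left
    filter_upwards [h] with n hn using tsub_eq_zero_iff_le.1 hn
  · right
    filter_upwards [h] with n hn using tsub_pos_iff_lt.1 (pos_iff_ne_zero.2 hn)

/-- Eigenfunctions at the top of the spectrum are proportional. -/
theorem exists_eigenfunction_eq_mul (hT : IsInvariantKernel T) (hκ : IsFiberBound T κ)
    {f m : Rel N r → ℝ≥0∞} (hf : Measurable f) (hm : Measurable m)
    (hf2 : ∫⁻ n, f n ^ 2 ≠ ∞) (hm2 : ∫⁻ n, m n ^ 2 ≠ ∞) (hm0 : ∀ᵐ n, m n ≠ 0)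
    (hfe : ∀ᵐ n, fiberOp T f n = κ * f n) (hme : ∀ᵐ n, fiberOp T m n = κ * m n) :
    ∃ c : ℝ≥0, ∀ᵐ n, f n = c * m n := by
  have hmt := ae_ne_top_of_lintegral_sq hm hm2
  have hft := ae_ne_top_of_lintegral_sq hf hf2
  set ρ : Rel N r → ℝ≥0∞ := fun n => f n / m n with hρ
  set c := essSup ρ volume with hc
  have hle : ∀ᵐ n, ρ n ≤ c := ae_le_essSup
  -- For q below the essential supremum of f / m, the first alternative is impossible. Rational q
  -- give one null set for all thresholds, so the ratio equals its essential supremum.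
  have hge : ∀ᵐ n, ∀ q : ℚ, ((Real.toNNReal q : ℝ≥0) : ℝ≥0∞) < c →
      ((Real.toNNReal q : ℝ≥0) : ℝ≥0∞) < ρ n := by
    refine ae_all_iff.2 fun q => ?_
    by_cases hq : ((Real.toNNReal q : ℝ≥0) : ℝ≥0∞) < c
    · rcases eigenfunction_le_or_gt hT hκ hf hm hf2 hfe hme (Real.toNNReal q) with h | h
      · refine absurd (essSup_le_of_ae_le _ ?_) hq.not_ge
        filter_upwards [h] with n hn using ENNReal.div_le_of_le_mul hn
      · filter_upwards [h, hm0, hmt] with n hn h1 h2 _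
        exact (ENNReal.lt_div_iff_mul_lt (Or.inl h1) (Or.inl h2)).2 hn
    · exact Filter.Eventually.of_forall fun n h => absurd h hq
  have heq : ∀ᵐ n, f n = c * m n := by
    filter_upwards [hle, hge, hm0, hmt] with n h1 h2 h3 h4
    have : ρ n = c := by
      refine le_antisymm h1 (le_of_not_gt fun hlt => ?_)
      obtain ⟨q, -, hq1, hq2⟩ := ENNReal.lt_iff_exists_rat_btwn.1 hlt
      exact absurd (h2 q hq2) hq1.not_gt
    rw [← this, hρ, ENNReal.div_mul_cancel h3 h4]
  -- The constant is finite because f is finite and m nonzero at a common point.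
  have hctop : c ≠ ∞ := by
    obtain ⟨n, h1, h2, h3⟩ := (heq.and (hm0.and hft)).exists
    intro h
    rw [h, ENNReal.top_mul h2] at h1
    exact h3 h1
  refine ⟨c.toNNReal, ?_⟩
  rw [ENNReal.coe_toNNReal hctop]
  exact heq

end PerronFrobenius

/-! ### A Liouville theorem -/

theorem ae_of_ae_conf {p : Conf N r → Prop} (hp : MeasurableSet {x | p x})
    (h : ∀ᵐ n : Rel N r, ∀ᵐ a : Pt N, p (conf a n)) : ∀ᵐ x, p x := by
  have hm : MeasurableSet {q : Pt N × Rel N r | p (conf q.1 q.2)} :=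
    continuous_conf.measurable hp
  have h1 : ∀ᵐ a : Pt N, ∀ᵐ n : Rel N r, p (conf a n) := (Measure.ae_ae_comm hm).2 h
  have h2 : ∀ᵐ q ∂((volume : Measure (Pt N)).prod (volume : Measure (Rel N r))),
      p (conf q.1 q.2) := (Measure.ae_prod_iff_ae_ae hm).2 h1
  rw [ae_iff] at h2 ⊢
  rw [← measurePreserving_conf.measure_preimage (s := {x | ¬p x}) hp.compl.nullMeasurableSet]
  exact h2

theorem measurable_essSup_conf {V : Conf N r → ℝ≥0∞} (hV : Measurable V) :
    Measurable fun n : Rel N r => essSup (fun a : Pt N => V (conf a n)) volume :=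
  measurable_essSup volume (f := fun p : Pt N × Rel N r => V (conf p.1 p.2))
    (hV.comp continuous_conf.measurable)

theorem ae_le_essSup_conf {V : Conf N r → ℝ≥0∞} (hV : Measurable V) :
    ∀ᵐ x, V x ≤ essSup (fun a : Pt N => V (conf a (diffs x))) volume := by
  refine ae_of_ae_conf (measurableSet_le hV ((measurable_essSup_conf hV).comp measurable_diffs))
    (Filter.Eventually.of_forall fun n => ?_)
  simp only [diffs_conf]
  exact ae_le_essSup (f := fun a => V (conf a n))

section Liouville

variable {T : Conf N r → Conf N r → ℝ} {κ : ℝ≥0}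

/-- A measurable function that is invariant under translations depends on the differences only. -/
theorem exists_eq_comp_diffs {U : Conf N r → ℝ≥0∞} (hU : Measurable U)
    (h : ∀ a : Pt N, ∀ᵐ x, U (shift a x) = U x) :
    ∃ f : Rel N r → ℝ≥0∞, Measurable f ∧ ∀ᵐ x, U x = f (diffs x) := by
  refine ⟨_, measurable_essSup_conf hU, ?_⟩
  refine ae_of_ae_conf (measurableSet_eq_fun hU
    ((measurable_essSup_conf hU).comp measurable_diffs)) ?_
  have hm : MeasurableSet {p : Pt N × Conf N r | U (shift p.1 p.2) = U p.2} :=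
    measurableSet_eq_fun (hU.comp continuous_shift.measurable) (hU.comp measurable_snd)
  -- The null set in the hypothesis depends on a. After exchanging the quantifiers, U is almost
  -- everywhere constant along almost every fiber, and its essential supremum there is a measurable
  -- representative.
  have h1 : ∀ᵐ x, ∀ᵐ a : Pt N, U (shift a x) = U x :=
    (Measure.ae_ae_comm hm).1 (Filter.Eventually.of_forall h)
  filter_upwards [ae_conf h1] with n hn
  obtain ⟨a, ha⟩ := hn.exists
  have h2 : ∀ᵐ b : Pt N, U (conf b n) = U (conf a n) := by
    have := (measurePreserving_add_right (volume : Measure (Pt N)) (-a)).quasiMeasurePreserving.ae ha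
    filter_upwards [this] with b hb
    rwa [shift_conf, neg_add_cancel_right] at hb
  have h3 : essSup (fun b : Pt N => U (conf b n)) volume = U (conf a n) := by
    rw [essSup_congr_ae h2, essSup_const _ (NeZero.ne _)]
  filter_upwards [h2] with b hb
  rw [diffs_conf, h3, hb]

/-- A translate of a solution is a solution, and the positive part of a difference of solutions is a
subsolution. -/
theorem posOp_shift_sub_le (hT : IsInvariantKernel T) {U : Conf N r → ℝ≥0∞} (hU : Measurable U)
    (hUe : ∀ᵐ x, posOp T U x = κ * U x) (h : Pt N) :
    ∀ᵐ x, κ * (U (shift h x) - U x) ≤ posOp T (fun x => U (shift h x) - U x) x := by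
  filter_upwards [hUe, (measurePreserving_shift h).quasiMeasurePreserving.ae hUe] with x h1 h2
  rw [ENNReal.mul_sub (by simp), ← h1, ← h2, tsub_le_iff_left, posOp_shift hT,
    ← posOp_add hT hU]
  exact posOp_mono (Filter.Eventually.of_forall fun y => le_add_tsub) x

/-- The essential supremum over a fiber of the gain (U(x + h) - U(x))₊ is a subsolution dominated by
m, hence a multiple c m by Perron–Frobenius. For c ≠ 0 the second clause records that this supremum
is nearly attained on sets of positive measure. -/
theorem exists_translation_bound (hT : IsInvariantKernel T) (hκ : IsFiberBound T κ)
    {m : Rel N r → ℝ≥0∞} (hm : Measurable m) (hm2 : ∫⁻ n, m n ^ 2 ≠ ∞) (hm0 : ∀ᵐ n, m n ≠ 0)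
    (hme : ∀ᵐ n, fiberOp T m n = κ * m n) {U : Conf N r → ℝ≥0∞} (hU : Measurable U)
    (hUm : ∀ᵐ x, U x ≤ m (diffs x)) (hUe : ∀ᵐ x, posOp T U x = κ * U x) (h : Pt N) :
    ∃ c : ℝ≥0, (∀ᵐ x, U (shift h x) ≤ U x + c * m (diffs x)) ∧
      (c ≠ 0 → ∀ᵐ n, ∀ ε : ℝ≥0∞, ε ≠ 0 → ∃ᶠ a in ae (volume : Measure (Pt N)),
        U (conf a n) + c * m n - U (shift h (conf a n)) ≤ ε) := by
  have hmt := ae_ne_top_of_lintegral_sq hm hm2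
  set V : Conf N r → ℝ≥0∞ := fun x => U (shift h x) - U x with hVdef
  have hV : Measurable V := (hU.comp (measurable_shift h)).sub hU
  set s : Rel N r → ℝ≥0∞ := fun n => essSup (fun a : Pt N => V (conf a n)) volume with hsdef
  have hs : Measurable s := measurable_essSup_conf hV
  have hVs : ∀ᵐ x, V x ≤ s (diffs x) := ae_le_essSup_conf hV
  have hVm : ∀ᵐ x, V x ≤ m (diffs x) := by
    filter_upwards [(measurePreserving_shift h).quasiMeasurePreserving.ae hUm] with x hx
    rw [diffs_shift] at hx
    exact tsub_le_self.trans hx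
  have hsm : ∀ᵐ n, s n ≤ m n := by
    filter_upwards [ae_conf hVm] with n hn
    refine essSup_le_of_ae_le _ ?_
    filter_upwards [hn] with a ha
    rwa [diffs_conf] at ha
  have hs2 : ∫⁻ n, s n ^ 2 ≠ ∞ := by
    refine ((lintegral_mono_ae ?_).trans_lt hm2.lt_top).ne
    filter_upwards [hsm] with n hn using pow_le_pow_left' hn 2
  have hle : ∀ᵐ n, κ * s n ≤ fiberOp T s n := by
    filter_upwards [ae_conf (posOp_shift_sub_le hT hU hUe h)] with n hn
    rw [hsdef, ← ENNReal.essSup_const_mul]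
    refine essSup_le_of_ae_le _ ?_
    filter_upwards [hn] with a ha
    refine ha.trans ((posOp_mono hVs _).trans_eq ?_)
    rw [posOp_diffs hT, diffs_conf]
  obtain ⟨c, hc⟩ := exists_eigenfunction_eq_mul hT hκ hs hm hs2 hm2 hm0
    (fiberOp_eq_of_le hT hs hs2 hle (hκ _ hs hs2)) hme
  refine ⟨c, ?_, fun hc0 => ?_⟩
  · filter_upwards [hVs, ae_diffs hc] with x h1 h2
    rw [h2] at h1
    exact tsub_le_iff_left.1 h1
  · filter_upwards [hc, hm0, hmt] with n h1 h2 h3 ε hε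
    have hcm0 : c * m n ≠ 0 := mul_ne_zero (by simpa using hc0) h2
    have hcmt : c * m n ≠ ∞ := ENNReal.mul_ne_top (by simp) h3
    have hlt : c * m n - ε < s n := by
      rw [h1]
      exact ENNReal.sub_lt_self hcmt hcm0 hε
    -- The essential supremum is a limsup along the almost-everywhere filter, so values above c m -
    -- ε occur frequently.
    refine (Filter.frequently_lt_of_lt_limsup (by isBoundedDefault) hlt).mono fun a ha => ?_
    have ha' : c * m n ≤ U (shift h (conf a n)) - U (conf a n) + ε :=
      tsub_le_iff_right.1 ha.le
    rw [tsub_le_iff_left]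
    rcases le_total (U (conf a n)) (U (shift h (conf a n))) with hcase | hcase
    · calc U (conf a n) + c * m n
          ≤ U (conf a n) + (U (shift h (conf a n)) - U (conf a n) + ε) := by gcongr
        _ = U (shift h (conf a n)) + ε := by rw [← add_assoc, add_tsub_cancel_of_le hcase]
    -- Here the truncated gain is zero and cannot exceed c m - ε.
    · exfalso
      have : c * m n - ε < 0 := by
        refine ha.trans_eq ?_
        exact tsub_eq_zero_of_le hcase
      exact not_lt_zero this

/-- The defect is a combination of solutions. To avoid truncated subtraction, the finite term κ U(x
+ h) is added to both sides and cancelled at the end. -/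
theorem posOp_defect (hT : IsInvariantKernel T) {m : Rel N r → ℝ≥0∞} (hm : Measurable m)
    (hmt : ∀ᵐ n, m n ≠ ∞) (hme : ∀ᵐ n, fiberOp T m n = κ * m n) {U : Conf N r → ℝ≥0∞}
    (hU : Measurable U) (hUm : ∀ᵐ x, U x ≤ m (diffs x)) (hUe : ∀ᵐ x, posOp T U x = κ * U x)
    {h : Pt N} {c : ℝ≥0} (hc : ∀ᵐ x, U (shift h x) ≤ U x + c * m (diffs x)) :
    ∀ᵐ x, posOp T (fun x => U x + c * m (diffs x) - U (shift h x)) x =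
      κ * (U x + c * m (diffs x) - U (shift h x)) := by
  have hUh : Measurable fun x => U (shift h x) := hU.comp (measurable_shift h)
  have hmd : Measurable fun x : Conf N r => m (diffs x) := hm.comp measurable_diffs
  have hD : Measurable fun x => U x + c * m (diffs x) - U (shift h x) :=
    (hU.add (hmd.const_mul _)).sub hUh
  filter_upwards [hUe, (measurePreserving_shift h).quasiMeasurePreserving.ae hUe, ae_diffs hme, hc,
    (measurePreserving_shift h).quasiMeasurePreserving.ae hUm, ae_diffs hmt] with x h1 h2 h3 h4 h5 h6
  rw [diffs_shift] at h5
  have hfin : κ * U (shift h x) ≠ ∞ := ENNReal.mul_ne_top (by simp) (h5.trans_lt h6.lt_top).ne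
  have e1 : posOp T (fun x => U x + c * m (diffs x) - U (shift h x)) x + κ * U (shift h x) =
      κ * U x + c * (κ * m (diffs x)) := by
    rw [← h2, posOp_shift hT, ← posOp_add hT hD, ← h1, ← h3, ← posOp_diffs hT,
      ← posOp_const_mul hT hmd, ← posOp_add hT hU]
    refine posOp_congr ?_ x
    filter_upwards [hc] with y hy using tsub_add_cancel_of_le hy
  have e2 : κ * (U x + c * m (diffs x) - U (shift h x)) + κ * U (shift h x) =
      κ * U x + c * (κ * m (diffs x)) := by
    rw [← mul_add, tsub_add_cancel_of_le h4, mul_add, mul_left_comm]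
  exact (ENNReal.add_left_inj hfin).1 (e1.trans e2.symm)

/-- The defects along the chain a, a + h, …, a + L h telescope; the last value of U stays on the
left so that nothing is subtracted. -/
theorem sum_defect_add {m : Rel N r → ℝ≥0∞} {U : Conf N r → ℝ≥0∞} {h : Pt N} {c : ℝ≥0}
    (hc : ∀ᵐ x, U (shift h x) ≤ U x + c * m (diffs x)) (a : Pt N) (L : ℕ) :
    ∀ᵐ y, ∑ l ∈ Finset.range L, (U (shift (a + l • h) y) + c * m (diffs y) -
        U (shift h (shift (a + l • h) y))) + U (shift (a + L • h) y) =
      U (shift a y) + L * (c * m (diffs y)) := by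
  have hl : ∀ᵐ y, ∀ l : ℕ, U (shift h (shift (a + l • h) y)) ≤
      U (shift (a + l • h) y) + c * m (diffs y) := by
    refine ae_all_iff.2 fun l => ?_
    filter_upwards [(measurePreserving_shift (a + l • h)).quasiMeasurePreserving.ae hc] with y hy
    rwa [diffs_shift] at hy
  filter_upwards [hl] with y hy
  induction L with
  | zero => simp
  | succ L ih =>
    have e : shift (a + (L + 1) • h) y = shift h (shift (a + L • h) y) := by
      rw [shift_shift]; congr 1; rw [succ_nsmul]; abel
    rw [Finset.sum_range_succ, e, add_assoc, tsub_add_cancel_of_le (hy L), ← add_assoc, ih]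
    push_cast
    ring

theorem ae_kernel_based_pos (hT : IsInvariantKernel T) :
    ∀ᵐ n : Rel N r, ∀ᵐ y : Conf N r, 0 < T (based n) y := by
  have h1 : ∀ᵐ x : Conf N r, ∀ᵐ y : Conf N r, 0 < T x y := Measure.ae_ae_of_ae_prod hT.pos
  filter_upwards [ae_conf h1] with n hn
  obtain ⟨a, ha⟩ := hn.exists
  filter_upwards [(measurePreserving_shift a).quasiMeasurePreserving.ae ha] with y hy
  rwa [conf, hT.shift] at hy

/-- Where the defect is at most ε, the eigenvalue equation makes its average against the positive
kernel at most κ ε. Averaging along a chain of translates and telescoping bounds a fixed positive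
integral by a multiple of ε, because U would otherwise have to grow beyond m. -/
theorem translation_bound_eq_zero (hT : IsInvariantKernel T) {m : Rel N r → ℝ≥0∞}
    (hm : Measurable m) (hmt : ∀ᵐ n, m n ≠ ∞) (hm0 : ∀ᵐ n, m n ≠ 0)
    (hme : ∀ᵐ n, fiberOp T m n = κ * m n) {U : Conf N r → ℝ≥0∞} (hU : Measurable U)
    (hUm : ∀ᵐ x, U x ≤ m (diffs x)) (hUe : ∀ᵐ x, posOp T U x = κ * U x)
    {h : Pt N} {c : ℝ≥0} (hc : ∀ᵐ x, U (shift h x) ≤ U x + c * m (diffs x))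
    (hsmall : ∀ᵐ n, ∀ ε : ℝ≥0∞, ε ≠ 0 → ∃ᶠ a in ae (volume : Measure (Pt N)),
        U (conf a n) + c * m n - U (shift h (conf a n)) ≤ ε) : c = 0 := by
  by_contra hc0
  -- Gains totalling 2 m are required: U can absorb at most m of them, and the defects must account
  -- for the remaining m.
  obtain ⟨L, hL⟩ : ∃ L : ℕ, 2 ≤ (L + 1 : ℝ≥0) * c := by
    obtain ⟨L, hL⟩ := exists_nat_ge (2 / c : ℝ≥0)
    refine ⟨L, ?_⟩
    have := (div_le_iff₀ (pos_iff_ne_zero.2 hc0)).1 hL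
    exact this.trans (by gcongr; simp)
  set D : Conf N r → ℝ≥0∞ := fun x => U x + c * m (diffs x) - U (shift h x) with hDdef
  have hUh : Measurable fun x => U (shift h x) := hU.comp (measurable_shift h)
  have hmd : Measurable fun x : Conf N r => m (diffs x) := hm.comp measurable_diffs
  have hD : Measurable D := (hU.add (hmd.const_mul _)).sub hUh
  have hDe := posOp_defect hT hm hmt hme hU hUm hUe hc
  obtain ⟨n, hn1, hn2, hn3⟩ :=
    ((ae_conf hDe).and (hsmall.and (ae_kernel_based_pos hT))).exists
  set k : Conf N r → ℝ≥0∞ := fun y => ENNReal.ofReal (T (based n) y) with hk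
  have hkm : Measurable k := hT.measurable_left _
  -- One weight that works at every link of the chain. A minimum over finitely many translates stays
  -- almost everywhere positive, and it depends neither on ε nor on the point a chosen for ε.
  set w : Conf N r → ℝ≥0∞ := fun y => ⨅ l : Fin (L + 1), k (shift ((l : ℕ) • h) y) with hw
  have hwm : Measurable w := Measurable.iInf fun l => hkm.comp (measurable_shift _)
  have hw0 : ∀ᵐ y, w y ≠ 0 := by
    have : ∀ᵐ y, ∀ l : Fin (L + 1), 0 < T (based n) (shift ((l : ℕ) • h) y) :=
      ae_all_iff.2 fun l => (measurePreserving_shift _).quasiMeasurePreserving.ae hn3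
    filter_upwards [this] with y hy
    obtain ⟨l, hl⟩ := exists_eq_ciInf_of_finite (f := fun l : Fin (L + 1) =>
      k (shift ((l : ℕ) • h) y))
    change (⨅ l : Fin (L + 1), k (shift ((l : ℕ) • h) y)) ≠ 0
    rw [← hl]
    exact (ENNReal.ofReal_pos.2 (hy l)).ne'
  have hJ : ∀ ε : ℝ≥0∞, ε ≠ 0 → ∫⁻ y, w y * m (diffs y) ≤ (((L + 1 : ℕ) : ℝ≥0∞) * κ) * ε := by
    intro ε hε
    -- A set that is met frequently also meets the almost-everywhere validity of the eigenvalue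
    -- equation for the defect.
    obtain ⟨a, ha, ha'⟩ := ((hn2 ε hε).and_eventually hn1).exists
    have hDa : D (conf a n) ≤ ε := by
      simp only [hDdef, diffs_conf]
      exact ha
    have hint : ∫⁻ y, k y * D (shift a y) ≤ κ * ε := by
      have : ∫⁻ y, k y * D (shift a y) = posOp T D (conf a n) := by
        rw [conf, posOp_shift hT]
        rfl
      rw [this]
      exact ha'.trans_le (by gcongr)
    have hterm : ∀ l ∈ Finset.range (L + 1),
        ∫⁻ y, w y * D (shift (a + l • h) y) ≤ κ * ε := by
      intro l hl
      refine le_trans (lintegral_mono fun y => ?_) (hint.trans' (le_of_eq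
        ((measurePreserving_shift (l • h)).lintegral_comp
          (hkm.mul (hD.comp (measurable_shift a))))))
      change w y * _ ≤ k (shift (l • h) y) * D (shift a (shift (l • h) y))
      rw [shift_shift]
      refine mul_le_mul_left ?_ _
      exact iInf_le (fun l : Fin (L + 1) => k (shift ((l : ℕ) • h) y))
        ⟨l, Finset.mem_range.1 hl⟩
    calc ∫⁻ y, w y * m (diffs y)
        ≤ ∫⁻ y, ∑ l ∈ Finset.range (L + 1), w y * D (shift (a + l • h) y) := by
          refine lintegral_mono_ae ?_
          filter_upwards [sum_defect_add hc a (L + 1),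
            (measurePreserving_shift (a + (L + 1) • h)).quasiMeasurePreserving.ae hUm,
            ae_diffs hmt] with y h1 h2 h3
          rw [← Finset.mul_sum]
          refine mul_le_mul_right ?_ _
          rw [diffs_shift] at h2
          have e : ∀ l : ℕ, D (shift (a + l • h) y) = U (shift (a + l • h) y) + c * m (diffs y) -
              U (shift h (shift (a + l • h) y)) := fun l => by
            simp only [hDdef, diffs_shift]
          simp only [e]
          -- Adding m on both sides replaces the subtraction: 2 m ≤ (L + 1) c m is at most the sum
          -- of the defects plus the last value of U, which is at most m.
          refine (ENNReal.add_le_add_iff_right h3).1 ?_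
          calc m (diffs y) + m (diffs y) = 2 * m (diffs y) := (two_mul _).symm
            _ ≤ (((L + 1 : ℝ≥0) * c : ℝ≥0) : ℝ≥0∞) * m (diffs y) := by
              gcongr
              exact_mod_cast hL
            _ = ((L + 1 : ℕ) : ℝ≥0∞) * (c * m (diffs y)) := by push_cast; ring
            _ ≤ U (shift a y) + ((L + 1 : ℕ) : ℝ≥0∞) * (c * m (diffs y)) := le_add_self
            _ ≤ _ := by rw [← h1]; gcongr
      _ = ∑ l ∈ Finset.range (L + 1), ∫⁻ y, w y * D (shift (a + l • h) y) :=
          lintegral_finsetSum _ fun l _ => hwm.mul (hD.comp (measurable_shift _))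
      _ ≤ ∑ l ∈ Finset.range (L + 1), κ * ε := Finset.sum_le_sum hterm
      _ = _ := by simp; ring
  have hzero : ∫⁻ y, w y * m (diffs y) = 0 := by
    have hlim : Filter.Tendsto (fun j : ℕ => (((L + 1 : ℕ) : ℝ≥0∞) * κ) * (j : ℝ≥0∞)⁻¹)
        Filter.atTop (nhds ((((L + 1 : ℕ) : ℝ≥0∞) * κ) * 0)) :=
      ENNReal.Tendsto.const_mul ENNReal.tendsto_inv_nat_nhds_zero
        (Or.inr (ENNReal.mul_ne_top (by simp) (by simp)))
    rw [mul_zero] at hlim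
    exact le_antisymm (ge_of_tendsto' hlim fun j => hJ _ (by simp)) zero_le
  rw [lintegral_eq_zero_iff (show Measurable fun y => w y * m (diffs y) from hwm.mul hmd)] at hzero
  obtain ⟨y, h1, h2, h3⟩ := (hzero.and (hw0.and (ae_diffs hm0))).exists
  exact mul_ne_zero h2 h3 h1

/-- An eigenfunction bounded by a positive eigenfunction of the differences is proportional to
it. -/
theorem exists_eq_mul_comp_diffs (hT : IsInvariantKernel T) (hκ : IsFiberBound T κ)
    {m : Rel N r → ℝ≥0∞} (hm : Measurable m) (hm2 : ∫⁻ n, m n ^ 2 ≠ ∞) (hm0 : ∀ᵐ n, m n ≠ 0)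
    (hme : ∀ᵐ n, fiberOp T m n = κ * m n) {U : Conf N r → ℝ≥0∞} (hU : Measurable U)
    (hUm : ∀ᵐ x, U x ≤ m (diffs x)) (hUe : ∀ᵐ x, posOp T U x = κ * U x) :
    ∃ c : ℝ≥0, ∀ᵐ x, U x = c * m (diffs x) := by
  have hmt := ae_ne_top_of_lintegral_sq hm hm2
  have hle : ∀ h : Pt N, ∀ᵐ x, U (shift h x) ≤ U x := by
    intro h
    obtain ⟨c, hc1, hc2⟩ := exists_translation_bound hT hκ hm hm2 hm0 hme hU hUm hUe h
    have hc0 : c = 0 := by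
      by_contra hne
      exact hne (translation_bound_eq_zero hT hm hmt hm0 hme hU hUm hUe hc1 (hc2 hne))
    simpa [hc0] using hc1
  -- The bound for -h, evaluated at the translated point, is the opposite inequality.
  have heq : ∀ h : Pt N, ∀ᵐ x, U (shift h x) = U x := by
    intro h
    filter_upwards [hle h, (measurePreserving_shift h).quasiMeasurePreserving.ae (hle (-h))]
      with x h1 h2
    rw [shift_shift, neg_add_cancel, shift_zero] at h2
    exact le_antisymm h1 h2
  obtain ⟨f, hf, hUf⟩ := exists_eq_comp_diffs hU heq
  have hfm : ∀ᵐ n, f n ≤ m n := by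
    refine ae_of_ae_diffs ?_
    filter_upwards [hUf, hUm] with x h1 h2
    rwa [← h1]
  have hf2 : ∫⁻ n, f n ^ 2 ≠ ∞ := by
    refine ((lintegral_mono_ae ?_).trans_lt hm2.lt_top).ne
    filter_upwards [hfm] with n hn using pow_le_pow_left' hn 2
  have hfe : ∀ᵐ n, fiberOp T f n = κ * f n := by
    refine ae_of_ae_diffs ?_
    filter_upwards [hUe, hUf] with x h1 h2
    rw [← posOp_diffs hT, ← posOp_congr hUf, h1, h2]
  obtain ⟨c, hc⟩ := exists_eigenfunction_eq_mul hT hκ hf hm hf2 hm2 hm0 hfe hme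
  refine ⟨c, ?_⟩
  filter_upwards [hUf, ae_diffs hc] with x h1 h2
  rw [h1, h2]

end Liouville

/-! ### Rotations -/

theorem based_rotRel (k : SO N) (n : Rel N r) : based (rotRel k n) = act (rotation k) (based n) := by
  funext i
  change _ = rot k (based n i) + 0
  refine Fin.cases ?_ (fun j => ?_) i
  · simp [based]
  · simp [based, rotRel]

theorem diffs_act (g : ISO N) (x : Conf N r) : diffs (act g x) = rotRel g.1 (diffs x) := by
  funext i
  simp [diffs, act, rotRel]

theorem diffs_place (g : ISO N) (n : Rel N r) : diffs (place g n) = rotRel g.1⁻¹ n := by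
  rw [place, diffs_act, diffs_based]
  rfl

theorem place_rotRel (g : ISO N) (k : SO N) (n : Rel N r) :
    place g (rotRel k n) = place (rotation k⁻¹ * g) n := by
  have h : (rotation k⁻¹)⁻¹ = rotation k := by
    refine Prod.ext (inv_inv k) ?_
    change -rot (k⁻¹)⁻¹ (0 : Pt N) = 0
    rw [map_zero, neg_zero]
  rw [place, place, based_rotRel, ← act_mul, mul_inv_rev, h]

theorem measurePreserving_rotation_mul (k : SO N) :
    MeasurePreserving (fun g : ISO N => rotation k * g) (haarISO N) (haarISO N) := by
  have h := (measurePreserving_mul_left (haarSO N) k).prod (rot k).measurePreserving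
  have e : (fun g : ISO N => rotation k * g) = Prod.map (fun x => k * x) (rot k) := by
    funext g
    refine Prod.ext rfl ?_
    change 0 + rot k g.2 = rot k g.2
    rw [zero_add]
  rw [e]
  exact h

theorem measurable_place (n : Rel N r) : Measurable fun g : ISO N => place g n := by
  have h : Measurable fun g : ISO N => (g, n) := measurable_id.prodMk measurable_const
  have hp := (measurePreserving_place (N := N) (r := r)).measurable
  change Measurable ((fun p : ISO N × Rel N r => place p.1 p.2) ∘ fun g : ISO N => (g, n))
  exact Measurable.comp hp h

theorem fiberOp_rotRel {T : Conf N r → Conf N r → ℝ} (hT : IsInvariantKernel T)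
    {m : Rel N r → ℝ≥0∞} (hm : ∀ k n, m (rotRel k n) = m n) (k : SO N) (n : Rel N r) :
    fiberOp T m (rotRel k n) = fiberOp T m n := by
  rw [fiberOp, based_rotRel, posOp_act hT, fiberOp]
  simp only [Function.comp, diffs_act, hm]
  rfl

theorem ae_of_ae_place {p : Conf N r → Prop} (hp : MeasurableSet {x | p x})
    (h : ∀ᵐ n : Rel N r, ∀ᵐ g ∂(haarISO N), p (place g n)) : ∀ᵐ x, p x := by
  have hm : MeasurableSet {q : ISO N × Rel N r | p (place q.1 q.2)} :=
    measurePreserving_place.measurable hp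
  have h1 : ∀ᵐ g ∂(haarISO N), ∀ᵐ n : Rel N r, p (place g n) := (Measure.ae_ae_comm hm).2 h
  have h2 : ∀ᵐ q ∂((haarISO N).prod (volume : Measure (Rel N r))), p (place q.1 q.2) :=
    (Measure.ae_prod_iff_ae_ae hm).2 h1
  rw [ae_iff] at h2 ⊢
  rw [← measurePreserving_place.measure_preimage (s := {x | ¬p x}) hp.compl.nullMeasurableSet]
  exact h2

/-! ### The structure of ground states -/

/-- The norm `ess sup_g |Ω(g, n)|`. -/
def orbitSup (Ω : AEFun N r) (n : Rel N r) : ℝ≥0∞ :=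
  eLpNorm (fun g => Ω (place g n)) ∞ (haarISO N)

theorem measurable_orbitSup (Ω : AEFun N r) : Measurable (orbitSup Ω) := by
  unfold orbitSup
  simp only [eLpNorm_exponent_top, eLpNormEssSup]
  exact measurable_essSup (haarISO N) (f := fun p : ISO N × Rel N r => ‖Ω (place p.1 p.2)‖ₑ)
    (Ω.stronglyMeasurable.measurable.comp measurePreserving_place.measurable).enorm

/-- Rotating n multiplies g on the left by a rotation, which preserves dg. -/
theorem orbitSup_rotRel (Ω : AEFun N r) (k : SO N) (n : Rel N r) :
    orbitSup Ω (rotRel k n) = orbitSup Ω n := by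
  unfold orbitSup
  simp only [place_rotRel]
  exact eLpNorm_comp_measurePreserving (g := fun g => Ω (place g n))
    (Ω.stronglyMeasurable.comp_measurable (measurable_place n)).aestronglyMeasurable
    (measurePreserving_rotation_mul k⁻¹)

/-- The differences of the point labelled by (g, n) are a rotation of n depending on g; rotation
invariance makes the bound the same along the orbit. -/
theorem ae_enorm_le_orbitSup (Ω : AEFun N r) : ∀ᵐ x, ‖Ω x‖ₑ ≤ orbitSup Ω (diffs x) := by
  refine ae_of_ae_place (measurableSet_le Ω.stronglyMeasurable.measurable.enorm
    ((measurable_orbitSup Ω).comp measurable_diffs)) (Filter.Eventually.of_forall fun n => ?_)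
  simp only [diffs_place, orbitSup_rotRel]
  exact enorm_ae_le_eLpNormEssSup _ _

section GroundStates

variable {𝓣 : L2 (Conf N r) →L[ℂ] L2 (Conf N r)} {T : Conf N r → Conf N r → ℝ}

theorem enorm_integral_kernel_le (hT : IsInvariantKernel T) (F : Conf N r → ℂ) (x : Conf N r) :
    ‖∫ y, (T x y : ℂ) * F y‖ₑ ≤ posOp T (fun y => ‖F y‖ₑ) x := by
  refine (enorm_integral_le_lintegral_enorm _).trans (le_of_eq (lintegral_congr fun y => ?_))
  rw [enorm_mul, ← ofReal_norm (T x y : ℂ), Complex.norm_real, Real.norm_of_nonneg (hT.nonneg x y)]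

/-- Take absolute values in the eigenvalue equation and dominate |Ω| by its orbit supremum. The
resulting bound is constant on orbits, so the essential supremum may be taken on the left. -/
theorem mul_orbitSup_le (hT : IsInvariantKernel T) {Ω : AEFun N r} (hΩ : Ω ∈ groundSector 𝓣 T) :
    ∀ᵐ n, (‖𝓣‖₊ : ℝ≥0∞) * orbitSup Ω n ≤ fiberOp T (orbitSup Ω) n := by
  have h1 : ∀ᵐ x, (‖𝓣‖₊ : ℝ≥0∞) * ‖Ω x‖ₑ ≤ fiberOp T (orbitSup Ω) (diffs x) := by
    filter_upwards [hΩ.2] with x hx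
    have h2 := enorm_integral_kernel_le hT Ω x
    rw [hx.2, enorm_mul, ← ofReal_norm ((‖𝓣‖ : ℝ) : ℂ), Complex.norm_real, norm_norm] at h2
    have e : ENNReal.ofReal ‖𝓣‖ = (‖𝓣‖₊ : ℝ≥0∞) := ofReal_norm 𝓣
    rw [e] at h2
    refine h2.trans ((posOp_mono (ae_enorm_le_orbitSup Ω) x).trans_eq ?_)
    exact posOp_diffs hT _ x
  filter_upwards [ae_place h1] with n hn
  rw [orbitSup, eLpNorm_exponent_top, eLpNormEssSup, ← ENNReal.essSup_const_mul]
  refine essSup_le_of_ae_le _ ?_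
  filter_upwards [hn] with g hg
  rwa [diffs_place, fiberOp_rotRel hT (orbitSup_rotRel Ω)] at hg

theorem isFiberBound_nnnorm (hTO : IsTransferOperator 𝓣 T) (hT : IsInvariantKernel T) :
    IsFiberBound T ‖𝓣‖₊ := fun _ hf h => lintegral_fiberOp_sq_le hTO hT hf h

theorem lintegral_orbitSup_sq {Ω : AEFun N r} (hΩ : Ω ∈ groundSector 𝓣 T) :
    ∫⁻ n, orbitSup Ω n ^ 2 ≠ ∞ :=
  ((normSup2_lt_top_iff Ω).1 hΩ.1).ne

theorem fiberOp_orbitSup (hTO : IsTransferOperator 𝓣 T) (hT : IsInvariantKernel T)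
    {Ω : AEFun N r} (hΩ : Ω ∈ groundSector 𝓣 T) :
    ∀ᵐ n, fiberOp T (orbitSup Ω) n = ‖𝓣‖₊ * orbitSup Ω n :=
  fiberOp_eq_of_le hT (measurable_orbitSup Ω) (lintegral_orbitSup_sq hΩ) (mul_orbitSup_le hT hΩ)
    (isFiberBound_nnnorm hTO hT _ (measurable_orbitSup Ω) (lintegral_orbitSup_sq hΩ))

/-- Adding the solution m makes w nonnegative, so that the Liouville theorem applies to m + w, which
is dominated by the solution 2 m. -/
theorem exists_real_eigenfunction_eq {κ : ℝ≥0} (hT : IsInvariantKernel T)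
    (hκ : IsFiberBound T κ) {m : Rel N r → ℝ≥0∞} (hm : Measurable m)
    (hm2 : ∫⁻ n, m n ^ 2 ≠ ∞) (hm0 : ∀ᵐ n, m n ≠ 0)
    (hme : ∀ᵐ n, fiberOp T m n = κ * m n) {w : Conf N r → ℝ} (hw : Measurable w)
    (hwm : ∀ᵐ x, ‖w x‖ₑ ≤ m (diffs x))
    (hwe : ∀ᵐ x, Integrable (fun y => T x y * w y) ∧ ∫ y, T x y * w y = κ * w x) :
    ∃ c : ℝ, ∀ᵐ x, w x = c * (m (diffs x)).toReal := by
  have hmt := ae_ne_top_of_lintegral_sq hm hm2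
  have hTx : ∀ x, Measurable (T x) := fun x =>
    (hT.continuous.comp (continuous_const.prodMk continuous_id)).measurable
  set M : Conf N r → ℝ := fun x => (m (diffs x)).toReal with hM
  have hMm : Measurable M := (hm.comp measurable_diffs).ennreal_toReal
  have hMe : ∀ᵐ x, ENNReal.ofReal (M x) = m (diffs x) := by
    filter_upwards [ae_diffs hmt] with x hx using ENNReal.ofReal_toReal hx
  have hwM : ∀ᵐ x, |w x| ≤ M x := by
    filter_upwards [hwm, ae_diffs hmt] with x h1 h2
    rw [← Real.norm_eq_abs, ← toReal_enorm]
    exact ENNReal.toReal_mono h2 h1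
  set U : Conf N r → ℝ≥0∞ := fun x => ENNReal.ofReal (M x + w x) with hU
  have hUm : Measurable U := (hMm.add hw).ennreal_ofReal
  have hU2 : ∀ᵐ x, U x ≤ 2 * m (diffs x) := by
    filter_upwards [hwM, hMe] with x h1 h2
    rw [← h2, two_mul, ← ENNReal.ofReal_add ENNReal.toReal_nonneg ENNReal.toReal_nonneg]
    exact ENNReal.ofReal_le_ofReal (add_le_add_right ((le_abs_self _).trans h1) _)
  have hUe : ∀ᵐ x, posOp T U x = κ * U x := by
    filter_upwards [hwe, ae_diffs hme, hMe, ae_diffs hmt] with x h1 h2 h3 h4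
    have hpM : ∫⁻ y, ENNReal.ofReal (T x y * M y) = κ * m (diffs x) := by
      rw [← h2, ← posOp_diffs hT]
      refine lintegral_congr_ae ?_
      filter_upwards [hMe] with y hy
      rw [ENNReal.ofReal_mul (hT.nonneg x y), hy]
    have hn : 0 ≤ᵐ[volume] fun y => T x y * M y :=
      Filter.Eventually.of_forall fun y => mul_nonneg (hT.nonneg x y) ENNReal.toReal_nonneg
    have hi : Integrable fun y => T x y * M y := by
      refine ⟨((hTx x).mul hMm).aestronglyMeasurable, ?_⟩
      rw [hasFiniteIntegral_iff_ofReal hn, hpM]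
      exact ENNReal.mul_lt_top (by simp) h4.lt_top
    have hiM : ∫ y, T x y * M y = κ * M x := by
      rw [integral_eq_lintegral_of_nonneg_ae hn hi.1, hpM, ENNReal.toReal_mul]
      rfl
    have hsum : (fun y => T x y * (M y + w y)) = fun y => T x y * M y + T x y * w y := by
      funext y; ring
    have e : posOp T U x = ENNReal.ofReal (∫ y, T x y * (M y + w y)) := by
      rw [ofReal_integral_eq_lintegral_ofReal]
      · refine lintegral_congr fun y => ?_
        rw [ENNReal.ofReal_mul (hT.nonneg x y)]
      · rw [hsum]; exact hi.add h1.1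
      · filter_upwards [hwM] with y hy
        exact mul_nonneg (hT.nonneg x y) (by linarith [neg_abs_le (w y)])
    rw [e, hsum, integral_add hi h1.1, hiM, h1.2, ← mul_add, ENNReal.ofReal_mul κ.coe_nonneg,
      ENNReal.ofReal_coe_nnreal]
  have h2m : ∀ᵐ n, fiberOp T (fun n => 2 * m n) n = κ * (2 * m n) := by
    filter_upwards [hme] with n hn
    rw [fiberOp_const_mul hT hm, hn, mul_left_comm]
  have h2m2 : ∫⁻ n, (2 * m n) ^ 2 ≠ ∞ := by
    simp only [mul_pow]
    rw [lintegral_const_mul _ (hm.pow_const 2)]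
    exact ENNReal.mul_ne_top (by simp) hm2
  have h2m0 : ∀ᵐ n, 2 * m n ≠ 0 := by
    filter_upwards [hm0] with n hn using mul_ne_zero two_ne_zero hn
  obtain ⟨c, hc⟩ := exists_eq_mul_comp_diffs hT hκ (hm.const_mul 2) h2m2 h2m0 h2m hUm hU2 hUe
  -- Solve m + w = c · 2 m for w.
  refine ⟨2 * c - 1, ?_⟩
  filter_upwards [hc, hwM] with x h1 h2
  have h3 : M x + w x = c * (2 * M x) := by
    have := congrArg ENNReal.toReal h1
    rw [hU, ENNReal.toReal_ofReal (by linarith [neg_abs_le (w x)]), ENNReal.toReal_mul,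
      ENNReal.toReal_mul] at this
    simpa using this
  change w x = (2 * c - 1) * M x
  linarith

/-- A ground state is a multiple of the supremum over its orbits. -/
theorem exists_groundState_eq (hTO : IsTransferOperator 𝓣 T) (hT : IsInvariantKernel T)
    {Ω : AEFun N r} (hΩ : Ω ∈ groundSector 𝓣 T) {m : Rel N r → ℝ≥0∞} (hm : Measurable m)
    (hm2 : ∫⁻ n, m n ^ 2 ≠ ∞) (hm0 : ∀ᵐ n, m n ≠ 0)
    (hme : ∀ᵐ n, fiberOp T m n = ‖𝓣‖₊ * m n) :
    ∃ c : ℂ, ∀ᵐ x, Ω x = c * ((m (diffs x)).toReal : ℂ) := by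
  obtain ⟨b, hb⟩ := exists_eigenfunction_eq_mul hT (isFiberBound_nnnorm hTO hT)
    (measurable_orbitSup Ω) hm (lintegral_orbitSup_sq hΩ) hm2 hm0 (fiberOp_orbitSup hTO hT hΩ) hme
  -- The Liouville theorem needs a dominating eigenfunction that is nonzero almost everywhere; for b
  -- = 0 the orbit supremum, and with it Ω, vanishes.
  by_cases hb0 : b = 0
  · refine ⟨0, ?_⟩
    filter_upwards [ae_enorm_le_orbitSup Ω, ae_diffs hb] with x h1 h2
    rw [h2, hb0] at h1
    simpa using h1
  have hs0 : ∀ᵐ n, orbitSup Ω n ≠ 0 := by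
    filter_upwards [hb, hm0] with n h1 h2
    rw [h1]
    exact mul_ne_zero (by simpa using hb0) h2
  have hre : ∀ᵐ x, Integrable (fun y => T x y * (Ω y).re) ∧
      ∫ y, T x y * (Ω y).re = ‖𝓣‖₊ * (Ω x).re := by
    filter_upwards [hΩ.2] with x hx
    have e : (fun y => T x y * (Ω y).re) = fun y => ((T x y : ℂ) * Ω y).re := by
      funext y; simp
    have hi := hx.1.re
    rw [e]
    refine ⟨hi, ?_⟩
    have := integral_re hx.1
    simp only [RCLike.re_eq_complex_re] at this
    rw [this, hx.2]
    simp
  have him : ∀ᵐ x, Integrable (fun y => T x y * (Ω y).im) ∧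
      ∫ y, T x y * (Ω y).im = ‖𝓣‖₊ * (Ω x).im := by
    filter_upwards [hΩ.2] with x hx
    have e : (fun y => T x y * (Ω y).im) = fun y => ((T x y : ℂ) * Ω y).im := by
      funext y; simp
    have hi := hx.1.im
    rw [e]
    refine ⟨hi, ?_⟩
    have := integral_im hx.1
    simp only [RCLike.im_eq_complex_im] at this
    rw [this, hx.2]
    simp
  have hΩm : Measurable Ω := Ω.stronglyMeasurable.measurable
  have habs : ∀ᵐ x, ‖(Ω x).re‖ₑ ≤ orbitSup Ω (diffs x) ∧ ‖(Ω x).im‖ₑ ≤ orbitSup Ω (diffs x) := by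
    filter_upwards [ae_enorm_le_orbitSup Ω] with x hx
    rw [← ofReal_norm (Ω x)] at hx
    constructor
    · rw [← ofReal_norm]
      exact (ENNReal.ofReal_le_ofReal (Complex.abs_re_le_norm _)).trans hx
    · rw [← ofReal_norm]
      exact (ENNReal.ofReal_le_ofReal (Complex.abs_im_le_norm _)).trans hx
  obtain ⟨c₁, hc₁⟩ := exists_real_eigenfunction_eq hT (isFiberBound_nnnorm hTO hT)
    (measurable_orbitSup Ω) (lintegral_orbitSup_sq hΩ) hs0 (fiberOp_orbitSup hTO hT hΩ)
    (Complex.measurable_re.comp hΩm) (habs.mono fun x hx => hx.1) hre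
  obtain ⟨c₂, hc₂⟩ := exists_real_eigenfunction_eq hT (isFiberBound_nnnorm hTO hT)
    (measurable_orbitSup Ω) (lintegral_orbitSup_sq hΩ) hs0 (fiberOp_orbitSup hTO hT hΩ)
    (Complex.measurable_im.comp hΩm) (habs.mono fun x hx => hx.2) him
  refine ⟨(c₁ + c₂ * Complex.I) * (b : ℝ), ?_⟩
  filter_upwards [hc₁, hc₂, ae_diffs hb] with x h1 h2 h3
  rw [h3, ENNReal.toReal_mul] at h1 h2
  rw [← Complex.re_add_im (Ω x)]
  change (((Complex.re ∘ Ω) x : ℝ) : ℂ) + (((Complex.im ∘ Ω) x : ℝ) : ℂ) * Complex.I = _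
  rw [h1, h2]
  push_cast
  simp only [ENNReal.coe_toReal]
  ring

theorem eq_zero_or_orbitSup_ne_zero (hTO : IsTransferOperator 𝓣 T) (hT : IsInvariantKernel T)
    {Ω : AEFun N r} (hΩ : Ω ∈ groundSector 𝓣 T) :
    Ω = 0 ∨ ∀ᵐ n, orbitSup Ω n ≠ 0 := by
  refine (ae_eq_zero_or_ne_zero_of_fiberOp_eq hT (measurable_orbitSup Ω)
    (fiberOp_orbitSup hTO hT hΩ)).imp (fun h => ?_) id
  refine AEEqFun.ext ?_
  filter_upwards [ae_enorm_le_orbitSup Ω, ae_diffs h,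
    AEEqFun.coeFn_zero (α := Conf N r) (β := ℂ) (μ := volume)] with x h1 h2 h3
  rw [h2] at h1
  rw [h3]
  simpa using h1

end GroundStates

/-! ### The singlet fiber -/

/-- The image of dk under inversion is left invariant because dk is right invariant; a Haar
probability measure is unique. -/
theorem measurePreserving_inv_SO :
    MeasurePreserving (fun k : SO N => k⁻¹) (haarSO N) (haarSO N) := by
  refine ⟨measurable_inv, ?_⟩
  change (haarSO N).inv = haarSO N
  have h : IsProbabilityMeasure (haarSO N).inv :=
    Measure.isProbabilityMeasure_map measurable_inv.aemeasurable
  have h' : (haarSO N).inv.IsHaarMeasure :=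
    { lt_top_of_isCompact := fun _ _ => measure_lt_top _ _
      open_pos := fun U hU hne => by
        rw [Measure.inv_apply]
        exact (hU.inv.measure_pos _ hne.inv).ne' }
  exact Measure.isHaarMeasure_eq_of_isProbabilityMeasure _ _

theorem measurePreserving_inv_ISO :
    MeasurePreserving (fun g : ISO N => g⁻¹) (haarISO N) (haarISO N) := by
  have hm : Measurable (Function.uncurry fun (k : SO N) (a : Pt N) => -rot k⁻¹ a) :=
    (continuous_rot.comp ((continuous_fst.inv).prodMk continuous_snd)).neg.measurable
  exact MeasurePreserving.skew_product measurePreserving_inv_SO hm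
    (Filter.Eventually.of_forall fun k =>
      ((Measure.measurePreserving_neg volume).comp (rot k⁻¹).measurePreserving).map_eq)

/-- Orbit coordinates g(0, n) without the inverse: they turn the integral of the kernel over
configurations into one over (g, n'). -/
theorem measurePreserving_act_based :
    MeasurePreserving (fun p : ISO N × Rel N r => act p.1 (based p.2))
      ((haarISO N).prod volume) volume := by
  have h := (measurePreserving_place (N := N) (r := r)).comp
    (measurePreserving_inv_ISO.prod (MeasurePreserving.id (volume : Measure (Rel N r))))
  have e : (fun p : ISO N × Rel N r => act p.1 (based p.2)) =
      (fun p : ISO N × Rel N r => place p.1 p.2) ∘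
        Prod.map (fun g : ISO N => g⁻¹) (id : Rel N r → Rel N r) := by
    funext p
    simp [place]
  rw [e]
  exact h

theorem measurable_rotRel : Measurable fun p : SO N × Rel N r => rotRel p.1 p.2 :=
  (continuous_pi fun i => continuous_rot.comp
    (continuous_fst.prodMk ((continuous_apply i).comp continuous_snd))).measurable

/-- A rotation invariant function is invariant under almost every rotation at almost every
point. -/
theorem ae_ae_rotRel (f : invL2 N r) :
    ∀ᵐ n : Rel N r, ∀ᵐ g ∂(haarISO N), f.1 (rotRel g.1 n) = f.1 n := by
  have hf : Measurable f.1 := (Lp.stronglyMeasurable f.1).measurable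
  have hm : MeasurableSet {p : SO N × Rel N r | f.1 (rotRel p.1 p.2) = f.1 p.2} :=
    measurableSet_eq_fun (hf.comp measurable_rotRel) (hf.comp measurable_snd)
  have h := (Measure.ae_ae_comm (μ := haarSO N) hm).1 (Filter.Eventually.of_forall f.2)
  filter_upwards [h] with n hn
  exact (Measure.quasiMeasurePreserving_fst (μ := haarSO N)
    (ν := (volume : Measure (Pt N)))).ae hn

theorem ae_place_eq (f : invL2 N r) :
    ∀ᵐ n : Rel N r, ∀ᵐ g ∂(haarISO N), f.1 (diffs (place g n)) = f.1 n := by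
  filter_upwards [ae_ae_rotRel f] with n hn
  have := measurePreserving_inv_ISO.quasiMeasurePreserving.ae hn
  filter_upwards [this] with g hg
  rw [diffs_place]
  exact hg

section Singlet

variable {T : Conf N r → Conf N r → ℝ}

/-- The action of the kernel on complex functions of the differences. -/
def fiberInt (T : Conf N r → Conf N r → ℝ) (f : Rel N r → ℂ) (n : Rel N r) : ℂ :=
  ∫ y, (T (based n) y : ℂ) * f (diffs y)

theorem IsInvariantKernel.measurable_complex (hT : IsInvariantKernel T) (x : Conf N r) :
    Measurable fun y => (T x y : ℂ) :=
  Complex.measurable_ofReal.comp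
    (hT.continuous.comp (continuous_const.prodMk continuous_id)).measurable

theorem lintegral_enorm_kernel (hT : IsInvariantKernel T) (x : Conf N r) (F : Conf N r → ℂ) :
    ∫⁻ y, ‖(T x y : ℂ) * F y‖ₑ = posOp T (fun y => ‖F y‖ₑ) x := by
  refine lintegral_congr fun y => ?_
  rw [enorm_mul, ← ofReal_norm (T x y : ℂ), Complex.norm_real, Real.norm_of_nonneg (hT.nonneg x y)]

theorem ae_integrable_kernel (hT : IsInvariantKernel T) (f : L2 (Rel N r)) :
    ∀ᵐ n, Integrable fun y => (T (based n) y : ℂ) * f (diffs y) := by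
  have hf : Measurable f := (Lp.stronglyMeasurable f).measurable
  have h2 : ∫⁻ n, ‖f n‖ₑ ^ 2 ≠ ∞ := by rw [lintegral_enorm_sq_Lp]; simp
  filter_upwards [ae_ne_top_of_lintegral_sq (measurable_fiberOp hT hf.enorm)
    (lintegral_fiberOp_sq_lt_top hT hf.enorm h2).ne] with n hn
  refine ⟨((hT.measurable_complex _).mul (hf.comp measurable_diffs)).aestronglyMeasurable, ?_⟩
  rw [hasFiniteIntegral_iff_enorm, lintegral_enorm_kernel hT _ fun y => f (diffs y)]
  exact lt_top_iff_ne_top.2 hn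

theorem stronglyMeasurable_fiberInt (hT : IsInvariantKernel T) (f : L2 (Rel N r)) :
    StronglyMeasurable (fiberInt T f) := by
  have hf : Measurable f := (Lp.stronglyMeasurable f).measurable
  have h : StronglyMeasurable (Function.uncurry fun (x y : Conf N r) =>
      (T x y : ℂ) * f (diffs y)) :=
    ((Complex.measurable_ofReal.comp hT.continuous.measurable).mul
      ((hf.comp measurable_diffs).comp measurable_snd)).stronglyMeasurable
  exact h.integral_prod_right.comp_measurable continuous_based.measurable

theorem lintegral_fiberInt_sq_le (hT : IsInvariantKernel T) {κ : ℝ≥0} (hκ : IsFiberBound T κ)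
    (f : L2 (Rel N r)) :
    ∫⁻ n, ‖fiberInt T f n‖ₑ ^ 2 ≤ ((κ : ℝ≥0∞) * ‖f‖ₑ) ^ 2 := by
  have hf : Measurable f := (Lp.stronglyMeasurable f).measurable
  have h2 : ∫⁻ n, ‖f n‖ₑ ^ 2 ≠ ∞ := by rw [lintegral_enorm_sq_Lp]; simp
  rw [mul_pow, ← lintegral_enorm_sq_Lp]
  refine (lintegral_mono fun n => pow_le_pow_left' ?_ 2).trans (hκ _ hf.enorm h2)
  exact enorm_integral_kernel_le hT (fun y => f (diffs y)) _

theorem memLp_fiberInt (hT : IsInvariantKernel T) {κ : ℝ≥0} (hκ : IsFiberBound T κ)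
    (f : L2 (Rel N r)) : MemLp (fiberInt T f) 2 volume := by
  refine ⟨(stronglyMeasurable_fiberInt hT f).aestronglyMeasurable, ?_⟩
  rw [eLpNorm_lt_top_iff_lintegral_rpow_enorm_lt_top (by norm_num) (by norm_num)]
  simp only [ENNReal.toReal_ofNat, ENNReal.rpow_two]
  exact (lintegral_fiberInt_sq_le hT hκ f).trans_lt
    (ENNReal.pow_lt_top (ENNReal.mul_lt_top (by simp) (by simp)))

theorem fiberInt_rotRel (hT : IsInvariantKernel T) (f : invL2 N r) (k : SO N) (n : Rel N r) :
    fiberInt T f.1 (rotRel k n) = fiberInt T f.1 n := by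
  unfold fiberInt
  rw [based_rotRel, ← (measurePreserving_act (rotation k)).integral_comp
    (measurableEmbedding_act (rotation k))]
  refine integral_congr_ae ?_
  filter_upwards [ae_diffs (f.2 k)] with y hy
  rw [hT.act, diffs_act]
  exact congrArg _ hy

theorem toLp_fiberInt_mem (hT : IsInvariantKernel T) {κ : ℝ≥0} (hκ : IsFiberBound T κ)
    (f : invL2 N r) : (memLp_fiberInt hT hκ f.1).toLp ∈ invL2 N r := by
  intro k
  have h := (memLp_fiberInt hT hκ f.1).coeFn_toLp
  filter_upwards [h, (measurePreserving_rotRel k).quasiMeasurePreserving.ae h] with n h1 h2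
  rw [h1, h2, fiberInt_rotRel hT]

/-- The component of the transfer operator in the singlet representation. -/
def singletFiber (hT : IsInvariantKernel T) {κ : ℝ≥0} (hκ : IsFiberBound T κ) :
    invL2 N r →L[ℂ] invL2 N r :=
  LinearMap.mkContinuous
    { toFun := fun f => ⟨(memLp_fiberInt hT hκ f.1).toLp, toLp_fiberInt_mem hT hκ f⟩
      map_add' := fun f f' => Subtype.ext <| Lp.ext <| by
        refine (memLp_fiberInt hT hκ (f + f').1).coeFn_toLp.trans ?_
        refine Filter.EventuallyEq.trans ?_ (Lp.coeFn_add _ _).symm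
        filter_upwards [(memLp_fiberInt hT hκ f.1).coeFn_toLp,
          (memLp_fiberInt hT hκ f'.1).coeFn_toLp, ae_integrable_kernel hT f.1,
          ae_integrable_kernel hT f'.1] with n h1 h2 h3 h4
        rw [Pi.add_apply, h1, h2, fiberInt, fiberInt, fiberInt, ← integral_add h3 h4]
        refine integral_congr_ae ?_
        filter_upwards [ae_diffs (Lp.coeFn_add f.1 f'.1)] with y hy
        rw [← mul_add]
        exact congrArg _ hy
      map_smul' := fun c f => Subtype.ext <| Lp.ext <| by
        refine (memLp_fiberInt hT hκ (c • f).1).coeFn_toLp.trans ?_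
        refine Filter.EventuallyEq.trans ?_ (Lp.coeFn_smul _ _).symm
        filter_upwards [(memLp_fiberInt hT hκ f.1).coeFn_toLp] with n h1
        rw [Pi.smul_apply, h1, fiberInt, fiberInt, RingHom.id_apply, smul_eq_mul,
          ← integral_const_mul]
        refine integral_congr_ae ?_
        filter_upwards [ae_diffs (Lp.coeFn_smul c f.1)] with y hy
        rw [mul_left_comm]
        exact congrArg _ hy }
    κ (fun f => by
      have h1 : ‖(memLp_fiberInt hT hκ f.1).toLp‖ₑ ^ 2 ≤ ((κ : ℝ≥0∞) * ‖f.1‖ₑ) ^ 2 := by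
        refine le_trans (le_of_eq ?_) (lintegral_fiberInt_sq_le hT hκ f.1)
        rw [← lintegral_enorm_sq_Lp]
        refine lintegral_congr_ae ?_
        filter_upwards [(memLp_fiberInt hT hκ f.1).coeFn_toLp] with n hn
        rw [hn]
      have h2 : ‖(memLp_fiberInt hT hκ f.1).toLp‖ₑ ≤ κ * ‖f.1‖ₑ := le_of_not_gt fun hlt =>
        absurd h1 (ENNReal.pow_lt_pow_left two_ne_zero hlt).not_ge
      rw [enorm_eq_nnnorm, enorm_eq_nnnorm] at h2
      have h3 : ‖(memLp_fiberInt hT hκ f.1).toLp‖₊ ≤ κ * ‖f.1‖₊ := by exact_mod_cast h2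
      exact_mod_cast h3)

theorem singletFiber_apply (hT : IsInvariantKernel T) {κ : ℝ≥0} (hκ : IsFiberBound T κ)
    (f : invL2 N r) : ∀ᵐ n, (singletFiber hT hκ f).1 n = fiberInt T f.1 n :=
  (memLp_fiberInt hT hκ f.1).coeFn_toLp

theorem nnnorm_singletFiber_le (hT : IsInvariantKernel T) {κ : ℝ≥0} (hκ : IsFiberBound T κ) :
    ‖singletFiber hT hκ‖₊ ≤ κ :=
  LinearMap.mkContinuous_norm_le _ κ.coe_nonneg _

/-- In orbit coordinates y = g(0, n') the factor f at the differences of y is f(n') by rotation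
invariance. Moving g to the other argument of T by invariance leaves the averaged kernel. -/
theorem isSingletFiber_singletFiber (hT : IsInvariantKernel T) {κ : ℝ≥0}
    (hκ : IsFiberBound T κ) : IsSingletFiber T (singletFiber hT hκ) := by
  intro f
  filter_upwards [singletFiber_apply hT hκ f, ae_integrable_kernel hT f.1] with n h1 h2
  have hP : Integrable (fun p : ISO N × Rel N r =>
      (T (based n) (act p.1 (based p.2)) : ℂ) * f.1 (rotRel p.1.1 p.2))
      ((haarISO N).prod volume) := by
    have := measurePreserving_act_based.integrable_comp_of_integrable h2
    refine this.congr (Filter.Eventually.of_forall fun p => ?_)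
    simp only [Function.comp, diffs_act, diffs_based]
  have hI : ∫ y, (T (based n) y : ℂ) * f.1 (diffs y) =
      ∫ p : ISO N × Rel N r, (T (based n) (act p.1 (based p.2)) : ℂ) * f.1 (rotRel p.1.1 p.2)
        ∂((haarISO N).prod volume) := by
    rw [← measurePreserving_act_based.map_eq, integral_map
      measurePreserving_act_based.measurable.aemeasurable]
    · simp only [diffs_act, diffs_based]
    · rw [measurePreserving_act_based.map_eq]
      exact h2.1
  have hK : ∀ᵐ n' : Rel N r, ∫ g, (T (based n) (act g (based n')) : ℂ) * f.1 (rotRel g.1 n')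
      ∂(haarISO N) = (singletKernel T n n' : ℂ) * f.1 n' := by
    filter_upwards [ae_ae_rotRel f] with n' hn'
    rw [singletKernel, ← integral_complex_ofReal, ← integral_mul_const]
    refine integral_congr_ae ?_
    filter_upwards [hn'] with g hg
    rw [hg, place, ← hT.act g⁻¹ (based n), act_inv_act]
  refine ⟨hP.integral_prod_right.congr hK, ?_⟩
  rw [h1, fiberInt, hI, integral_prod_symm _ hP]
  exact integral_congr_ae hK

/-! ### Eigenfunctions of the singlet fiber -/

/-- The absolute value of a rotation invariant function. -/
def absInv (f : invL2 N r) : invL2 N r :=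
  ⟨(memLp_toReal (F := fun n => ‖f.1 n‖ₑ) (Lp.stronglyMeasurable f.1).measurable.enorm
    (by rw [lintegral_enorm_sq_Lp]; simp)).toLp, by
    intro k
    have h := (memLp_toReal (F := fun n => ‖f.1 n‖ₑ) (μ := volume)
      (Lp.stronglyMeasurable f.1).measurable.enorm
      (by rw [lintegral_enorm_sq_Lp]; simp)).coeFn_toLp
    filter_upwards [h, (measurePreserving_rotRel k).quasiMeasurePreserving.ae h, f.2 k]
      with n h1 h2 h3
    rw [h1, h2, h3]⟩

theorem absInv_apply (f : invL2 N r) : ∀ᵐ n, (absInv f).1 n = ((‖f.1 n‖ₑ).toReal : ℂ) :=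
  (memLp_toReal (F := fun n => ‖f.1 n‖ₑ) (Lp.stronglyMeasurable f.1).measurable.enorm
    (by rw [lintegral_enorm_sq_Lp]; simp)).coeFn_toLp

theorem lintegral_enorm_sq_ne_top (f : L2 (Rel N r)) : ∫⁻ n, ‖f n‖ₑ ^ 2 ≠ ∞ := by
  rw [lintegral_enorm_sq_Lp]; simp

theorem measurable_enorm_L2 (f : L2 (Rel N r)) : Measurable fun n => ‖f n‖ₑ :=
  (Lp.stronglyMeasurable f).measurable.enorm

theorem fiberInt_absInv (hT : IsInvariantKernel T) (f : invL2 N r) (n : Rel N r) :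
    fiberInt T (absInv f).1 n = ((fiberOp T (fun n => ‖f.1 n‖ₑ) n).toReal : ℂ) := by
  rw [fiberOp, ← integral_kernel_toReal hT ((measurable_enorm_L2 f.1).comp measurable_diffs)
    (by simp)]
  refine integral_congr_ae ?_
  filter_upwards [ae_diffs (absInv_apply f)] with y hy
  rw [hy]
  rfl

/-- The singlet operator is applied to |f|, on which it acts as the positive operator; this gives a
bound by its own norm rather than by κ. -/
theorem lintegral_fiberOp_enorm_sq_le (hT : IsInvariantKernel T) {κ : ℝ≥0}
    (hκ : IsFiberBound T κ) (f : invL2 N r) :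
    ∫⁻ n, fiberOp T (fun n => ‖f.1 n‖ₑ) n ^ 2 ≤
      (‖singletFiber hT hκ‖₊ : ℝ≥0∞) ^ 2 * ∫⁻ n, ‖f.1 n‖ₑ ^ 2 := by
  have hm := measurable_enorm_L2 f.1
  have h2 := lintegral_enorm_sq_ne_top f.1
  have hfin := ae_ne_top_of_lintegral_sq (measurable_fiberOp hT hm)
    (lintegral_fiberOp_sq_lt_top hT hm h2).ne
  have e1 : ∫⁻ n, fiberOp T (fun n => ‖f.1 n‖ₑ) n ^ 2 =
      ‖(singletFiber hT hκ (absInv f)).1‖ₑ ^ 2 := by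
    rw [← lintegral_enorm_sq_Lp]
    refine lintegral_congr_ae ?_
    filter_upwards [singletFiber_apply hT hκ (absInv f), hfin] with n h1 h3
    rw [h1, fiberInt_absInv hT, enorm_toReal h3]
  have e2 : ∫⁻ n, ‖f.1 n‖ₑ ^ 2 = ‖(absInv f).1‖ₑ ^ 2 := by
    rw [← lintegral_enorm_sq_Lp]
    refine lintegral_congr_ae ?_
    filter_upwards [absInv_apply f] with n h1
    rw [h1, enorm_toReal (by simp)]
  rw [e1, e2, ← mul_pow]
  exact pow_le_pow_left' ((singletFiber hT hκ).le_opENorm (absInv f)) 2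

theorem enorm_coe_mul (κ : ℝ≥0) (z : ℂ) : ‖((κ : ℝ) : ℂ) * z‖ₑ = κ * ‖z‖ₑ := by
  rw [enorm_mul, ← ofReal_norm ((κ : ℝ) : ℂ), Complex.norm_real, Real.norm_of_nonneg κ.coe_nonneg,
    ENNReal.ofReal_coe_nnreal]

/-- The triangle inequality makes |f| a subsolution for the norm of the singlet operator, and that
norm bounds the image of |f|. -/
theorem fiberOp_enorm_eigenvector (hT : IsInvariantKernel T) {κ : ℝ≥0}
    (hκ : IsFiberBound T κ) {f : invL2 N r}
    (hf : singletFiber hT hκ f = (‖singletFiber hT hκ‖ : ℂ) • f) :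
    ∀ᵐ n, fiberOp T (fun n => ‖f.1 n‖ₑ) n = ‖singletFiber hT hκ‖₊ * ‖f.1 n‖ₑ := by
  refine fiberOp_eq_of_le hT (measurable_enorm_L2 f.1) (lintegral_enorm_sq_ne_top f.1) ?_
    (lintegral_fiberOp_enorm_sq_le hT hκ f)
  have h := singletFiber_apply hT hκ f
  rw [hf] at h
  filter_upwards [h, Lp.coeFn_smul (‖singletFiber hT hκ‖ : ℂ) f.1] with n h1 h2
  have h3 := enorm_integral_kernel_le hT (fun y => f.1 (diffs y)) (based n)
  have h4 : (‖singletFiber hT hκ‖ : ℂ) * f.1 n = fiberInt T f.1 n := h2.symm.trans h1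
  refine le_trans (le_of_eq ?_) h3
  change _ = ‖fiberInt T f.1 n‖ₑ
  rw [← h4]
  exact (enorm_coe_mul ‖singletFiber hT hκ‖₊ _).symm

theorem ae_ne_zero_of_eigenvector (hT : IsInvariantKernel T) {κ : ℝ≥0}
    (hκ : IsFiberBound T κ) {f : invL2 N r} (hf0 : f ≠ 0)
    (hf : singletFiber hT hκ f = (‖singletFiber hT hκ‖ : ℂ) • f) :
    ∀ᵐ n, ‖f.1 n‖ₑ ≠ 0 := by
  refine (ae_eq_zero_or_ne_zero_of_fiberOp_eq hT (measurable_enorm_L2 f.1)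
    (fiberOp_enorm_eigenvector hT hκ hf)).resolve_left fun h => hf0 (Subtype.ext (Lp.ext ?_))
  filter_upwards [h, Lp.coeFn_zero ℂ 2 (volume : Measure (Rel N r))] with n h1 h2
  refine Eq.trans ?_ h2.symm
  simpa using h1

/-- If the singlet fiber attains its norm, the norm is that of the transfer operator. -/
theorem norm_singletFiber_eq {𝓣 : L2 (Conf N r) →L[ℂ] L2 (Conf N r)}
    (hTO : IsTransferOperator 𝓣 T) (hT : IsInvariantKernel T)
    (hκ : IsFiberBound T ‖𝓣‖₊) {f : invL2 N r} (hf0 : f ≠ 0)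
    (hf : singletFiber hT hκ f = (‖singletFiber hT hκ‖ : ℂ) • f) :
    ‖singletFiber hT hκ‖₊ = ‖𝓣‖₊ := by
  refine le_antisymm (nnnorm_singletFiber_le hT hκ) ?_
  exact opNorm_le_of_fiberOp_le hTO hT (measurable_enorm_L2 f.1)
    (ae_ne_zero_of_eigenvector hT hκ hf0 hf) (by simp)
    ((fiberOp_enorm_eigenvector hT hκ hf).mono fun n hn => hn.le)

end Singlet

/-! ### Ground states as functions of the differences -/

/-- The function `x ↦ f(x_2 - x_1, …, x_ν - x_1)`. -/
def pullback (N r : ℕ) : invL2 N r →ₗ[ℂ] AEFun N r where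
  toFun f := (f.1 : Rel N r →ₘ[volume] ℂ).compQuasiMeasurePreserving diffs
    quasiMeasurePreserving_diffs
  map_add' f f' := by
    refine AEEqFun.ext ?_
    filter_upwards [AEEqFun.coeFn_compQuasiMeasurePreserving ((f + f').1 : Rel N r →ₘ[volume] ℂ)
        quasiMeasurePreserving_diffs,
      AEEqFun.coeFn_compQuasiMeasurePreserving (f.1 : Rel N r →ₘ[volume] ℂ)
        quasiMeasurePreserving_diffs,
      AEEqFun.coeFn_compQuasiMeasurePreserving (f'.1 : Rel N r →ₘ[volume] ℂ)
        quasiMeasurePreserving_diffs,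
      AEEqFun.coeFn_add ((f.1 : Rel N r →ₘ[volume] ℂ).compQuasiMeasurePreserving diffs
        quasiMeasurePreserving_diffs) ((f'.1 : Rel N r →ₘ[volume] ℂ).compQuasiMeasurePreserving
        diffs quasiMeasurePreserving_diffs), ae_diffs (Lp.coeFn_add f.1 f'.1)]
      with x h1 h2 h3 h4 h5
    rw [h1, h4, Pi.add_apply, h2, h3]
    exact h5
  map_smul' c f := by
    refine AEEqFun.ext ?_
    filter_upwards [AEEqFun.coeFn_compQuasiMeasurePreserving ((c • f).1 : Rel N r →ₘ[volume] ℂ)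
        quasiMeasurePreserving_diffs,
      AEEqFun.coeFn_compQuasiMeasurePreserving (f.1 : Rel N r →ₘ[volume] ℂ)
        quasiMeasurePreserving_diffs,
      AEEqFun.coeFn_smul c ((f.1 : Rel N r →ₘ[volume] ℂ).compQuasiMeasurePreserving diffs
        quasiMeasurePreserving_diffs), ae_diffs (Lp.coeFn_smul c f.1)]
      with x h1 h2 h3 h4
    rw [h1, RingHom.id_apply, h3, Pi.smul_apply, h2]
    exact h4

theorem pullback_apply (f : invL2 N r) : ∀ᵐ x, pullback N r f x = f.1 (diffs x) :=
  AEEqFun.coeFn_compQuasiMeasurePreserving (f.1 : Rel N r →ₘ[volume] ℂ)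
    quasiMeasurePreserving_diffs

theorem pullback_injective : Function.Injective (pullback N r) := by
  refine (injective_iff_map_eq_zero _).2 fun f hf => Subtype.ext (Lp.ext ?_)
  have h : ∀ᵐ x : Conf N r, f.1 (diffs x) = 0 := by
    have h1 := pullback_apply f
    rw [hf] at h1
    filter_upwards [h1, AEEqFun.coeFn_zero (α := Conf N r) (β := ℂ) (μ := volume)] with x h1 h2
    rw [← h1, h2]
    rfl
  filter_upwards [ae_of_ae_diffs (p := fun n => f.1 n = 0) h, Lp.coeFn_zero ℂ 2 (volume : Measure (Rel N r))] with n h1 h2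
  exact h1.trans h2.symm

theorem ae_pullback_place (f : invL2 N r) :
    ∀ᵐ n : Rel N r, ∀ᵐ g ∂(haarISO N), pullback N r f (place g n) = f.1 n := by
  filter_upwards [ae_place (pullback_apply f), ae_place_eq f] with n h1 h2
  filter_upwards [h1, h2] with g h3 h4
  rw [h3, h4]

theorem haarISO_ne_zero : haarISO N ≠ 0 := by
  intro h
  have h' : (haarSO N).prod (volume : Measure (Pt N)) = 0 := h
  have h1 : (haarSO N).prod volume (Set.univ ×ˢ Metric.ball (0 : Pt N) 1) = 0 := by rw [h']; rfl
  rw [Measure.prod_prod, measure_univ, one_mul] at h1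
  exact (Metric.measure_ball_pos volume (0 : Pt N) one_pos).ne' h1

/-- On almost every orbit the function is constant and equal to f(n), so the essential supremum
costs nothing and the two norms coincide. -/
theorem normSup2_pullback (f : invL2 N r) : normSup2 (pullback N r f) = ENNReal.ofReal ‖f‖ := by
  have h : ∫⁻ n : Rel N r, eLpNorm (fun g => pullback N r f (place g n)) ∞ (haarISO N) ^ 2 =
      ‖f.1‖ₑ ^ 2 := by
    rw [← lintegral_enorm_sq_Lp]
    refine lintegral_congr_ae ?_
    filter_upwards [ae_pullback_place f] with n hn
    rw [eLpNorm_congr_ae (g := fun _ => f.1 n) hn, eLpNorm_exponent_top,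
      eLpNormEssSup_const _ haarISO_ne_zero]
  rw [normSup2, h, ← ENNReal.rpow_two, ← ENNReal.rpow_mul]
  norm_num

/-! ### Correspondence between ground states and singlet eigenvectors -/

section GroundSector

variable {𝓣 : L2 (Conf N r) →L[ℂ] L2 (Conf N r)} {T : Conf N r → Conf N r → ℝ}

theorem integral_kernel_diffs (hT : IsInvariantKernel T) (f : Rel N r → ℂ) (x : Conf N r) :
    ∫ y, (T x y : ℂ) * f (diffs y) = fiberInt T f (diffs x) := by
  conv_lhs => rw [← conf_diffs x, conf, ← act_transl,
    ← (measurePreserving_act (transl (x 0))).integral_comp (measurableEmbedding_act _)]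
  simp only [hT.act]
  simp only [act_transl, diffs_shift]
  rfl

theorem integrable_kernel_diffs (hT : IsInvariantKernel T) {f : Rel N r → ℂ} {x : Conf N r}
    (h : Integrable fun y => (T (based (diffs x)) y : ℂ) * f (diffs y)) :
    Integrable fun y => (T x y : ℂ) * f (diffs y) := by
  have h1 := (measurePreserving_shift (-x 0)).integrable_comp_of_integrable h
  refine h1.congr (Filter.Eventually.of_forall fun y => ?_)
  have e : based (diffs x) = shift (-x 0) x := by
    conv_rhs => rw [← conf_diffs x, shift_conf, conf_zero, neg_add_cancel, conf_zero_left]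
  simp only [Function.comp, diffs_shift]
  rw [e, hT.shift]

/-- Both sides are the same equation, read on configurations or on 𝒩. The eigenvalue is ‖𝓣‖; that it
is the norm of the singlet operator is known only once a nonzero eigenvector exists. -/
theorem pullback_mem_groundSector_iff (hT : IsInvariantKernel T) (hκ : IsFiberBound T ‖𝓣‖₊)
    (f : invL2 N r) :
    pullback N r f ∈ groundSector 𝓣 T ↔ singletFiber hT hκ f = (‖𝓣‖ : ℂ) • f := by
  have hint : ∀ x, ∫ y, (T x y : ℂ) * pullback N r f y = fiberInt T f.1 (diffs x) := by
    intro x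
    rw [← integral_kernel_diffs hT]
    refine integral_congr_ae ?_
    filter_upwards [pullback_apply f] with y hy
    rw [hy]
  have hs := Lp.coeFn_smul (‖𝓣‖ : ℂ) f.1
  constructor
  · intro h
    refine Subtype.ext (Lp.ext ?_)
    have h1 : ∀ᵐ x : Conf N r, fiberInt T f.1 (diffs x) = (‖𝓣‖ : ℂ) * f.1 (diffs x) := by
      filter_upwards [h.2, pullback_apply f] with x h1 h2
      rw [← hint, h1.2, h2]
    filter_upwards [ae_of_ae_diffs (p := fun n => fiberInt T f.1 n = (‖𝓣‖ : ℂ) * f.1 n) h1,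
      singletFiber_apply hT hκ f, hs] with n h2 h3 h4
    rw [h3, h2]
    exact h4.symm
  · intro h
    refine ⟨by rw [normSup2_pullback]; exact ENNReal.ofReal_lt_top, ?_⟩
    have h1 := singletFiber_apply hT hκ f
    rw [h] at h1
    filter_upwards [ae_diffs (ae_integrable_kernel hT f.1), pullback_apply f, ae_diffs h1,
      ae_diffs hs] with x h2 h3 h4 h5
    refine ⟨(integrable_kernel_diffs hT h2).congr ?_, ?_⟩
    · filter_upwards [pullback_apply f] with y hy
      rw [hy]
    · rw [hint, h3, ← h4]
      exact h5

/-- Eigenvectors of the singlet fiber for the norm of the transfer operator exist only if the norms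
agree. -/
theorem norm_singletFiber_eq_of_eigenvector (hT : IsInvariantKernel T)
    (hκ : IsFiberBound T ‖𝓣‖₊) {f : invL2 N r} (hf0 : f ≠ 0)
    (hf : singletFiber hT hκ f = (‖𝓣‖ : ℂ) • f) : ‖singletFiber hT hκ‖ = ‖𝓣‖ := by
  refine le_antisymm (nnnorm_singletFiber_le hT hκ) ?_
  have h := (singletFiber hT hκ).le_opNorm f
  rw [hf, norm_smul, Complex.norm_real, Real.norm_of_nonneg (norm_nonneg 𝓣)] at h
  exact le_of_mul_le_mul_right h (norm_pos_iff.2 hf0)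

theorem pullback_mem_groundSector (hTO : IsTransferOperator 𝓣 T) (hT : IsInvariantKernel T)
    (hκ : IsFiberBound T ‖𝓣‖₊) {f : invL2 N r} (hf : f ∈ opGroundSector (singletFiber hT hκ)) :
    pullback N r f ∈ groundSector 𝓣 T := by
  have hf' : singletFiber hT hκ f = (‖singletFiber hT hκ‖ : ℂ) • f :=
    Module.End.mem_eigenspace_iff.1 hf
  by_cases h0 : f = 0
  · rw [h0, map_zero]
    exact zero_mem _
  · rw [pullback_mem_groundSector_iff hT hκ, hf']
    have h : ‖singletFiber hT hκ‖ = ‖𝓣‖ :=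
      congrArg NNReal.toReal (norm_singletFiber_eq hTO hT hκ h0 hf')
    rw [h]

/-- A square integrable, rotation invariant, nonnegative function as an element of `L²`. -/
def invOfENNReal {m : Rel N r → ℝ≥0∞} (hm : Measurable m) (hm2 : ∫⁻ n, m n ^ 2 ≠ ∞)
    (hrot : ∀ k n, m (rotRel k n) = m n) : invL2 N r :=
  ⟨(memLp_toReal hm hm2).toLp, by
    intro k
    have h := (memLp_toReal hm hm2).coeFn_toLp
    filter_upwards [h, (measurePreserving_rotRel k).quasiMeasurePreserving.ae h] with n h1 h2
    rw [h1, h2, hrot]⟩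

theorem exists_pullback_eq (hTO : IsTransferOperator 𝓣 T) (hT : IsInvariantKernel T)
    {Ω : AEFun N r} (hΩ : Ω ∈ groundSector 𝓣 T) : ∃ f : invL2 N r, pullback N r f = Ω := by
  rcases eq_zero_or_orbitSup_ne_zero hTO hT hΩ with h0 | h0
  · exact ⟨0, by rw [map_zero, h0]⟩
  obtain ⟨c, hc⟩ := exists_groundState_eq hTO hT hΩ (measurable_orbitSup Ω)
    (lintegral_orbitSup_sq hΩ) h0 (fiberOp_orbitSup hTO hT hΩ)
  refine ⟨c • invOfENNReal (measurable_orbitSup Ω) (lintegral_orbitSup_sq hΩ)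
    (orbitSup_rotRel Ω), AEEqFun.ext ?_⟩
  set f := invOfENNReal (measurable_orbitSup Ω) (lintegral_orbitSup_sq hΩ) (orbitSup_rotRel Ω)
  have h1 : ∀ᵐ n, f.1 n = ((orbitSup Ω n).toReal : ℂ) :=
    (memLp_toReal (measurable_orbitSup Ω) (lintegral_orbitSup_sq hΩ)).coeFn_toLp
  rw [map_smul]
  filter_upwards [hc, AEEqFun.coeFn_smul c (pullback N r f), pullback_apply f, ae_diffs h1]
    with x h2 h3 h4 h5
  rw [h3, Pi.smul_apply, h4, h5, h2, smul_eq_mul]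

theorem exists_mem_opGroundSector_pullback_eq (hTO : IsTransferOperator 𝓣 T)
    (hT : IsInvariantKernel T) (hκ : IsFiberBound T ‖𝓣‖₊) {Ω : AEFun N r}
    (hΩ : Ω ∈ groundSector 𝓣 T) :
    ∃ f ∈ opGroundSector (singletFiber hT hκ), pullback N r f = Ω := by
  obtain ⟨f, rfl⟩ := exists_pullback_eq hTO hT hΩ
  refine ⟨f, Module.End.mem_eigenspace_iff.2 ?_, rfl⟩
  -- Without a nonzero eigenvector the norms are not compared, and the zero function must be treated
  -- apart.
  by_cases h0 : f = 0
  · simp [h0]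
  · have hf := (pullback_mem_groundSector_iff hT hκ f).1 hΩ
    rw [norm_singletFiber_eq_of_eigenvector hT hκ h0 hf]
    exact hf

/-- The identification of the ground states of the singlet fiber with those of the transfer
operator. -/
def groundSectorEquiv (hTO : IsTransferOperator 𝓣 T) (hT : IsInvariantKernel T)
    (hκ : IsFiberBound T ‖𝓣‖₊) :
    opGroundSector (singletFiber hT hκ) ≃ₗ[ℂ] groundSector 𝓣 T :=
  LinearEquiv.ofBijective
    ((pullback N r).restrict fun _ hf => pullback_mem_groundSector hTO hT hκ hf)
    ⟨fun _ _ h => Subtype.ext (pullback_injective (congrArg Subtype.val h)), fun Ω => by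
      obtain ⟨f, hf, h⟩ := exists_mem_opGroundSector_pullback_eq hTO hT hκ Ω.2
      exact ⟨⟨f, hf⟩, Subtype.ext h⟩⟩

/-- The square integral contains the volume of the translations as a factor on every fiber, and this
is infinite as soon as N ≥ 1. -/
theorem not_memLp_comp_diffs [NeZero N] {f : Rel N r → ℂ} (hf : Measurable f)
    (h0 : ∀ᵐ n, ‖f n‖ₑ ≠ 0) {ψ : Conf N r → ℂ} (hψ : ∀ᵐ x, ψ x = f (diffs x)) :
    ¬ MemLp ψ 2 volume := by
  intro h
  have h1 := (eLpNorm_lt_top_iff_lintegral_rpow_enorm_lt_top (by norm_num) (by norm_num)).1 h.2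
  simp only [ENNReal.toReal_ofNat, ENNReal.rpow_two] at h1
  have h2 : ∫⁻ x, ‖ψ x‖ₑ ^ 2 = ∫⁻ x : Conf N r, ‖f (diffs x)‖ₑ ^ 2 := by
    refine lintegral_congr_ae ?_
    filter_upwards [hψ] with x hx
    rw [hx]
  rw [h2, lintegral_conf (show Measurable fun x : Conf N r => ‖f (diffs x)‖ₑ ^ 2 from
    (hf.comp measurable_diffs).enorm.pow_const 2)] at h1
  simp only [diffs_conf, lintegral_const] at h1
  have hnt : Nontrivial (Pt N) :=
    Module.nontrivial_of_finrank_pos (R := ℝ) (by simpa using NeZero.pos N)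
  have hnc : NoncompactSpace (Pt N) := NormedSpace.noncompactSpace ℝ (Pt N)
  rw [measure_univ_of_isAddLeftInvariant] at h1
  have h3 : ∫⁻ n : Rel N r, ‖f n‖ₑ ^ 2 * ∞ = ∫⁻ _ : Rel N r, ∞ := by
    refine lintegral_congr_ae ?_
    filter_upwards [h0] with n hn
    exact ENNReal.mul_top (pow_ne_zero 2 hn)
  rw [h3, lintegral_const, ENNReal.top_mul (NeZero.ne _)] at h1
  exact lt_irrefl _ h1

/-- An eigenvector of the singlet fiber gives a strictly positive ground state, unique up to
scalars. -/
theorem exists_unique_groundState [NeZero N] (hTO : IsTransferOperator 𝓣 T)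
    (hT : IsInvariantKernel T) (hκ : IsFiberBound T ‖𝓣‖₊) {f : invL2 N r} (hf0 : f ≠ 0)
    (hf : singletFiber hT hκ f = (‖𝓣‖ : ℂ) • f) :
    ∃ ψ ∈ groundSector 𝓣 T,
      (∀ᵐ x : Conf N r, (ψ x).im = 0 ∧ 0 < (ψ x).re) ∧
      (∃ f : invL2 N r, ∀ᵐ x : Conf N r, ψ x = f.1 (diffs x)) ∧
      (∀ Ω ∈ groundSector 𝓣 T, ∃ c : ℂ, Ω = c • ψ) ∧
      ¬ MemLp ψ 2 volume := by
  have hn := norm_singletFiber_eq_of_eigenvector hT hκ hf0 hf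
  have hn' : ‖singletFiber hT hκ‖₊ = ‖𝓣‖₊ := NNReal.eq hn
  have hf' : singletFiber hT hκ f = (‖singletFiber hT hκ‖ : ℂ) • f := by rw [hn]; exact hf
  have he := fiberOp_enorm_eigenvector hT hκ hf'
  rw [hn'] at he
  have h0 := ae_ne_zero_of_eigenvector hT hκ hf0 hf'
  have habs := absInv_apply f
  have hpull := pullback_apply (absInv f)
  -- A given eigenvector may carry a phase; its absolute value is the positive one.
  refine ⟨pullback N r (absInv f), ?_, ?_, ⟨absInv f, hpull⟩, fun Ω hΩ => ?_, ?_⟩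
  · rw [pullback_mem_groundSector_iff hT hκ]
    refine Subtype.ext (Lp.ext ?_)
    filter_upwards [singletFiber_apply hT hκ (absInv f), he, habs,
      Lp.coeFn_smul (‖𝓣‖ : ℂ) (absInv f).1] with n h1 h2 h3 h4
    rw [h1, fiberInt_absInv hT, h2, ENNReal.toReal_mul]
    refine Eq.trans ?_ h4.symm
    rw [Pi.smul_apply, h3]
    push_cast
    rfl
  · filter_upwards [hpull, ae_diffs habs, ae_diffs h0] with x h1 h2 h3
    rw [h1, h2]
    refine ⟨Complex.ofReal_im _, ?_⟩
    rw [Complex.ofReal_re]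
    exact ENNReal.toReal_pos h3 (by simp)
  · obtain ⟨c, hc⟩ := exists_groundState_eq hTO hT hΩ (measurable_enorm_L2 f.1)
      (lintegral_enorm_sq_ne_top f.1) h0 he
    refine ⟨c, AEEqFun.ext ?_⟩
    filter_upwards [hc, AEEqFun.coeFn_smul c (pullback N r (absInv f)), hpull, ae_diffs habs]
      with x h1 h2 h3 h4
    rw [h1, h2, Pi.smul_apply, h3, h4, smul_eq_mul]
  · refine not_memLp_comp_diffs (Lp.stronglyMeasurable (absInv f).1).measurable ?_ hpull
    filter_upwards [habs, h0] with n h1 h2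
    rwa [h1, enorm_toReal (by simp)]

end GroundSector

/-! ### Equivariance -/

section Equivariance

variable {𝓣 : L2 (Conf N r) →L[ℂ] L2 (Conf N r)} {T : Conf N r → Conf N r → ℝ}

/-- Evaluation of an operator on `ℂ` at `1`. -/
def evalOne : Compacts ℂ →L[ℂ] ℂ :=
  LinearMap.mkContinuous
    { toFun := fun A => A.1 1
      map_add' := fun _ _ => rfl
      map_smul' := fun _ _ => rfl } 1 fun A => by
    have h := A.1.le_opNorm 1
    rw [norm_one, mul_one] at h
    rw [one_mul]
    exact h

/-- At the trivial representation the Fourier transform is the integral over g, and Ω is constant in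
g. So the functional is the inner product with f, after identifying operators on ℂ with scalars. -/
theorem isEquivariant_singletRep_pullback (f : invL2 N r) :
    IsEquivariant (singletRep N) (pullback N r f) := by
  refine ⟨(innerSL ℂ f.1).comp (evalOne.compLpL 2 volume), fun φ _ Φ hΦ => ?_⟩
  change _ = ⟪f.1, evalOne.compLpL 2 volume Φ⟫_ℂ
  rw [L2.inner_def]
  refine integral_congr_ae ?_
  filter_upwards [ae_pullback_place f, hΦ, evalOne.coeFn_compLpL Φ] with n h1 h2 h3
  have h4 : ∫ g, conj (pullback N r f (place g n)) * φ (g, n) ∂(haarISO N) =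
      conj (f.1 n) * ∫ g, φ (g, n) ∂(haarISO N) := by
    rw [← integral_const_mul]
    refine integral_congr_ae ?_
    filter_upwards [h1] with g hg
    rw [hg]
  have h5 : evalOne (Φ n) = ∫ g, φ (g, n) ∂(haarISO N) := by
    have h6 := h2 1 1
    simp only [singletRep, MonoidHom.one_apply] at h6
    have h7 : evalOne (Φ n) = (Φ n).1 1 := rfl
    rw [h7]
    simpa using h6
  rw [h3, h5, h4]
  simp [mul_comm]

theorem isEquivariant_zero {H : Type*} [NormedAddCommGroup H] [InnerProductSpace ℂ H]
    (π : ISO N →* (H →ₗᵢ[ℂ] H)) : IsEquivariant π (0 : AEFun N r) := by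
  refine ⟨0, fun φ _ Φ _ => ?_⟩
  have h : ∀ᵐ n : Rel N r, ∫ g, conj ((0 : AEFun N r) (place g n)) * φ (g, n) ∂(haarISO N) = 0 := by
    filter_upwards [ae_place (AEEqFun.coeFn_zero (α := Conf N r) (β := ℂ) (μ := volume))] with n hn
    refine integral_eq_zero_of_ae ?_
    filter_upwards [hn] with g hg
    rw [hg]
    simp
  rw [integral_eq_zero_of_ae h]
  rfl

theorem measurePreserving_snd_ISO :
    MeasurePreserving (fun g : ISO N => g.2) (haarISO N) volume :=
  measurePreserving_snd (μ := haarSO N) (ν := (volume : Measure (Pt N)))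

/-- A rotation invariant function of the differences that is equivariant vanishes, if some test
function of the translations with nonzero mean has vanishing Fourier transform. -/
theorem eq_zero_of_isEquivariant_pullback {H : Type*} [NormedAddCommGroup H]
    [InnerProductSpace ℂ H] {π : ISO N →* (H →ₗᵢ[ℂ] H)} {η : Pt N → ℂ} (hηm : Measurable η)
    (hηi : Integrable η) (hη0 : ∫ a, η a ≠ 0)
    (hη : ∀ u w : H, ∫ g, η g.2 * ⟪u, π g⁻¹ w⟫_ℂ ∂(haarISO N) = 0) {f : invL2 N r}
    (h : IsEquivariant π (pullback N r f)) : f = 0 := by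
  obtain ⟨ℓ, hℓ⟩ := h
  have hf : Measurable f.1 := (Lp.stronglyMeasurable f.1).measurable
  -- Its Fourier transform is f(n) times that of η, hence zero, while its pairing with the ground
  -- state is ‖f‖² times the mean of η.
  set φ : ISO N × Rel N r → ℂ := fun p => η p.1.2 * f.1 p.2 with hφ
  have hφm : Measurable φ := (hηm.comp (measurePreserving_snd_ISO.measurable.comp
    measurable_fst)).mul (hf.comp measurable_snd)
  have hη1 : ∫⁻ g : ISO N, ‖η g.2‖ₑ ∂(haarISO N) = ∫⁻ a, ‖η a‖ₑ :=
    measurePreserving_snd_ISO.lintegral_comp hηm.enorm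
  have hmem : MemL12 φ := by
    refine ⟨hφm.aestronglyMeasurable, ?_⟩
    have e : ∀ n, (∫⁻ g, ‖φ (g, n)‖ₑ ∂(haarISO N)) ^ 2 = (∫⁻ a, ‖η a‖ₑ) ^ 2 * ‖f.1 n‖ₑ ^ 2 := by
      intro n
      simp only [hφ, enorm_mul]
      rw [lintegral_mul_const' _ _ (by simp), hη1, mul_pow]
    simp only [e]
    rw [lintegral_const_mul _ (hf.enorm.pow_const 2)]
    exact ENNReal.mul_lt_top (ENNReal.pow_lt_top hηi.2)
      (lintegral_enorm_sq_ne_top f.1).lt_top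
  have hFT : IsFourierTransform π φ (0 : Lp (Compacts H) 2 (volume : Measure (Rel N r))) := by
    filter_upwards [Lp.coeFn_zero (Compacts H) 2 (volume : Measure (Rel N r))] with n hn u w
    have e : ∫ g, φ (g, n) * ⟪u, π g⁻¹ w⟫_ℂ ∂(haarISO N) = 0 := by
      have : ∀ g : ISO N, φ (g, n) * ⟪u, π g⁻¹ w⟫_ℂ = f.1 n * (η g.2 * ⟪u, π g⁻¹ w⟫_ℂ) :=
        fun g => by simp only [hφ]; ring
      simp only [this]
      rw [integral_const_mul, hη, mul_zero]
    rw [e, hn]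
    exact inner_zero_right u
  have h1 := hℓ φ hmem 0 hFT
  rw [map_zero] at h1
  have h2 : ∀ᵐ n : Rel N r, ∫ g, conj (pullback N r f (place g n)) * φ (g, n) ∂(haarISO N) =
      ((‖f.1 n‖ ^ 2 : ℝ) : ℂ) * ∫ a, η a := by
    filter_upwards [ae_pullback_place f] with n hn
    have e : ∫ g : ISO N, η g.2 ∂(haarISO N) = ∫ a, η a := by
      rw [← measurePreserving_snd_ISO.map_eq, integral_map
        measurePreserving_snd_ISO.measurable.aemeasurable hηm.aestronglyMeasurable]
    rw [← e, ← integral_const_mul]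
    refine integral_congr_ae ?_
    filter_upwards [hn] with g hg
    rw [hg, hφ]
    have : conj (f.1 n) * f.1 n = ((‖f.1 n‖ ^ 2 : ℝ) : ℂ) := by
      rw [mul_comm, Complex.mul_conj, Complex.normSq_eq_norm_sq]
    rw [← this]
    ring
  rw [integral_congr_ae h2, integral_mul_const, integral_complex_ofReal] at h1
  have h3 : ∫ n, ‖f.1 n‖ ^ 2 = 0 := by
    have := (mul_eq_zero.1 h1).resolve_right hη0
    exact_mod_cast this
  have hi : Integrable fun n => ‖f.1 n‖ ^ 2 := by
    have := (Lp.memLp f.1).integrable_norm_pow (by norm_num)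
    simpa using this
  rw [integral_eq_zero_iff_of_nonneg (fun n => by positivity) hi] at h3
  refine Subtype.ext (Lp.ext ?_)
  filter_upwards [h3, Lp.coeFn_zero ℂ 2 (volume : Measure (Rel N r))] with n h4 h5
  refine Eq.trans ?_ h5.symm
  simpa using h4

end Equivariance

/-! ### A test function on the translations -/

theorem integral_gaussian_fourier (b : ℝ) (hb : 0 < b) (v : Pt N) :
    ∫ a : Pt N, Complex.exp (-(b : ℂ) * ‖a‖ ^ 2) * Complex.exp (-Complex.I * ⟪v, a⟫_ℝ) =
      (Real.pi / b : ℂ) ^ (N / 2 : ℂ) * Real.exp (-‖v‖ ^ 2 / (4 * b)) := by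
  have h := GaussianFourier.integral_cexp_neg_mul_sq_norm_add (b := (b : ℂ)) (by simpa using hb)
    (-Complex.I) v
  rw [finrank_euclideanSpace_fin] at h
  simp only [← Complex.exp_add]
  rw [h]
  congr 1
  rw [Complex.ofReal_exp]
  congr 1
  push_cast
  rw [neg_sq, Complex.I_sq]
  ring

theorem integrable_gaussian (b : ℝ) (hb : 0 < b) :
    Integrable fun a : Pt N => Complex.exp (-(b : ℂ) * ‖a‖ ^ 2) := by
  have h := GaussianFourier.integrable_cexp_neg_mul_sq_norm_add (b := (b : ℂ))
    (by simpa using hb) 0 (0 : Pt N)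
  simpa using h

/-- For `ω ≠ 0` there is an integrable function with nonzero mean whose Fourier transform vanishes
on the sphere of radius `ω`. -/
theorem exists_testFunction (N : ℕ) (ω : ℝ) : ∃ η : Pt N → ℂ, Measurable η ∧ Integrable η ∧
    ∫ a, η a ≠ 0 ∧ (ω ≠ 0 → ∀ v : Pt N, ‖v‖ = ω →
      ∫ a, η a * Complex.exp (-Complex.I * ⟪v, a⟫_ℝ) = 0) := by
  set I : ℝ → ℝ → ℂ := fun b t => (Real.pi / b : ℂ) ^ (N / 2 : ℂ) * Real.exp (-t ^ 2 / (4 * b))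
    with hI
  set γ : ℝ → Pt N → ℂ := fun b a => Complex.exp (-(b : ℂ) * ‖a‖ ^ 2) with hγ
  have hm : ∀ b, Measurable (γ b) := fun b => by fun_prop
  have hF : ∀ b, 0 < b → ∀ v : Pt N,
      ∫ a, γ b a * Complex.exp (-Complex.I * ⟪v, a⟫_ℝ) = I b ‖v‖ :=
    fun b hb v => integral_gaussian_fourier b hb v
  have hF0 : ∀ b, 0 < b → ∫ a, γ b a = I b 0 := fun b hb => by
    simpa using hF b hb 0
  have hc : ∀ b : ℝ, 0 < b → (Real.pi / b : ℂ) ^ (N / 2 : ℂ) ≠ 0 := fun b hb => by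
    rw [Complex.cpow_ne_zero_iff]
    left
    have : ((Real.pi / b : ℝ) : ℂ) ≠ 0 := Complex.ofReal_ne_zero.2 (by positivity)
    simpa using this
  by_cases hω : ω = 0
  · refine ⟨γ 1, hm 1, integrable_gaussian 1 one_pos, ?_, fun h => absurd hω h⟩
    rw [hF0 1 one_pos]
    exact mul_ne_zero (hc 1 one_pos) (Complex.ofReal_ne_zero.2 (Real.exp_pos _).ne')
  have hi1 := (integrable_gaussian (N := N) 1 one_pos).const_mul (I 2 ω)
  have hi2 := (integrable_gaussian (N := N) 2 two_pos).const_mul (I 1 ω)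
  -- Two Gaussians of different widths, with coefficients chosen to cancel their transforms on the
  -- sphere. The mean survives because the transforms decay at different rates, so their ratio at
  -- radius ω differs from that at zero.
  refine ⟨fun a => I 2 ω * γ 1 a - I 1 ω * γ 2 a, ((hm 1).const_mul _).sub ((hm 2).const_mul _),
    hi1.sub hi2, ?_, fun _ v hv => ?_⟩
  · rw [integral_sub hi1 hi2, integral_const_mul, integral_const_mul]
    change (I 2 ω * ∫ a, γ 1 a) - (I 1 ω * ∫ a, γ 2 a) ≠ 0
    rw [hF0 1 one_pos, hF0 2 two_pos]
    have e : I 2 ω * I 1 0 - I 1 ω * I 2 0 = ((Real.pi / (1 : ℝ) : ℂ) ^ (N / 2 : ℂ) *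
        (Real.pi / (2 : ℝ) : ℂ) ^ (N / 2 : ℂ)) *
        ((Real.exp (-ω ^ 2 / (4 * 2)) - Real.exp (-ω ^ 2 / (4 * 1)) : ℝ) : ℂ) := by
      simp only [hI]
      simp only [ne_eq, OfNat.ofNat_ne_zero, not_false_eq_true, zero_pow, neg_zero, zero_div,
        Real.exp_zero, Complex.ofReal_one, mul_one, Complex.ofReal_sub]
      ring
    rw [e]
    refine mul_ne_zero (mul_ne_zero (hc 1 one_pos) (hc 2 two_pos))
      (Complex.ofReal_ne_zero.2 (sub_ne_zero.2 fun h => ?_))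
    have h1 := Real.exp_injective h
    have h2 : ω ^ 2 = 0 := by linarith
    exact hω (by simpa using h2)
  · have hb : ∀ b, 0 < b → Integrable fun a : Pt N =>
        γ b a * Complex.exp (-Complex.I * ⟪v, a⟫_ℝ) := fun b hb => by
      have h := GaussianFourier.integrable_cexp_neg_mul_sq_norm_add (b := (b : ℂ))
        (by simpa using hb) (-Complex.I) v
      simpa only [Complex.exp_add] using h
    have e : ∀ a : Pt N, (I 2 ω * γ 1 a - I 1 ω * γ 2 a) * Complex.exp (-Complex.I * ⟪v, a⟫_ℝ) =
        I 2 ω * (γ 1 a * Complex.exp (-Complex.I * ⟪v, a⟫_ℝ)) -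
        I 1 ω * (γ 2 a * Complex.exp (-Complex.I * ⟪v, a⟫_ℝ)) := fun a => by ring
    simp only [e]
    rw [integral_sub ((hb 1 one_pos).const_mul _) ((hb 2 two_pos).const_mul _),
      integral_const_mul, integral_const_mul, hF 1 one_pos, hF 2 two_pos, hv]
    ring

/-! ### Vanishing of Fourier transforms at the principal series -/

theorem measurePreserving_mul_inv (l : SO N) :
    MeasurePreserving (fun k : SO N => l * k⁻¹) (haarSO N) (haarSO N) :=
  (measurePreserving_mul_left (haarSO N) l).comp measurePreserving_inv_SO

theorem measurePreserving_prod_mul_inv :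
    MeasurePreserving (fun p : SO N × SO N => (p.1, p.1 * p.2⁻¹))
      ((haarSO N).prod (haarSO N)) ((haarSO N).prod (haarSO N)) :=
  MeasurePreserving.skew_product (g := fun l k : SO N => l * k⁻¹) (MeasurePreserving.id _)
    (continuous_fst.mul continuous_snd.inv).measurable
    (Filter.Eventually.of_forall fun l => (measurePreserving_mul_inv l).map_eq)

theorem integral_mul_inv {E : Type*} [NormedAddCommGroup E] [NormedSpace ℝ E] (l : SO N)
    {F : SO N → E} (hF : AEStronglyMeasurable F (haarSO N)) :
    ∫ k, F (l * k⁻¹) ∂(haarSO N) = ∫ k, F k ∂(haarSO N) := by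
  have h := measurePreserving_mul_inv l
  conv_rhs => rw [← h.map_eq]
  rw [integral_map h.measurable.aemeasurable (by rwa [h.map_eq])]

section Vanishing

variable [NeZero N] {V : Type*} [NormedAddCommGroup V] [InnerProductSpace ℂ V]
  [FiniteDimensional ℂ V]

theorem integrable_covariantL2 {ξ : UnitaryIrrep (isotropy N) V} (w : covariantL2 ξ) :
    Integrable w.1 (haarSO N) :=
  (Lp.memLp w.1).integrable one_le_two

/-- By covariance and left invariance of dk the integral is fixed by all of M. The fixed vectors
form an invariant subspace, which is zero for a nontrivial irreducible ξ. -/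
theorem integral_covariantL2_eq_zero {ξ : UnitaryIrrep (isotropy N) V} (hξ : ¬ ξ.IsTrivial)
    (w : covariantL2 ξ) : ∫ k, w.1 k ∂(haarSO N) = 0 := by
  have hV : CompleteSpace V := FiniteDimensional.complete ℂ V
  set W : Submodule ℂ V :=
    { carrier := {v | ∀ m, ξ.toHom m v = v}
      zero_mem' := fun m => map_zero _
      add_mem' := fun {v v'} hv hv' m => by rw [map_add, hv m, hv' m]
      smul_mem' := fun c v hv m => by rw [map_smul, hv m] } with hW
  have hmem : ∫ k, w.1 k ∂(haarSO N) ∈ W := by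
    intro m
    have h1 : ξ.toHom m (∫ k, w.1 k ∂(haarSO N)) = ∫ k, ξ.toHom m (w.1 k) ∂(haarSO N) :=
      ((ξ.toHom m).toContinuousLinearEquiv.integral_comp_comm _).symm
    rw [h1, ← integral_congr_ae (w.2 m)]
    exact integral_mul_left_eq_self (fun k => w.1 k) (m : SO N)
  rcases ξ.irreducible W (fun g v hv m => by rw [hv g, hv m]) with h | h
  · rw [h] at hmem
    exact (Submodule.mem_bot ℂ).1 hmem
  · refine absurd (fun g v => ?_) hξ
    have : v ∈ W := by rw [h]; trivial
    exact this g

theorem integrable_inner_covariantL2 {ξ : UnitaryIrrep (isotropy N) V} (u w : covariantL2 ξ) :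
    Integrable (fun p : SO N × SO N => ⟪u.1 p.1, w.1 p.2⟫_ℂ) ((haarSO N).prod (haarSO N)) := by
  refine ((integrable_covariantL2 u).norm.mul_prod (integrable_covariantL2 w).norm).mono' ?_
    (Filter.Eventually.of_forall fun p => norm_inner_le_norm _ _)
  exact ((Lp.stronglyMeasurable u.1).comp_measurable measurable_fst).aestronglyMeasurable.inner
    ((Lp.stronglyMeasurable w.1).comp_measurable measurable_snd).aestronglyMeasurable

/-- For fixed l the integral over k is, by invariance under inversion and translation, the full
integral of w, which vanishes. -/
theorem integral_integral_inner_eq_zero {ξ : UnitaryIrrep (isotropy N) V} (hξ : ¬ ξ.IsTrivial)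
    (u w : covariantL2 ξ) :
    ∫ k, ∫ l, ⟪u.1 l, w.1 (l * k⁻¹)⟫_ℂ ∂(haarSO N) ∂(haarSO N) = 0 := by
  have hV : CompleteSpace V := FiniteDimensional.complete ℂ V
  have hi := measurePreserving_prod_mul_inv.integrable_comp_of_integrable
    (integrable_inner_covariantL2 u w)
  rw [integral_integral_swap (f := fun k l => ⟪u.1 l, w.1 (l * k⁻¹)⟫_ℂ) hi.swap]
  refine integral_eq_zero_of_ae (Filter.Eventually.of_forall fun l => ?_)
  have h1 := integral_mul_inv l (F := fun p => ⟪u.1 l, w.1 p⟫_ℂ)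
    (aestronglyMeasurable_const.inner (Lp.aestronglyMeasurable w.1))
  change ∫ k, ⟪u.1 l, w.1 (l * k⁻¹)⟫_ℂ ∂(haarSO N) = 0
  rw [h1, integral_inner (integrable_covariantL2 w), integral_covariantL2_eq_zero hξ,
    inner_zero_right]

/-- The translation part of g⁻¹ is -k⁻¹ a. Moving the rotations over to e₁ exhibits the phase as a
character of a, whose frequency has length ω for every k and l when ω ≥ 0. -/
theorem phase_neg_rot (ω : ℝ) (a : Pt N) (k l : SO N) :
    phase ω (-rot k⁻¹ a) l =
      Complex.exp (-Complex.I * ⟪ω • rot (l * k⁻¹)⁻¹ (e₁ N), a⟫_ℝ) := by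
  have h : ⟪e₁ N, rot l (rot k⁻¹ a)⟫_ℝ = ⟪rot (l * k⁻¹)⁻¹ (e₁ N), a⟫_ℝ := by
    rw [← LinearIsometryEquiv.inner_map_map (rot (l * k⁻¹)) (rot (l * k⁻¹)⁻¹ (e₁ N)) a,
      ← rot_mul (l * k⁻¹) (l * k⁻¹)⁻¹, mul_inv_cancel, rot_one, rot_mul]
  unfold phase
  rw [map_neg, inner_neg_right, h, real_inner_smul_left]
  congr 1
  push_cast
  ring

theorem inner_principalSeries (ω : ℝ) (ξ : UnitaryIrrep (isotropy N) V) (g : ISO N)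
    (u w : covariantL2 ξ) :
    ⟪u, principalSeries ω ξ g⁻¹ w⟫_ℂ = ∫ l,
      Complex.exp (-Complex.I * ⟪ω • rot (l * g.1⁻¹)⁻¹ (e₁ N), g.2⟫_ℝ) *
        ⟪u.1 l, w.1 (l * g.1⁻¹)⟫_ℂ ∂(haarSO N) := by
  change ⟪u.1, (memLp_principal ω g⁻¹ w.1).toLp⟫_ℂ = _
  rw [L2.inner_def]
  refine integral_congr_ae ?_
  filter_upwards [(memLp_principal ω g⁻¹ w.1).coeFn_toLp] with l hl
  rw [hl, inner_smul_right]
  congr 1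
  exact phase_neg_rot ω g.2 g.1 l

theorem norm_rot_e₁ (k : SO N) : ‖rot k (e₁ N)‖ = 1 := by
  rw [LinearIsometryEquiv.norm_map]
  simp [e₁]

/-- Integrate over a first: for each l this is the Fourier transform of η at a point of the sphere
of radius ω. -/
theorem integral_translation_eq_zero {ω : ℝ} (hω : 0 ≤ ω) {ξ : UnitaryIrrep (isotropy N) V}
    {η : Pt N → ℂ} (hηi : Integrable η)
    (hη : ∀ v : Pt N, ‖v‖ = ω → ∫ a, η a * Complex.exp (-Complex.I * ⟪v, a⟫_ℝ) = 0)
    (u w : covariantL2 ξ) {k : SO N}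
    (hk : Integrable (fun l => ⟪u.1 l, w.1 (l * k⁻¹)⟫_ℂ) (haarSO N)) :
    ∫ a, η a * ∫ l, Complex.exp (-Complex.I * ⟪ω • rot (l * k⁻¹)⁻¹ (e₁ N), a⟫_ℝ) *
        ⟪u.1 l, w.1 (l * k⁻¹)⟫_ℂ ∂(haarSO N) = 0 := by
  set E : Pt N → SO N → ℂ := fun a l =>
    Complex.exp (-Complex.I * ⟪ω • rot (l * k⁻¹)⁻¹ (e₁ N), a⟫_ℝ) with hE
  have hEc : Continuous fun p : Pt N × SO N => E p.1 p.2 := by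
    have h1 : Continuous fun p : Pt N × SO N => rot (p.2 * k⁻¹)⁻¹ (e₁ N) :=
      continuous_rot.comp ((continuous_snd.mul continuous_const).inv.prodMk continuous_const)
    exact Complex.continuous_exp.comp (continuous_const.mul
      (Complex.continuous_ofReal.comp ((h1.const_smul ω).inner continuous_fst)))
  have hEn : ∀ a l, ‖E a l‖ = 1 := fun a l => by
    have : E a l = Complex.exp (((-⟪ω • rot (l * k⁻¹)⁻¹ (e₁ N), a⟫_ℝ : ℝ) : ℂ) * Complex.I) := by
      simp only [hE]
      congr 1
      push_cast
      ring
    rw [this, Complex.norm_exp_ofReal_mul_I]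
  have hint : Integrable (fun p : Pt N × SO N =>
      E p.1 p.2 * (η p.1 * ⟪u.1 p.2, w.1 (p.2 * k⁻¹)⟫_ℂ)) (volume.prod (haarSO N)) :=
    (hηi.mul_prod hk).bdd_mul hEc.aestronglyMeasurable
      (Filter.Eventually.of_forall fun p => (hEn p.1 p.2).le)
  have e1 : ∀ a, η a * ∫ l, E a l * ⟪u.1 l, w.1 (l * k⁻¹)⟫_ℂ ∂(haarSO N) =
      ∫ l, E a l * (η a * ⟪u.1 l, w.1 (l * k⁻¹)⟫_ℂ) ∂(haarSO N) := fun a => by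
    rw [← integral_const_mul]
    refine integral_congr_ae (Filter.Eventually.of_forall fun l => ?_)
    simp only
    ring
  change ∫ a, η a * ∫ l, E a l * ⟪u.1 l, w.1 (l * k⁻¹)⟫_ℂ ∂(haarSO N) = 0
  simp only [e1]
  rw [integral_integral_swap (f := fun a l => E a l * (η a * ⟪u.1 l, w.1 (l * k⁻¹)⟫_ℂ)) hint]
  refine integral_eq_zero_of_ae (Filter.Eventually.of_forall fun l => ?_)
  have e2 : ∀ a, E a l * (η a * ⟪u.1 l, w.1 (l * k⁻¹)⟫_ℂ) =
      (η a * E a l) * ⟪u.1 l, w.1 (l * k⁻¹)⟫_ℂ := fun a => by ring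
  change ∫ a, E a l * (η a * ⟪u.1 l, w.1 (l * k⁻¹)⟫_ℂ) = 0
  simp only [e2]
  rw [integral_mul_const]
  simp only [hE]
  rw [hη _ (by rw [norm_smul, norm_rot_e₁, mul_one, Real.norm_of_nonneg hω]), zero_mul]

theorem integrable_test_principalSeries (ω : ℝ) (ξ : UnitaryIrrep (isotropy N) V)
    {η : Pt N → ℂ} (hηi : Integrable η) (u w : covariantL2 ξ) :
    Integrable (fun p : SO N × Pt N => η p.2 * ∫ l,
      Complex.exp (-Complex.I * ⟪ω • rot (l * p.1⁻¹)⁻¹ (e₁ N), p.2⟫_ℝ) *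
        ⟪u.1 l, w.1 (l * p.1⁻¹)⟫_ℂ ∂(haarSO N)) ((haarSO N).prod volume) := by
  have hc : Continuous fun q : (SO N × Pt N) × SO N =>
      Complex.exp (-Complex.I * ⟪ω • rot (q.2 * q.1.1⁻¹)⁻¹ (e₁ N), q.1.2⟫_ℝ) := by
    have h1 : Continuous fun q : (SO N × Pt N) × SO N => rot (q.2 * q.1.1⁻¹)⁻¹ (e₁ N) :=
      continuous_rot.comp ((continuous_snd.mul
        (continuous_fst.comp continuous_fst).inv).inv.prodMk continuous_const)
    exact Complex.continuous_exp.comp (continuous_const.mul (Complex.continuous_ofReal.comp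
      ((h1.const_smul ω).inner (continuous_snd.comp continuous_fst))))
  have hs : StronglyMeasurable fun q : (SO N × Pt N) × SO N =>
      Complex.exp (-Complex.I * ⟪ω • rot (q.2 * q.1.1⁻¹)⁻¹ (e₁ N), q.1.2⟫_ℝ) *
        ⟪u.1 q.2, w.1 (q.2 * q.1.1⁻¹)⟫_ℂ :=
    hc.stronglyMeasurable.mul (((Lp.stronglyMeasurable u.1).comp_measurable measurable_snd).inner
      ((Lp.stronglyMeasurable w.1).comp_measurable (continuous_snd.mul
        (continuous_fst.comp continuous_fst).inv).measurable))
  have hη2 : Integrable (fun p : SO N × Pt N => η p.2) ((haarSO N).prod volume) := by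
    simpa using (integrable_const (1 : ℂ)).mul_prod (μ := haarSO N) hηi
  refine hη2.mul_bdd (c := ‖u‖ * ‖w‖) hs.integral_prod_right'.aestronglyMeasurable
    (Filter.Eventually.of_forall fun p => ?_)
  -- The inner integral is a matrix coefficient of a unitary operator, hence bounded by ‖u‖ ‖w‖,
  -- although its integrand need not be bounded.
  have h := inner_principalSeries ω ξ (p : ISO N) u w
  have h2 := norm_inner_le_norm (𝕜 := ℂ) u (principalSeries ω ξ (p : ISO N)⁻¹ w)
  rw [LinearIsometry.norm_map, h] at h2
  exact h2

/-- The Fourier transform at `π_{ωξ}` of a test function on the translations vanishes. -/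
theorem integral_test_principalSeries_eq_zero {ω : ℝ} (hω : 0 ≤ ω)
    {ξ : UnitaryIrrep (isotropy N) V} (hne : ¬(ω = 0 ∧ ξ.IsTrivial))
    {η : Pt N → ℂ} (hηi : Integrable η)
    (hη : ω ≠ 0 → ∀ v : Pt N, ‖v‖ = ω → ∫ a, η a * Complex.exp (-Complex.I * ⟪v, a⟫_ℝ) = 0)
    (u w : covariantL2 ξ) :
    ∫ g, η g.2 * ⟪u, principalSeries ω ξ g⁻¹ w⟫_ℂ ∂(haarISO N) = 0 := by
  have hI := integrable_test_principalSeries ω ξ hηi u w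
  simp only [inner_principalSeries]
  -- For ω = 0 the phase disappears and the rotations must produce the cancellation, so they are
  -- integrated first. For ω ≠ 0 the translations do so, for any ξ.
  by_cases h0 : ω = 0
  · refine (integral_prod_symm _ hI).trans ?_
    refine integral_eq_zero_of_ae (Filter.Eventually.of_forall fun a => ?_)
    simp only [h0, zero_smul, inner_zero_left, Complex.ofReal_zero, mul_zero, Complex.exp_zero,
      one_mul]
    rw [integral_const_mul, integral_integral_inner_eq_zero (fun h => hne ⟨h0, h⟩), mul_zero]
    rfl
  · refine (integral_prod _ hI).trans ?_
    refine integral_eq_zero_of_ae ?_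
    have hi := (measurePreserving_prod_mul_inv.integrable_comp_of_integrable
      (integrable_inner_covariantL2 u w)).prod_left_ae
    filter_upwards [hi] with k hk
    exact integral_translation_eq_zero hω hηi (hη h0) u w hk

end Vanishing

end EuclideanSpin

end

/-! ### Assembly of the theorem -/

theorem theoremC1 (N r : ℕ) [NeZero N]
    (𝓣 : L2 (Conf N r) →L[ℂ] L2 (Conf N r)) (T : Conf N r → Conf N r → ℝ)
    (hT : IsTransferOperator 𝓣 T) (hinv : IsInvariant 𝓣) :
    -- the equivariant ground state sectors are trivial except for the singlet,
    (∀ (ω : ℝ) (V : Type*) [NormedAddCommGroup V] [InnerProductSpace ℂ V]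
        [FiniteDimensional ℂ V] (ξ : UnitaryIrrep (isotropy N) V),
        0 ≤ ω → ¬(ω = 0 ∧ ξ.IsTrivial) →
        equivariantGroundSector 𝓣 T (principalSeries ω ξ) = {0}) ∧
    -- which accounts for the whole ground state sector;
    equivariantGroundSector 𝓣 T (singletRep N) = (groundSector 𝓣 T : Set (AEFun N r)) ∧
    ∃ T₀₀ : invL2 N r →L[ℂ] invL2 N r, IsSingletFiber T T₀₀ ∧
      -- the ground state sector is isometric to that of the singlet component,
      -- through functions of the differences,
      (∃ τ : opGroundSector T₀₀ ≃ₗ[ℂ] groundSector 𝓣 T, ∀ f : opGroundSector T₀₀,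
        normSup2 (τ f).1 = ENNReal.ofReal ‖f‖ ∧
        ∀ᵐ x : Conf N r, (τ f).1 x = f.1.1 (diffs x)) ∧
      -- and the ground state, if any, is unique, strictly positive and not normalizable.
      (Module.End.HasEigenvalue (T₀₀ : Module.End ℂ (invL2 N r)) (‖𝓣‖ : ℂ) →
        ∃ ψ ∈ groundSector 𝓣 T,
          (∀ᵐ x : Conf N r, (ψ x).im = 0 ∧ 0 < (ψ x).re) ∧
          (∃ f : invL2 N r, ∀ᵐ x : Conf N r, ψ x = f.1 (diffs x)) ∧
          (∀ Ω ∈ groundSector 𝓣 T, ∃ c : ℂ, Ω = c • ψ) ∧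
          ¬ MemLp ψ 2 volume) := by
  have hK := hT.isInvariantKernel hinv
  have hκ := isFiberBound_nnnorm hT hK
  refine ⟨?_, ?_, singletFiber hK hκ, isSingletFiber_singletFiber hK hκ,
    ⟨groundSectorEquiv hT hK hκ, fun f => ⟨normSup2_pullback f.1, pullback_apply f.1⟩⟩, ?_⟩
  · intro ω V _ _ _ ξ hω hne
    refine Set.eq_singleton_iff_unique_mem.2
      ⟨⟨zero_mem _, isEquivariant_zero _⟩, fun Ω hΩ => ?_⟩
    -- Every ground state is already a function of the differences, so only such functions have to
    -- be tested for equivariance.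
    obtain ⟨f, rfl⟩ := exists_pullback_eq hT hK hΩ.1
    obtain ⟨η, hηm, hηi, hη0, hη⟩ := exists_testFunction N ω
    rw [eq_zero_of_isEquivariant_pullback hηm hηi hη0
      (integral_test_principalSeries_eq_zero hω hne hηi hη) hΩ.2, map_zero]
  · refine Set.Subset.antisymm (fun Ω hΩ => hΩ.1) fun Ω hΩ => ⟨hΩ, ?_⟩
    obtain ⟨f, rfl⟩ := exists_pullback_eq hT hK hΩ
    exact isEquivariant_singletRep_pullback f
  · intro h
    obtain ⟨f, hf⟩ := h.exists_hasEigenvector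
    exact exists_unique_groundState hT hK hκ hf.2 hf.apply_eq_smul
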